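/- Let $T>0$ and let $\mathbb D^p=\mathbb D([0,T]\to\mathbb R^p)$ be the space of càdlàg functions with the sup norm $\|w\|=\sup_t|w(t)|$ ($|\cdot|$ Euclidean) and the $\sigma$-field generated by the coordinate maps. For a twice Fréchet differentiable $g:\mathbb D^p\to\mathbb R$ put $$\|g\|_M=\sup_w\frac{|g(w)|}{1+\|w\|^3}+\sup_w\frac{\|Dg(w)\|}{1+\|w\|^2}+\sup_w\frac{\|D^2g(w)\|}{1+\|w\|}+\sup_{w,h}\frac{\|D^2g(w+h)-D^2g(w)\|}{\|h\|},$$ where $\|A\|=\sup_{\|w\|=1}|A[w,\dots,w]|$, and let $M$ be the set of such $g$ with $\|g\|_M<\infty$. Let $N$ be a (locally finite) simple point process on $\mathbb R^d$ with $\sigma$-finite mean measure $\lambda$, let $\sigma>0$, and let $J_u\in\mathbb D^p$ ($u\in\mathbb R^d$) be such that $(u,s)\mapsto J_u(s)$ is measurable, $J_\cdot(s)\in L^2(\lambda)$ for every $s$, and $\int\|J_u\|\,\lambda(du)<\infty$ (so that the following integrals converge absolutely in $\mathbb D^p$ almost surely). Put $$X(s)=\int J_u(s)\,N(du),\qquad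 \widetilde X(s)=\int J_u(s)\,\widetilde N(du),\qquad \widetilde N=\sigma^{-1}(N-\lambda).$$ Let $\Lambda$ be a measure on $\mathbb R^d$, let $\widehat J_u\in\mathbb D^p$ be such that $(u,s)\mapsto\widehat J_u(s)$ is measurable and $\widehat J_\cdot(s)\in L^2(\Lambda)$ for every $s$, and let $Z$ be a centred $\mathbb R^p$-valued Gaussian process on $[0,T]$ with almost surely continuous paths and $$\mathbb E[Z(s)Z(t)^\top]=\int\widehat J_u(s)\widehat J_u(t)^\top\,\Lambda(du),\qquad s,t\in[0,T].$$ Let $g\in M$ be measurable, and let $$f(w)=-\int_0^\infty\Big(\mathbb E\,g\big(we^{-s}+\sqrt{1-e^{-2s}}\,Z\big)-\mathbb E\,g(Z)\Big)ds .$$ Then these expectations and the integral exist, and $f\in M$. **General bound.** Let $(N^u)_{u\in\mathbb R^d}$ be random measures on the probability space of $N$, jointly measurable in $u$ and $\omega$, that couple $N$ with its reduced Palm measures, i.e. $\mathbb E\int h(N,u)\,N(du)=\mathbb E\int h(N^u+\delta_u,u)\,\lambda(du)$ for all measurable $h\ge0$. Put $X^u(s)=\int J_v(s)\,N^u(dv)$.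 Then $$\begin{aligned}|\mathbb E g(\widetilde X)-\mathbb E g(Z)|\le{}&\Big|\mathbb E\Big[\int D^2f(\widetilde X)[\widehat J_u,\widehat J_u]\,\Lambda(du)-\int D^2f(\widetilde X)\big[J_u,\mathbb E[X^u-X+J_u]\big]\,\sigma^{-2}\lambda(du)\Big]\Big|\\&+\Big|\mathbb E\int D^2f(\widetilde X)\big[J_u,(X^u-X)-\mathbb E[X^u-X]\big]\,\sigma^{-2}\lambda(du)\Big|\\&+\frac{\|g\|_M}{2\sigma}\,\mathbb E\int\|J_u\|\,\|X^u-X+J_u\|^2\,\sigma^{-2}\lambda(du).\end{aligned}$$ If the last expectation is infinite, the bound is understood as void (when $\|g\|_M\neq 0$); if it is finite, all the other expectations and integrals exist: $g(\widetilde X)$ is integrable; for $\lambda$-almost every $u$ with $J_u\ne0$ the function $s\mapsto\mathbb E[X^u(s)-X(s)]$ exists and is càdlàg; $D^2f(w)[\widehat J_u,\widehat J_u]$ is $\Lambda$-integrable in $u$ for every $w\in\mathbb D^p$, and its integral at $w=\widetilde X$ has finite expectation; and the integrands of the two integrals against $\sigma^{-2}\lambda(du)$ in the first two lines are integrable with respect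 to $\mathbb P\otimes\sigma^{-2}\lambda$. **Poisson case.** If $N$ is a Poisson process with intensity $\lambda$, $\Lambda=\sigma^{-2}\lambda$ and $\widehat J_u=J_u$ for all $u$, then $$|\mathbb E g(\widetilde X)-\mathbb E g(Z)|\le\frac{\|g\|_M}{2\sigma}\int\|J_u\|^3\,\sigma^{-2}\lambda(du),$$ and $g(\widetilde X)$ is integrable if the right-hand integral is finite. -/

import Mathlib

open MeasureTheory ProbabilityTheory Filter Topology Set
open scoped ENNReal NNReal

noncomputable section

/-- `ℝᵏ` with the Euclidean norm. -/
abbrev Euc (k : ℕ) : Type := EuclideanSpace ℝ (Fin k)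

/-- Right continuous with left limits at every point of `[0,T]` (the left limit at `0` and the right
continuity at `T` are void, as `[0,T]` is the whole space). -/
def IsCadlag {T : ℝ} {p : ℕ} (x : Icc (0 : ℝ) T → Euc p) : Prop :=
  ∀ t, ContinuousWithinAt x (Ici t) t ∧ ∃ l, Tendsto x (𝓝[<] t) (𝓝 l)

/-- A càdlàg function on `[0,T]` is bounded. -/
theorem IsCadlag.bounded {T : ℝ} {p : ℕ} {x : Icc (0 : ℝ) T → Euc p} (hx : IsCadlag x) :
    ∃ C, ∀ t, ‖x t‖ ≤ C := by
  have key : ∃ C, ∀ t ∈ (univ : Set (Icc (0 : ℝ) T)), ‖x t‖ ≤ C := by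
    refine isCompact_univ.induction_on (p := fun s => ∃ C, ∀ t ∈ s, ‖x t‖ ≤ C)
      ⟨0, by simp⟩ ?_ ?_ ?_
    · rintro s t hst ⟨C, hC⟩
      exact ⟨C, fun r hr => hC r (hst hr)⟩
    · rintro s t ⟨C, hC⟩ ⟨C', hC'⟩
      refine ⟨max C C', fun r hr => ?_⟩
      rcases hr with hr | hr
      · exact (hC r hr).trans (le_max_left _ _)
      · exact (hC' r hr).trans (le_max_right _ _)
    · intro t _
      obtain ⟨h1, l, h2⟩ := hx t
      have e1 : ∀ᶠ r in 𝓝[≥] t, ‖x r‖ < ‖x t‖ + 1 :=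
        h1.norm.eventually_lt_const (lt_add_one _)
      have e2 : ∀ᶠ r in 𝓝[<] t, ‖x r‖ < ‖l‖ + 1 :=
        h2.norm.eventually_lt_const (lt_add_one _)
      have e : ∀ᶠ r in 𝓝 t, ‖x r‖ ≤ max (‖x t‖ + 1) (‖l‖ + 1) := by
        rw [← nhdsLT_sup_nhdsGE t, eventually_sup]
        exact ⟨e2.mono fun r hr => hr.le.trans (le_max_right _ _),
          e1.mono fun r hr => hr.le.trans (le_max_left _ _)⟩
      exact ⟨{r | ‖x r‖ ≤ max (‖x t‖ + 1) (‖l‖ + 1)}, mem_nhdsWithin_of_mem_nhds e, _, fun r hr => hr⟩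
  obtain ⟨C, hC⟩ := key
  exact ⟨C, fun t => hC t (mem_univ t)⟩

/-- The càdlàg functions, as a subspace of the bounded functions `[0,T] → ℝᵖ` with the sup norm
`‖x‖ = sup_t |x(t)|`. -/
def cadlagSubmodule (T : ℝ) (p : ℕ) :
    Submodule ℝ (lp (fun _ : Icc (0 : ℝ) T => Euc p) ∞) where
  carrier := {x | IsCadlag (fun t => x t)}
  add_mem' := by
    intro x y hx hy t
    obtain ⟨h1, l, h2⟩ := hx t
    obtain ⟨h3, m, h4⟩ := hy t
    exact ⟨h1.add h3, l + m, h2.add h4⟩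
  zero_mem' := fun t => ⟨continuousWithinAt_const, 0, tendsto_const_nhds⟩
  smul_mem' := by
    intro c x hx t
    obtain ⟨h1, l, h2⟩ := hx t
    exact ⟨h1.const_smul c, c • l, h2.const_smul c⟩

/-- The space `𝔻ᵖ = 𝔻([0,T] → ℝᵖ)` of càdlàg functions with the sup norm. -/
def Cadlag (T : ℝ) (p : ℕ) : Type := cadlagSubmodule T p

instance {T : ℝ} {p : ℕ} : NormedAddCommGroup (Cadlag T p) :=
  inferInstanceAs (NormedAddCommGroup (cadlagSubmodule T p))

instance {T : ℝ} {p : ℕ} : NormedSpace ℝ (Cadlag T p) :=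
  inferInstanceAs (NormedSpace ℝ (cadlagSubmodule T p))

instance {T : ℝ} {p : ℕ} : CoeFun (Cadlag T p) (fun _ => Icc (0 : ℝ) T → Euc p) :=
  ⟨fun x => x.1.1⟩

/-- The σ-field on `𝔻ᵖ` generated by the coordinate maps `x ↦ x(t)` (it is the Borel σ-field of the
Skorokhod topology). -/
instance {T : ℝ} {p : ℕ} : MeasurableSpace (Cadlag T p) :=
  MeasurableSpace.comap (fun (x : Cadlag T p) (t : Icc (0 : ℝ) T) => x t) MeasurableSpace.pi

open Classical in
/-- A function `[0,T] → ℝᵖ` as an element of `𝔻ᵖ`; the value is `0` if it is not càdlàg. -/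
def toCadlag {T : ℝ} {p : ℕ} (x : Icc (0 : ℝ) T → Euc p) : Cadlag T p :=
  if h : IsCadlag x then
    ⟨⟨x, memℓp_infty ⟨h.bounded.choose, by
      rintro _ ⟨t, rfl⟩
      exact h.bounded.choose_spec t⟩⟩, h⟩
  else 0

theorem toCadlag_apply {T : ℝ} {p : ℕ} {x : Icc (0 : ℝ) T → Euc p} (h : IsCadlag x)
    (t : Icc (0 : ℝ) T) : toCadlag x t = x t := by
  simp [toCadlag, h]

/-! ### Test functions -/

/-- The second Fréchet derivative `D²g(w)`, as a bilinear form. -/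
def D2 {T : ℝ} {p : ℕ} (g : Cadlag T p → ℝ) (w : Cadlag T p) :
    Cadlag T p →L[ℝ] Cadlag T p →L[ℝ] ℝ :=
  fderiv ℝ (fderiv ℝ g) w

/-- The norm `‖A‖ = sup_{‖w‖ = 1} |A[w,w]|` of a bilinear form. -/
def quadNorm {T : ℝ} {p : ℕ} (A : Cadlag T p →L[ℝ] Cadlag T p →L[ℝ] ℝ) : ℝ≥0∞ :=
  ⨆ (w : Cadlag T p) (_ : ‖w‖ = 1), ‖A w w‖ₑ

/-- The norm `‖g‖_M`, with values in `[0,∞]`. -/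
def normM {T : ℝ} {p : ℕ} (g : Cadlag T p → ℝ) : ℝ≥0∞ :=
  (⨆ w, ‖g w‖ₑ / (1 + ‖w‖ₑ ^ 3)) + (⨆ w, ‖fderiv ℝ g w‖ₑ / (1 + ‖w‖ₑ ^ 2))
    + (⨆ w, quadNorm (D2 g w) / (1 + ‖w‖ₑ))
    + (⨆ (w : Cadlag T p) (h : Cadlag T p), quadNorm (D2 g (w + h) - D2 g w) / ‖h‖ₑ)

/-- The space `M` of twice Fréchet differentiable functions with `‖g‖_M < ∞`. -/
structure MemM {T : ℝ} {p : ℕ} (g : Cadlag T p → ℝ) : Prop where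
  differentiable : Differentiable ℝ g
  differentiable_fderiv : Differentiable ℝ (fderiv ℝ g)
  normM_lt_top : normM g < ∞

/-- The point `w e^{-s} + √(1 - e^{-2s}) z` of `𝔻ᵖ`. -/
def ouPoint {T : ℝ} {p : ℕ} (w : Cadlag T p) (s : ℝ) (z : Cadlag T p) : Cadlag T p :=
  Real.exp (-s) • w + Real.sqrt (1 - Real.exp (-2 * s)) • z

/-- The Stein solution
`f_g(w) = -∫₀^∞ (E g(w e^{-s} + √(1 - e^{-2s}) Z) - E g(Z)) ds`. -/
def steinSolution {T : ℝ} {p : ℕ} {Ω : Type*} [MeasurableSpace Ω] (Q : Measure Ω)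
    (Z : Ω → Cadlag T p) (g : Cadlag T p → ℝ) (w : Cadlag T p) : ℝ :=
  -∫ s in Ioi (0 : ℝ), ((∫ ω, g (ouPoint w s (Z ω)) ∂Q) - ∫ ω, g (Z ω) ∂Q)

/-! ### Point processes -/

/-- `N` is a (locally finite) simple point process on `ℝᵈ`: a random measure that is almost surely
the counting measure of a set with finitely many points in each ball. -/
structure IsSimplePointProcess {d : ℕ} {Ω : Type*} [MeasurableSpace Ω]
    (P : Measure Ω) (N : Ω → Measure (Euc d)) : Prop where
  measurable : Measurable N
  simple : ∀ᵐ ω ∂P, ∃ S : Set (Euc d),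
    (∀ r : ℝ, (S ∩ Metric.closedBall 0 r).Finite) ∧ N ω = Measure.count.restrict S

/-- `lam` is the mean measure of `N`. -/
def HasMeanMeasure {d : ℕ} {Ω : Type*} [MeasurableSpace Ω] (P : Measure Ω)
    (N : Ω → Measure (Euc d)) (lam : Measure (Euc d)) : Prop :=
  ∀ A, MeasurableSet A → lam A = ∫⁻ ω, N ω A ∂P

/-- The family `Nu u`, defined on the same probability space as `N` and jointly measurable, couples
`N` with its reduced Palm measures: `E ∫ h(N,u) N(du) = E ∫ h(Nᵘ + δ_u, u) lam(du)`. -/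
structure IsReducedPalmCoupling {d : ℕ} {Ω : Type*} [MeasurableSpace Ω] (P : Measure Ω)
    (N : Ω → Measure (Euc d)) (lam : Measure (Euc d)) (Nu : Euc d → Ω → Measure (Euc d)) :
    Prop where
  measurable : Measurable (fun q : Euc d × Ω => Nu q.1 q.2)
  palm : ∀ h : Measure (Euc d) × Euc d → ℝ≥0∞, Measurable h →
    ∫⁻ ω, ∫⁻ u, h (N ω, u) ∂(N ω) ∂P
      = ∫⁻ ω, ∫⁻ u, h (Nu u ω + Measure.dirac u, u) ∂lam ∂P

/-- `N` is a Poisson process with intensity `lam`: the number of points in a set of finite intensity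
is Poisson, and the numbers of points in disjoint sets are independent. -/
structure IsPoissonProcess {d : ℕ} {Ω : Type*} [MeasurableSpace Ω] (P : Measure Ω)
    (N : Ω → Measure (Euc d)) (lam : Measure (Euc d)) : Prop where
  law : ∀ A, MeasurableSet A → lam A ≠ ∞ →
    P.map (fun ω => N ω A) = (poissonMeasure (lam A).toNNReal).map (fun k : ℕ => (k : ℝ≥0∞))
  indep : ∀ (n : ℕ) (A : Fin n → Set (Euc d)), (∀ i, MeasurableSet (A i)) →
    Pairwise (fun i j => Disjoint (A i) (A j)) → iIndepFun (fun i ω => N ω (A i)) P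

/-! ### The processes -/

/-- The path `s ↦ ∫ J_u(s) n(du)`. -/
def integralPath {T : ℝ} {p d : ℕ} (J : Euc d → Cadlag T p) (n : Measure (Euc d)) : Cadlag T p :=
  toCadlag fun s => ∫ u, J u s ∂n

/-- The path `s ↦ ∫ J_u(s) σ⁻¹(n - lam)(du)`. -/
def centredPath {T : ℝ} {p d : ℕ} (J : Euc d → Cadlag T p) (lam : Measure (Euc d)) (σ : ℝ)
    (n : Measure (Euc d)) : Cadlag T p :=
  toCadlag fun s => σ⁻¹ • ((∫ u, J u s ∂n) - ∫ u, J u s ∂lam)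

/-- The pointwise expectation `s ↦ E[Y(s)]` of a random path. -/
def meanPath {T : ℝ} {p : ℕ} {Ω : Type*} [MeasurableSpace Ω] (P : Measure Ω)
    (Y : Ω → Cadlag T p) : Cadlag T p :=
  toCadlag fun s => ∫ ω, Y ω s ∂P

/-- `Z` is a centred Gaussian process on `[0,T]` with almost surely continuous paths and with
covariance `E[Z(s) Z(t)ᵀ] = ∫ J_u(s) J_u(t)ᵀ Λ(du)`. -/
structure IsCentredGaussianWithCov {T : ℝ} {p d : ℕ} {Ω : Type*} [MeasurableSpace Ω]
    (Q : Measure Ω) (Z : Icc (0 : ℝ) T → Ω → Euc p) (J : Euc d → Cadlag T p)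
    (Lam : Measure (Euc d)) : Prop where
  gaussian : IsGaussianProcess Z Q
  centred : ∀ s, ∫ ω, Z s ω ∂Q = 0
  continuous_paths : ∀ᵐ ω ∂Q, Continuous fun s => Z s ω
  cov : ∀ (s t : Icc (0 : ℝ) T) (i j : Fin p),
    ∫ ω, Z s ω i * Z t ω j ∂Q = ∫ u, J u s i * J u t j ∂Lam

end

/-!
Stein's method for a Gaussian law on the space of càdlàg paths. The function `f` is the Stein
solution of `g` for the Ornstein–Uhlenbeck semigroup of the law `γ` of `Z`. Differentiating under
the integral shows that `f` is again of class `M`, and the factor `e⁻³ˢ` picked up by third-order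
differences makes the Taylor remainder of `Df` at most `c/3 ‖h‖²` with `c = ‖g‖_M`
(`HasBounds.steinSolution_hasBounds`). Rotation invariance of `γ ⊗ γ` is Mehler's formula, and
comparing `E f(w e⁻ᵗ + √(1 - e⁻²ᵗ) Z) - f(w)` for small `t`, computed by the semigroup property and
by Taylor's formula, gives the Stein equation
`g(w) - E g(Z) = -Df(w)[w] + E D²f(w)[Z,Z]` (`HasBounds.stein_equation`).

The path space is not separable for the sup norm, and its σ-field is that of the coordinate maps, so
neither the measurability of functionals such as `Df(w)` nor the interchange of such functionals
with integrals of paths is automatic. Both rest on the following fact about a bounded bilinear form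
`B`: the times at which `B` has an atom to the right are countable (`countable_atomTimes`). Indeed
Riesz products of signs bound `∑ B(hᵢ, yᵢ)` over `m` indicators `hᵢ` of disjoint intervals by a
multiple of `√m`, which excludes infinitely many atoms of size more than `δ`. Replacing a path `x`
by the step function with the values of `x` on a time grid that exhausts the atoms therefore does not
change `B(x, ·)` in the limit (`IsTimeGrid.tendsto_bilin`), although it need not converge in norm.
As a consequence, functionals are measurable and commute with pointwise expectations of paths
(`clm_meanPath`), and the covariance identity extends from pairs of times to bilinear forms:
`E B(Z,Z) = ∫ B(Ĵ_u,Ĵ_u) Λ(du)` (`integral_bilin`). For the latter the forms of the discretized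
paths are Cauchy in `L¹(Λ)`, because the positive and negative parts of a quadratic form on a
finite-dimensional space are controlled by moments of a Gaussian vector.

Inserting the centred path integral `X̃` into the Stein equation leaves `E Df(X̃)[X̃]`. Palm's formula
(`IsReducedPalmCoupling.integral_clm`) rewrites it as the integral over `u` of the expected increment
of `Df[J_u]` between `X̃` and `X̃ + (Xᵘ - X + J_u)/σ`, and Taylor's formula replaces the increment by
`D²f(X̃)[J_u, Xᵘ - X + J_u]/σ` up to the stated remainder (`abs_integral_fderiv_sub_le`). The moments
of `X` this needs follow from the finiteness of the remainder term, each order from the previous one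
by Palm's formula (`hasPalmMoments`). Splitting `Xᵘ - X + J_u` into its mean and the centred part
gives the bound (`stein_bound`).

For a Poisson process Mecke's formula (`IsPoissonProcess.isReducedPalmCoupling`) permits the coupling
`Nᵘ = N`. It is proved for functions of the masses of the cells of a finite partition, where it is
the identity `E[K φ(K)] = r E[φ(K + 1)]` for a Poisson variable `K` with mean `r`, and extended by
uniqueness of measures. Then `Xᵘ - X = 0`, so the two second-order terms cancel or vanish.
-/


/-! ### The space of càdlàg functions -/

namespace Cadlag

variable {T : ℝ} {p : ℕ}

/-- The underlying function of a càdlàg path. -/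
noncomputable def path (x : Cadlag T p) : Icc (0 : ℝ) T → Euc p := fun t => x t

theorem ext {x y : Cadlag T p} (h : ∀ t, x.path t = y.path t) : x = y :=
  Subtype.ext (Subtype.ext (funext h))

@[simp] theorem add_apply (x y : Cadlag T p) (t : Icc (0 : ℝ) T) : (x + y).path t = x.path t + y.path t := rfl

@[simp] theorem sub_apply (x y : Cadlag T p) (t : Icc (0 : ℝ) T) : (x - y).path t = x.path t - y.path t := rfl

@[simp] theorem zero_apply (t : Icc (0 : ℝ) T) : (0 : Cadlag T p).path t = 0 := rfl

@[simp] theorem smul_apply (c : ℝ) (x : Cadlag T p) (t : Icc (0 : ℝ) T) : (c • x).path t = c • x.path t := rfl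

theorem sum_apply {ι : Type*} (s : Finset ι) (x : ι → Cadlag T p) (t : Icc (0 : ℝ) T) :
    (∑ i ∈ s, x i).path t = ∑ i ∈ s, (x i).path t := by
  classical
  induction s using Finset.induction_on with
  | empty => simp
  | insert a s ha ih => simp [Finset.sum_insert ha, ih]

theorem isCadlag (x : Cadlag T p) : IsCadlag x.path := x.2

theorem path_toCadlag {x : Icc (0 : ℝ) T → Euc p} (h : IsCadlag x) (t : Icc (0 : ℝ) T) :
    (toCadlag x).path t = x t :=
  toCadlag_apply h t

@[simp] theorem toCadlag_path (x : Cadlag T p) : toCadlag x.path = x :=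
  ext fun t => path_toCadlag x.isCadlag t

theorem norm_apply_le (x : Cadlag T p) (t : Icc (0 : ℝ) T) : ‖x.path t‖ ≤ ‖x‖ :=
  lp.norm_apply_le_norm (by simp) x.1 t

theorem norm_le {x : Cadlag T p} {C : ℝ} (hC : 0 ≤ C) (h : ∀ t, ‖x.path t‖ ≤ C) : ‖x‖ ≤ C :=
  lp.norm_le_of_forall_le (f := x.1) hC h

theorem norm_le_of_coord_le {x : Cadlag T p} {C : ℝ} (hC : 0 ≤ C) (h : ∀ t b, |x.path t b| ≤ C) :
    ‖x‖ ≤ √p * C := by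
  refine norm_le (by positivity) fun t => ?_
  rw [EuclideanSpace.norm_eq]
  calc √(∑ i, ‖x.path t i‖ ^ 2) ≤ √(∑ _i : Fin p, C ^ 2) := by
        refine Real.sqrt_le_sqrt (Finset.sum_le_sum fun i _ => ?_)
        exact pow_le_pow_left₀ (norm_nonneg _) (h t i) 2
    _ = √p * C := by
        simp [Real.sqrt_sq hC]

theorem measurable_eval (t : Icc (0 : ℝ) T) : Measurable (fun x : Cadlag T p => x.path t) :=
  (measurable_pi_apply t).comp (comap_measurable _)

theorem measurable_iff {α : Type*} [MeasurableSpace α] {f : α → Cadlag T p} :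
    Measurable f ↔ ∀ t, Measurable fun a => (f a).path t := by
  refine ⟨fun h t => (measurable_eval t).comp h, fun h => ?_⟩
  rw [measurable_comap_iff]
  exact measurable_pi_lambda _ h

instance : MeasurableAdd₂ (Cadlag T p) :=
  ⟨measurable_iff.2 fun t =>
    ((measurable_eval t).comp measurable_fst).add ((measurable_eval t).comp measurable_snd)⟩

instance : MeasurableSub₂ (Cadlag T p) :=
  ⟨measurable_iff.2 fun t =>
    ((measurable_eval t).comp measurable_fst).sub ((measurable_eval t).comp measurable_snd)⟩

instance : MeasurableNeg (Cadlag T p) := ⟨measurable_iff.2 fun t => (measurable_eval t).neg⟩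

instance : MeasurableSMul₂ ℝ (Cadlag T p) :=
  ⟨measurable_iff.2 fun t => measurable_fst.smul ((measurable_eval t).comp measurable_snd)⟩

/-- A countable dense set of times which contains `T`. -/
theorem exists_countable_times (T : ℝ) : ∃ D : Set (Icc (0 : ℝ) T), D.Countable ∧ Dense D ∧
    ∀ t, (∀ s, s ≤ t) → t ∈ D := by
  obtain ⟨D, hD, hd⟩ := TopologicalSpace.exists_countable_dense (Icc (0 : ℝ) T)
  refine ⟨D ∪ {t | ∀ s, s ≤ t}, hD.union ?_, hd.mono subset_union_left, fun t ht => Or.inr ht⟩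
  refine Set.Subsingleton.countable fun a ha b hb => le_antisymm (hb a) (ha b)

/-- By right continuity, a bound for a path holds everywhere once it holds on a dense set of times
which contains the last one. -/
theorem apply_mem_of_dense {x : Cadlag T p} {D : Set (Icc (0 : ℝ) T)} (hd : Dense D)
    (hlast : ∀ t, (∀ s, s ≤ t) → t ∈ D) {F : Set (Euc p)} (hF : IsClosed F) (h : ∀ t ∈ D, x.path t ∈ F)
    (t : Icc (0 : ℝ) T) : x.path t ∈ F := by
  by_cases ht : ∀ s, s ≤ t
  · exact h t (hlast t ht)
  push Not at ht
  obtain ⟨s, hs⟩ := ht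
  have hcl : t ∈ closure (D ∩ Ioi t) := by
    have := nhdsGT_neBot_of_exists_gt ⟨s, hs⟩
    have h2 : t ∈ closure (Ioi t) := mem_closure_iff_nhdsWithin_neBot.2 this
    rw [inter_comm]
    exact closure_minimal (hd.open_subset_closure_inter isOpen_Ioi) isClosed_closure h2
  have h1 : Tendsto (fun s => x.path s) (𝓝[D ∩ Ioi t] t) (𝓝 (x.path t)) :=
    (x.isCadlag t).1.tendsto.mono_left
      (nhdsWithin_mono _ (inter_subset_right.trans Ioi_subset_Ici_self))
  have := mem_closure_iff_nhdsWithin_neBot.1 hcl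
  exact hF.mem_of_tendsto h1 (eventually_mem_nhdsWithin.mono fun s hs => h s hs.1)

theorem norm_eq_iSup_enorm {D : Set (Icc (0 : ℝ) T)} (hd : Dense D)
    (hlast : ∀ t, (∀ s, s ≤ t) → t ∈ D) (x : Cadlag T p) : ‖x‖ₑ = ⨆ t ∈ D, ‖x.path t‖ₑ := by
  refine le_antisymm ?_ (iSup₂_le fun t _ => ?_)
  · by_cases htop : (⨆ t ∈ D, ‖x.path t‖ₑ) = ∞
    · simp [htop]
    rw [← ENNReal.ofReal_toReal htop, ← ofReal_norm]
    refine ENNReal.ofReal_le_ofReal (norm_le ENNReal.toReal_nonneg fun t => ?_)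
    refine apply_mem_of_dense (F := {v | ‖v‖ ≤ _}) hd hlast
      (isClosed_le continuous_norm continuous_const) (fun t ht => ?_) t
    rw [mem_ofPred_eq, ← toReal_enorm]
    exact ENNReal.toReal_mono htop (le_iSup₂ (f := fun t (_ : t ∈ D) => ‖x.path t‖ₑ) t ht)
  · exact enorm_le_iff_norm_le.2 (norm_apply_le x t)

theorem measurable_enorm : Measurable (fun x : Cadlag T p => ‖x‖ₑ) := by
  obtain ⟨D, hD, hd, hlast⟩ := exists_countable_times T
  simp_rw [norm_eq_iSup_enorm hd hlast]
  exact Measurable.biSup D hD fun t _ => (measurable_eval t).enorm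

theorem measurable_norm : Measurable (fun x : Cadlag T p => ‖x‖) := by
  simp_rw [← toReal_enorm]
  exact measurable_enorm.ennreal_toReal

/-- A continuous function of finitely many càdlàg paths is càdlàg. -/
theorem isCadlag_comp {ι : Type*} {Φ : (ι → Euc p) → Euc p} (hΦ : Continuous Φ)
    (y : ι → Cadlag T p) : IsCadlag fun t => Φ fun j => (y j).path t := by
  intro t
  have h := fun j => (y j).isCadlag t
  choose h1 l h2 using h
  exact ⟨hΦ.continuousAt.comp_continuousWithinAt (continuousWithinAt_pi.2 h1), Φ l,
    (hΦ.tendsto l).comp (tendsto_pi_nhds.2 h2)⟩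

/-- A function of time which depends only on which of finitely many times have passed is càdlàg. -/
theorem isCadlag_filter (τ : Finset (Icc (0 : ℝ) T)) (F : Finset (Icc (0 : ℝ) T) → Euc p) :
    IsCadlag fun s => F (τ.filter (· ≤ s)) := by
  intro t
  constructor
  · have h : ∀ᶠ s in 𝓝[≥] t, τ.filter (· ≤ s) = τ.filter (· ≤ t) := by
      have h1 : ∀ᶠ s in 𝓝[≥] t, ∀ r ∈ τ, (r ≤ s ↔ r ≤ t) := by
        refine (Finset.eventually_all τ).2 fun r _ => ?_
        by_cases hr : r ≤ t
        · filter_upwards [self_mem_nhdsWithin] with s hs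
          exact ⟨fun _ => hr, fun _ => hr.trans hs⟩
        · filter_upwards [mem_nhdsWithin_of_mem_nhds (Iio_mem_nhds (not_le.1 hr))] with s hs
          exact ⟨fun h => absurd hs (not_lt.2 h), fun h => absurd h hr⟩
      exact h1.mono fun s hs => Finset.filter_congr hs
    exact tendsto_const_nhds.congr' (h.mono fun s hs => congrArg F hs.symm)
  · have h : ∀ᶠ s in 𝓝[<] t, τ.filter (· ≤ s) = τ.filter (· < t) := by
      have h1 : ∀ᶠ s in 𝓝[<] t, ∀ r ∈ τ, (r ≤ s ↔ r < t) := by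
        refine (Finset.eventually_all τ).2 fun r _ => ?_
        by_cases hr : r < t
        · filter_upwards [mem_nhdsWithin_of_mem_nhds (Ioi_mem_nhds hr)] with s hs
          exact ⟨fun _ => hr, fun _ => le_of_lt hs⟩
        · filter_upwards [self_mem_nhdsWithin] with s hs
          exact ⟨fun h => lt_of_le_of_lt h hs, fun h => absurd h hr⟩
      exact h1.mono fun s hs => Finset.filter_congr hs
    exact ⟨_, tendsto_const_nhds.congr' (h.mono fun s hs => congrArg F hs.symm)⟩

/-- The path `v 1_{[a,r)}`. -/
noncomputable def block (a r : Icc (0 : ℝ) T) (v : Euc p) : Cadlag T p :=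
  toCadlag fun s => if a ≤ s ∧ s < r then v else 0

theorem block_apply (a r : Icc (0 : ℝ) T) (v : Euc p) (s : Icc (0 : ℝ) T) :
    (block a r v).path s = if a ≤ s ∧ s < r then v else 0 := by
  classical
  refine path_toCadlag ?_ s
  convert isCadlag_filter {a, r} (fun F => if a ∈ F ∧ r ∉ F then v else 0) using 3 with s
  simp

/-- The path `v 1_{[a,T]}`. -/
noncomputable def step (a : Icc (0 : ℝ) T) (v : Euc p) : Cadlag T p :=
  toCadlag fun s => if a ≤ s then v else 0

theorem step_apply (a : Icc (0 : ℝ) T) (v : Euc p) (s : Icc (0 : ℝ) T) :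
    (step a v).path s = if a ≤ s then v else 0 := by
  classical
  refine path_toCadlag ?_ s
  convert isCadlag_filter {a} (fun F => if a ∈ F then v else 0) using 3 with s
  simp

/-- The last time in the finite set `τ` which is at most `s` (an unspecified time if there is
none). -/
noncomputable def lastTime (τ : Finset (Icc (0 : ℝ) T)) (s : Icc (0 : ℝ) T) : Icc (0 : ℝ) T :=
  if h : (τ.filter (· ≤ s)).Nonempty then (τ.filter (· ≤ s)).max' h else Classical.choice ⟨s⟩

theorem isCadlag_lastTime (τ : Finset (Icc (0 : ℝ) T)) (F : Icc (0 : ℝ) T → Euc p) :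
    IsCadlag fun s => F (lastTime τ s) := by
  by_cases hne : Nonempty (Icc (0 : ℝ) T)
  · exact isCadlag_filter τ fun G => F (if h : G.Nonempty then G.max' h else Classical.choice hne)
  · exact fun t => absurd ⟨t⟩ hne

theorem lastTime_mem {τ : Finset (Icc (0 : ℝ) T)} {r s : Icc (0 : ℝ) T} (hr : r ∈ τ) (hrs : r ≤ s) :
    lastTime τ s ∈ τ ∧ r ≤ lastTime τ s ∧ lastTime τ s ≤ s := by
  have hr' : r ∈ τ.filter (· ≤ s) := Finset.mem_filter.2 ⟨hr, hrs⟩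
  have h : (τ.filter (· ≤ s)).Nonempty := ⟨r, hr'⟩
  have h1 := Finset.mem_filter.1 ((τ.filter (· ≤ s)).max'_mem h)
  rw [lastTime, dif_pos h]
  exact ⟨h1.1, Finset.le_max' _ _ hr', h1.2⟩

/-- The discretization of a path: on each interval between successive times of `τ` it is constant,
with the value of the path at the left end. -/
noncomputable def discretize (τ : Finset (Icc (0 : ℝ) T)) : Cadlag T p →ₗ[ℝ] Cadlag T p where
  toFun x := toCadlag fun s => x.path (lastTime τ s)
  map_add' x y := ext fun s => by
    rw [add_apply, path_toCadlag (isCadlag_lastTime τ _), path_toCadlag (isCadlag_lastTime τ _),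
      path_toCadlag (isCadlag_lastTime τ _), add_apply]
  map_smul' c x := ext fun s => by
    rw [RingHom.id_apply, smul_apply, path_toCadlag (isCadlag_lastTime τ _),
      path_toCadlag (isCadlag_lastTime τ _), smul_apply]

theorem discretize_apply (τ : Finset (Icc (0 : ℝ) T)) (x : Cadlag T p) (s : Icc (0 : ℝ) T) :
    (discretize τ x).path s = x.path (lastTime τ s) :=
  path_toCadlag (isCadlag_lastTime τ _) s

theorem norm_discretize_le (τ : Finset (Icc (0 : ℝ) T)) (x : Cadlag T p) :
    ‖discretize τ x‖ ≤ ‖x‖ :=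
  norm_le (norm_nonneg x) fun s => by rw [discretize_apply]; exact norm_apply_le x _

/-- The path which equals the `a`-th unit vector while the last time of `τ` is `r`, and `0`
otherwise. -/
noncomputable def cell (τ : Finset (Icc (0 : ℝ) T)) (r : Icc (0 : ℝ) T) (a : Fin p) : Cadlag T p :=
  toCadlag fun s => if lastTime τ s = r then EuclideanSpace.single a 1 else 0

theorem discretize_eq_sum {τ : Finset (Icc (0 : ℝ) T)} {r₀ : Icc (0 : ℝ) T} (hr₀ : r₀ ∈ τ)
    (hle : ∀ s, r₀ ≤ s) (x : Cadlag T p) :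
    discretize τ x = ∑ r ∈ τ, ∑ a, x.path r a • cell τ r a := by
  refine ext fun s => ?_
  rw [discretize_apply, sum_apply]
  have h1 : ∀ r ∈ τ, (∑ a, x.path r a • cell τ r a : Cadlag T p).path s
      = if lastTime τ s = r then x.path r else 0 := by
    intro r _
    rw [sum_apply]
    have h2 : ∀ a, (x.path r a • cell τ r a : Cadlag T p).path s
        = if lastTime τ s = r then x.path r a • EuclideanSpace.single a (1 : ℝ) else 0 := by
      intro a
      rw [smul_apply, cell, path_toCadlag (isCadlag_lastTime τ
        fun q => if q = r then EuclideanSpace.single a 1 else 0), smul_ite, smul_zero]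
    simp_rw [h2]
    split_ifs with h
    · ext b
      simp [Pi.single_apply]
    · simp
  rw [Finset.sum_congr rfl h1, Finset.sum_ite_eq, if_pos (lastTime_mem hr₀ (hle s)).1]

end Cadlag


/-! ### Riesz products and discretization -/

/-- The sign `±1` coded by a Boolean. -/
noncomputable def boolSign (b : Bool) : ℝ := if b then 1 else -1

theorem boolSign_sq (b : Bool) : boolSign b ^ 2 = 1 := by
  cases b <;> simp [boolSign]

/-- The Riesz product `Im ∏ⱼ (1 + i εⱼ cⱼ)`. -/
noncomputable def rieszProduct {ι : Type*} [Fintype ι] (c : ι → ℝ) (ε : ι → Bool) : ℝ :=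
  (∏ j, (1 + Complex.I * ((boolSign (ε j) * c j : ℝ) : ℂ))).im

theorem abs_rieszProduct_le {ι : Type*} [Fintype ι] (c : ι → ℝ) (ε : ι → Bool) :
    |rieszProduct c ε| ≤ Real.exp ((∑ j, c j ^ 2) / 2) := by
  refine (Complex.abs_im_le_norm _).trans ?_
  rw [norm_prod, Finset.sum_div, Real.exp_sum]
  refine Finset.prod_le_prod (fun _ _ => norm_nonneg _) fun j _ => ?_
  refine abs_le_of_sq_le_sq' ?_ (Real.exp_pos _).le |>.2
  rw [← Complex.normSq_eq_norm_sq, ← Real.exp_nat_mul]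
  have : Complex.normSq (1 + Complex.I * ((boolSign (ε j) * c j : ℝ) : ℂ)) = c j ^ 2 + 1 := by
    rw [Complex.normSq_apply]
    simp only [Complex.add_re, Complex.one_re, Complex.mul_re, Complex.I_re, Complex.ofReal_re,
      Complex.I_im, Complex.ofReal_im, Complex.add_im, Complex.one_im, Complex.mul_im]
    linear_combination (c j ^ 2) * boolSign_sq (ε j)
  rw [this]
  refine (Real.add_one_le_exp _).trans (le_of_eq ?_)
  push_cast
  ring_nf

/-- Averaging a Riesz product against one of the signs recovers the corresponding coefficient. -/
theorem sum_boolSign_mul_rieszProduct {ι : Type*} [Fintype ι] [DecidableEq ι] (c : ι → ℝ) (i : ι) :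
    ∑ ε : ι → Bool, boolSign (ε i) * rieszProduct c ε = 2 ^ Fintype.card ι * c i := by
  have h1 : ∀ ε : ι → Bool, boolSign (ε i) * rieszProduct c ε
      = (∏ j, ((if j = i then (boolSign (ε j) : ℂ) else 1)
          * (1 + Complex.I * ((boolSign (ε j) * c j : ℝ) : ℂ)))).im := by
    intro ε
    rw [Finset.prod_mul_distrib, Finset.prod_ite_eq' Finset.univ i, if_pos (Finset.mem_univ i),
      Complex.im_ofReal_mul, rieszProduct]
  simp_rw [h1]
  rw [← Complex.im_sum, ← Fintype.prod_sum (fun j b => (if j = i then (boolSign b : ℂ) else 1)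
          * (1 + Complex.I * ((boolSign b * c j : ℝ) : ℂ)))]
  have h2 : ∀ j, ∑ b : Bool, (if j = i then (boolSign b : ℂ) else 1)
          * (1 + Complex.I * ((boolSign b * c j : ℝ) : ℂ))
      = 2 * (if j = i then Complex.I * c i else 1) := by
    intro j
    by_cases h : j = i
    · subst h; simp [boolSign]; ring
    · simp [h, boolSign]; ring
  simp_rw [h2]
  rw [Finset.prod_mul_distrib, Finset.prod_ite_eq' Finset.univ i, if_pos (Finset.mem_univ i),
    Finset.prod_const, Finset.card_univ]
  rw [show (2 : ℂ) ^ Fintype.card ι * (Complex.I * c i)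
    = ((2 ^ Fintype.card ι * c i : ℝ) : ℂ) * Complex.I by push_cast; ring]
  rw [Complex.im_ofReal_mul, Complex.I_im, mul_one]

namespace Cadlag

variable {T : ℝ} {p : ℕ}

/-- A Grothendieck type bound for a bilinear form: along elements `hᵢ` all of whose signed sums are
in the unit ball, for instance indicators of disjoint intervals, the form only grows like the square
root of their number. -/
theorem sum_bilin_le (B : Cadlag T p →L[ℝ] Cadlag T p →L[ℝ] ℝ) {ι : Type*} [Fintype ι]
    (h y : ι → Cadlag T p) (hy : ∀ i, ‖y i‖ ≤ 1)
    (hh : ∀ ε : ι → Bool, ‖∑ i, boolSign (ε i) • h i‖ ≤ 1) :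
    ∑ i, B (h i) (y i) ≤ √(Fintype.card ι) * (‖B‖ * (√p * Real.exp (1 / 2))) := by
  classical
  rcases isEmpty_or_nonempty ι with hι | hι
  · simp
  set m : ℝ := ((Fintype.card ι : ℕ) : ℝ) with hm
  have hm0 : 0 < m := by rw [hm]; exact_mod_cast Fintype.card_pos
  have hsm : 0 < √m := Real.sqrt_pos.2 hm0
  let Φ : (ι → Bool) → (ι → Euc p) → Euc p := fun ε v =>
    WithLp.toLp 2 fun b => rieszProduct (fun j => v j b / √m) ε
  have hΦ : ∀ ε, Continuous (Φ ε) := by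
    intro ε
    refine (PiLp.continuous_toLp 2 _).comp (continuous_pi fun b => ?_)
    simp only [rieszProduct]
    fun_prop
  let Y : (ι → Bool) → Cadlag T p := fun ε => toCadlag fun t => Φ ε fun j => (y j).path t
  have hYapp : ∀ ε t, (Y ε).path t = Φ ε fun j => (y j).path t := fun ε t =>
    path_toCadlag (isCadlag_comp (hΦ ε) y) t
  have hYn : ∀ ε, ‖Y ε‖ ≤ √p * Real.exp (1 / 2) := by
    intro ε
    refine norm_le_of_coord_le (Real.exp_pos _).le fun t b => ?_
    rw [hYapp]
    refine (abs_rieszProduct_le _ ε).trans (Real.exp_le_exp.2 ?_)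
    have : ∀ j, ((y j).path t b / √m) ^ 2 ≤ 1 / m := by
      intro j
      rw [div_pow, Real.sq_sqrt hm0.le]
      gcongr
      rw [sq_le_one_iff_abs_le_one]
      exact (PiLp.norm_apply_le ((y j).path t) b).trans ((norm_apply_le _ t).trans (hy j))
    calc (∑ j, ((y j).path t b / √m) ^ 2) / 2 ≤ (∑ _j : ι, 1 / m) / 2 := by
          gcongr with j _
          exact this j
      _ = 1 / 2 := by
          rw [Finset.sum_const, Finset.card_univ, nsmul_eq_mul, ← hm]
          field_simp
  have havg : ∀ i, ∑ ε, boolSign (ε i) • Y ε = (2 ^ Fintype.card ι / √m) • y i := by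
    intro i
    refine ext fun t => ?_
    rw [sum_apply, smul_apply]
    ext b
    simp only [smul_apply, hYapp, WithLp.ofLp_sum, Finset.sum_apply, PiLp.smul_apply, smul_eq_mul, Φ]
    rw [sum_boolSign_mul_rieszProduct]
    ring
  have h2 : (0 : ℝ) < 2 ^ Fintype.card ι := by positivity
  have key : (2 ^ Fintype.card ι / √m) * ∑ i, B (h i) (y i)
      = ∑ ε, B (∑ i, boolSign (ε i) • h i) (Y ε) := by
    have : ∀ i, (2 ^ Fintype.card ι / √m) * B (h i) (y i)
        = ∑ ε, boolSign (ε i) * B (h i) (Y ε) := by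
      intro i
      rw [← smul_eq_mul, ← map_smul, ← havg, map_sum]
      simp
    rw [Finset.mul_sum, Finset.sum_congr rfl fun i _ => this i, Finset.sum_comm]
    refine Finset.sum_congr rfl fun ε _ => ?_
    simp [map_sum]
  have hle : (2 ^ Fintype.card ι / √m) * ∑ i, B (h i) (y i)
      ≤ 2 ^ Fintype.card ι * (‖B‖ * (√p * Real.exp (1 / 2))) := by
    rw [key]
    calc ∑ ε, B (∑ i, boolSign (ε i) • h i) (Y ε)
        ≤ ∑ _ε : ι → Bool, ‖B‖ * (√p * Real.exp (1 / 2)) := by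
          refine Finset.sum_le_sum fun ε _ => ?_
          refine (le_abs_self _).trans ((B.le_opNorm₂ _ _).trans ?_)
          rw [mul_assoc]
          refine mul_le_mul_of_nonneg_left ?_ (by positivity)
          calc ‖∑ i, boolSign (ε i) • h i‖ * ‖Y ε‖ ≤ 1 * (√p * Real.exp (1 / 2)) :=
                mul_le_mul (hh ε) (hYn ε) (norm_nonneg _) zero_le_one
            _ = _ := one_mul _
      _ = _ := by simp
  have := (div_mul_eq_mul_div (2 ^ Fintype.card ι : ℝ) (√m) (∑ i, B (h i) (y i))).symm.trans_le hle
  rw [div_le_iff₀ hsm, mul_assoc, mul_le_mul_iff_right₀ h2] at this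
  linarith

/-- The times `t` at which the form `B` has an atom immediately to the right of `t`. -/
def atomTimes (B : Cadlag T p →L[ℝ] Cadlag T p →L[ℝ] ℝ) : Set (Icc (0 : ℝ) T) :=
  {t | ∃ a : Fin p,
    ¬ Tendsto (fun r => ‖B (block t r (EuclideanSpace.single a 1))‖) (𝓝[>] t) (𝓝 0)}

theorem norm_sum_block_le {ι : Type*} [Fintype ι] (a : Fin p) (t r : ι → Icc (0 : ℝ) T)
    (hdisj : ∀ i j s, t i ≤ s → s < r i → t j ≤ s → s < r j → i = j) (ε : ι → Bool) :
    ‖∑ i, boolSign (ε i) • block (t i) (r i) (EuclideanSpace.single a 1)‖ ≤ 1 := by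
  refine norm_le zero_le_one fun s => ?_
  rw [sum_apply]
  simp_rw [smul_apply, block_apply]
  by_cases h : ∃ i, t i ≤ s ∧ s < r i
  · obtain ⟨i, hi⟩ := h
    rw [Finset.sum_eq_single i]
    · rw [if_pos hi, norm_smul]
      cases ε i <;> simp [boolSign]
    · intro j _ hj
      rw [if_neg, smul_zero]
      exact fun hj' => hj (hdisj j i s hj'.1 hj'.2 hi.1 hi.2)
    · simp
  · push Not at h
    rw [Finset.sum_eq_zero]
    · simp
    · intro i _
      rw [if_neg, smul_zero]
      exact fun hi => absurd hi.2 (not_lt.2 (h i hi.1))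

/-- Only finitely many atoms have size more than `δ`: disjoint short intervals at `m` of them would
give `m δ ≤ C √m` by `sum_bilin_le`. -/
theorem finite_setOf_frequently_lt_norm (B : Cadlag T p →L[ℝ] Cadlag T p →L[ℝ] ℝ) (a : Fin p)
    {δ : ℝ} (hδ : 0 < δ) :
    {t | ∃ᶠ r in 𝓝[>] t, δ < ‖B (block t r (EuclideanSpace.single a 1))‖}.Finite := by
  by_contra hinf
  set S := {t | ∃ᶠ r in 𝓝[>] t, δ < ‖B (block t r (EuclideanSpace.single a 1))‖} with hS
  set C := ‖B‖ * (√p * Real.exp (1 / 2)) with hC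
  obtain ⟨m, hm⟩ := exists_nat_gt ((C / δ) ^ 2)
  obtain ⟨F, hFS, hFm⟩ := Set.Infinite.exists_subset_card_eq hinf m
  have hr : ∀ t : F, ∃ r, t.1 < r ∧ (∀ t' ∈ F, t.1 < t' → r < t') ∧
      ∃ y : Cadlag T p, ‖y‖ ≤ 1 ∧ δ < B (block t.1 r (EuclideanSpace.single a 1)) y := by
    intro t
    have h1 : ∃ᶠ r in 𝓝[>] t.1, δ < ‖B (block t.1 r (EuclideanSpace.single a 1))‖ := hFS t.2
    have h2 : ∀ᶠ r in 𝓝[>] t.1, ∀ t' ∈ F, t.1 < t' → r < t' := by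
      refine (Finset.eventually_all F).2 fun t' _ => ?_
      by_cases h : t.1 < t'
      · filter_upwards [mem_nhdsWithin_of_mem_nhds (Iio_mem_nhds h)] with r hr _ using hr
      · exact Eventually.of_forall fun r h' => absurd h' h
    obtain ⟨r, hr1, hr2, hr3⟩ := (h1.and_eventually (h2.and self_mem_nhdsWithin)).exists
    refine ⟨r, hr3, hr2, ?_⟩
    obtain ⟨y, hy1, hy2⟩ := ContinuousLinearMap.exists_lt_apply_of_lt_opNorm _ hr1
    rcases le_total 0 (B (block t.1 r (EuclideanSpace.single a 1)) y) with h | h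
    · exact ⟨y, hy1.le, by rwa [Real.norm_of_nonneg h] at hy2⟩
    · exact ⟨-y, by rw [norm_neg]; exact hy1.le, by
        rw [map_neg]; rwa [Real.norm_of_nonpos h] at hy2⟩
  choose r hr1 hr2 y hy hB using hr
  have hdisj : ∀ (i j : F) s, i.1 ≤ s → s < r i → j.1 ≤ s → s < r j → i = j := by
    intro i j s h1 h2 h3 h4
    rcases lt_trichotomy i.1 j.1 with h | h | h
    · exact absurd (h3.trans_lt h2) (not_lt.2 (hr2 i j.1 j.2 h).le)
    · exact Subtype.ext h
    · exact absurd (h1.trans_lt h4) (not_lt.2 (hr2 j i.1 i.2 h).le)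
  have h3 := sum_bilin_le B (fun i : F => block i.1 (r i) (EuclideanSpace.single a 1)) y hy
    (norm_sum_block_le a _ r hdisj)
  have h4 : (m : ℝ) * δ ≤ √m * C := by
    have : ∑ _i : F, δ ≤ ∑ i : F, B (block i.1 (r i) (EuclideanSpace.single a 1)) (y i) :=
      Finset.sum_le_sum fun i _ => (hB i).le
    rw [Finset.sum_const, Finset.card_univ, Fintype.card_coe, hFm, nsmul_eq_mul] at this
    rw [Fintype.card_coe, hFm] at h3
    exact this.trans h3
  have hm0 : (0 : ℝ) < m := lt_of_le_of_lt (sq_nonneg _) hm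
  have hsm := Real.sqrt_pos.2 hm0
  have h5 : √m * δ ≤ C := by
    refine le_of_mul_le_mul_left ?_ hsm
    rwa [← mul_assoc, Real.mul_self_sqrt hm0.le]
  have h6 : √m ≤ C / δ := (le_div_iff₀ hδ).2 h5
  have h7 := pow_le_pow_left₀ hsm.le h6 2
  rw [Real.sq_sqrt hm0.le] at h7
  exact absurd hm (not_lt.2 h7)

theorem countable_atomTimes (B : Cadlag T p →L[ℝ] Cadlag T p →L[ℝ] ℝ) :
    (atomTimes B).Countable := by
  have : atomTimes B ⊆ ⋃ (a : Fin p) (k : ℕ),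
      {t | ∃ᶠ r in 𝓝[>] t, 1 / ((k : ℝ) + 1) < ‖B (block t r (EuclideanSpace.single a 1))‖} := by
    rintro t ⟨a, ha⟩
    simp only [mem_iUnion, mem_ofPred_eq]
    refine ⟨a, ?_⟩
    by_contra h
    push Not at h
    refine ha (Metric.tendsto_nhds.2 fun ε hε => ?_)
    obtain ⟨k, hk⟩ := exists_nat_one_div_lt hε
    refine (h k).mono fun r hr => ?_
    rw [dist_zero_right, norm_norm]
    exact hr.trans_lt hk
  refine Countable.mono this (countable_iUnion fun a => countable_iUnion fun k => ?_)
  exact (finite_setOf_frequently_lt_norm B a (by positivity)).countable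

end Cadlag


/-! ### Time grids and bilinear forms -/

namespace Cadlag

variable {T : ℝ} {p : ℕ}

/-- The span of the steps `v 1_{[a,T]}` is dense: follow the path from time `0`, and add a step
whenever it has moved by `ε`. -/
theorem mem_of_step_mem (hT : 0 ≤ T) {V : Submodule ℝ (Cadlag T p)}
    (hV : IsClosed (V : Set (Cadlag T p)))
    (hstep : ∀ a v, step a v ∈ V) (x : Cadlag T p) : x ∈ V := by
  rw [← SetLike.mem_coe, ← hV.closure_eq, Metric.mem_closure_iff]
  intro ε' hε'
  obtain ⟨ε, hε, hεε'⟩ := exists_between hε'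
  let A : Set (Icc (0 : ℝ) T) := {t | ∃ h ∈ V, (∀ s ≤ t, ‖x.path s - h.path s‖ ≤ ε) ∧
    ∀ s, t ≤ s → h.path s = x.path t}
  have hA0 : (⟨0, le_rfl, hT⟩ : Icc (0 : ℝ) T) ∈ A := by
    refine ⟨step ⟨0, le_rfl, hT⟩ (x.path ⟨0, le_rfl, hT⟩), hstep _ _, fun s hs => ?_, fun s hs => ?_⟩
    · have : s = ⟨0, le_rfl, hT⟩ := le_antisymm hs s.2.1
      rw [this, step_apply, if_pos le_rfl, sub_self, norm_zero]
      exact hε.le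
    · rw [step_apply, if_pos hs]
  -- Passing from `t ∈ A` to a later time `r` before which the path has hardly moved.
  have hext : ∀ t ∈ A, ∀ r, t < r → (∀ s, t < s → s < r → ‖x.path s - x.path t‖ ≤ ε) → r ∈ A := by
    rintro t ⟨h, hh, h1, h2⟩ r htr hr
    refine ⟨h + step r (x.path r - x.path t), V.add_mem hh (hstep _ _), fun s hs => ?_,
      fun s hs => ?_⟩
    · rw [add_apply, step_apply]
      rcases eq_or_lt_of_le hs with hs | hs
      · rw [hs, if_pos le_rfl, h2 r htr.le, add_sub_cancel, sub_self, norm_zero]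
        exact hε.le
      · rw [if_neg (not_le.2 hs), add_zero]
        rcases le_or_gt s t with hst | hst
        · exact h1 s hst
        · rw [h2 s hst.le]
          exact hr s hst hs
    · rw [add_apply, step_apply, if_pos hs, h2 s (htr.le.trans hs), add_sub_cancel]
  obtain ⟨c, -, hc⟩ := (isClosed_closure (s := A)).isCompact.exists_isLUB
    ⟨_, subset_closure hA0⟩
  have hc : IsLUB A c := by rwa [IsLUB, upperBounds_closure] at hc
  have hcA : c ∈ A := by
    by_contra hcA
    obtain ⟨l, hl⟩ := (x.isCadlag c).2
    have h0c : (⟨0, le_rfl, hT⟩ : Icc (0 : ℝ) T) < c :=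
      lt_of_le_of_ne (hc.1 hA0) fun h => hcA (h ▸ hA0)
    have h1 : ∀ᶠ s in 𝓝[<] c, dist (x.path s) l < ε / 2 := hl.eventually (Metric.ball_mem_nhds _ (half_pos hε))
    obtain ⟨b, hb, hb2⟩ := (mem_nhdsLT_iff_exists_Ioo_subset' h0c).1 h1
    obtain ⟨t, htA, hbt⟩ := (lt_isLUB_iff hc).1 hb
    have htc : t < c := lt_of_le_of_ne (hc.1 htA) fun h => hcA (h ▸ htA)
    refine hcA (hext t htA c htc fun s h2 h3 => ?_)
    rw [← dist_eq_norm]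
    have e1 : dist (x.path s) l < ε / 2 := hb2 ⟨hbt.trans h2, h3⟩
    have e2 : dist (x.path t) l < ε / 2 := hb2 ⟨hbt, htc⟩
    linarith [dist_triangle_right (x.path s) (x.path t) l]
  have hlast : ∀ s, s ≤ c := by
    by_contra hcon
    push Not at hcon
    obtain ⟨b, hb⟩ := hcon
    have h1 : ∀ᶠ s in 𝓝[≥] c, dist (x.path s) (x.path c) < ε :=
      (x.isCadlag c).1.tendsto.eventually (Metric.ball_mem_nhds _ hε)
    obtain ⟨r, hr, hr2⟩ := (mem_nhdsGE_iff_exists_Ico_subset' hb).1 h1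
    have hrA : r ∈ A := hext c hcA r hr fun s h2 h3 => by
      rw [← dist_eq_norm]
      exact le_of_lt (hr2 ⟨h2.le, h3⟩)
    exact absurd (hc.1 hrA) (not_le.2 hr)
  obtain ⟨h, hh, h1, -⟩ := hcA
  refine ⟨h, hh, lt_of_le_of_lt ?_ hεε'⟩
  rw [dist_eq_norm]
  exact norm_le hε.le fun s => h1 s (hlast s)

/-- An increasing sequence of finite sets of times, all containing `0` and `T`, with dense union. -/
structure IsTimeGrid (τ : ℕ → Finset (Icc (0 : ℝ) T)) : Prop where
  mono : Monotone τ
  first : ∀ n, ∃ r ∈ τ n, ∀ s, r ≤ s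
  last : ∀ n, ∃ r ∈ τ n, ∀ s, s ≤ r
  dense : Dense (⋃ n, (τ n : Set (Icc (0 : ℝ) T)))

theorem exists_isTimeGrid (hT : 0 ≤ T) {S : Set (Icc (0 : ℝ) T)} (hS : S.Countable) :
    ∃ τ : ℕ → Finset (Icc (0 : ℝ) T), IsTimeGrid τ ∧ ∀ t ∈ S, ∃ n, t ∈ τ n := by
  classical
  obtain ⟨D, hD, hd⟩ := TopologicalSpace.exists_countable_dense (Icc (0 : ℝ) T)
  have : Nonempty (Icc (0 : ℝ) T) := ⟨⟨0, le_rfl, hT⟩⟩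
  obtain ⟨q, hq⟩ := (hD.union hS).exists_eq_range (hd.mono subset_union_left).nonempty
  let τ : ℕ → Finset (Icc (0 : ℝ) T) := fun n =>
    {⟨0, le_rfl, hT⟩, ⟨T, hT, le_rfl⟩} ∪ (Finset.range n).image q
  have hmem : ∀ t ∈ D ∪ S, ∃ n, t ∈ τ n := by
    intro t ht
    rw [hq] at ht
    obtain ⟨k, rfl⟩ := ht
    refine ⟨k + 1, Finset.mem_union_right _ (Finset.mem_image_of_mem _ ?_)⟩
    simp
  refine ⟨τ, ⟨fun n k hnk => ?_, fun n => ⟨⟨0, le_rfl, hT⟩, by simp [τ], fun s => s.2.1⟩,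
    fun n => ⟨⟨T, hT, le_rfl⟩, by simp [τ], fun s => s.2.2⟩, ?_⟩, fun t ht => hmem t (Or.inr ht)⟩
  · exact Finset.union_subset_union_right (Finset.image_subset_image (Finset.range_mono hnk))
  · refine hd.mono fun t ht => ?_
    obtain ⟨n, hn⟩ := hmem t (Or.inl ht)
    exact mem_iUnion.2 ⟨n, hn⟩

namespace IsTimeGrid

variable {τ : ℕ → Finset (Icc (0 : ℝ) T)}

theorem lastTime_le (hτ : IsTimeGrid τ) (n : ℕ) (s : Icc (0 : ℝ) T) :
    lastTime (τ n) s ∈ τ n ∧ lastTime (τ n) s ≤ s := by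
  obtain ⟨r, hr, hrs⟩ := hτ.first n
  have := lastTime_mem hr (hrs s)
  exact ⟨this.1, this.2.2⟩

/-- The mesh of a time grid tends to `0`. -/
theorem eventually_dist_lt (hτ : IsTimeGrid τ) {δ : ℝ} (hδ : 0 < δ) :
    ∀ᶠ n in atTop, ∀ s, dist s (lastTime (τ n) s) < δ := by
  have key : ∀ᶠ n in atTop, ∀ s ∈ (univ : Set (Icc (0 : ℝ) T)), dist s (lastTime (τ n) s) < δ := by
    refine isCompact_univ.induction_on (p := fun A => ∀ᶠ n in atTop, ∀ s ∈ A,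
      dist s (lastTime (τ n) s) < δ) (by simp) (fun A B hAB hB => ?_) (fun A B hA hB => ?_)
      (fun t _ => ?_)
    · exact hB.mono fun n hn s hs => hn s (hAB hs)
    · filter_upwards [hA, hB] with n h1 h2 s hs
      exact hs.elim (h1 s) (h2 s)
    · -- A time `q` of the grid slightly before `t`, or the first time if `t` is the first time.
      have hq : ∃ (n : ℕ) (q : Icc (0 : ℝ) T), q ∈ τ n ∧ dist t q < δ / 2 ∧
          ∀ᶠ s in 𝓝 t, q ≤ s := by
        by_cases h0 : ∀ s, t ≤ s
        · obtain ⟨r, hr, hrs⟩ := hτ.first 0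
          refine ⟨0, r, hr, ?_, Eventually.of_forall hrs⟩
          rw [le_antisymm (hrs t) (h0 r), dist_self]
          exact half_pos hδ
        · push Not at h0
          obtain ⟨b, hb⟩ := h0
          have hne : (Metric.ball t (δ / 2) ∩ Iio t).Nonempty := by
            have := nhdsLT_neBot_of_exists_lt ⟨b, hb⟩
            exact mem_closure_iff_nhds.1 (mem_closure_iff_nhdsWithin_neBot.2 this) _
              (Metric.ball_mem_nhds t (half_pos hδ))
          obtain ⟨q, ⟨hq1, hq2⟩, hq3⟩ := hτ.dense.inter_open_nonempty _
            (Metric.isOpen_ball.inter isOpen_Iio) hne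
          obtain ⟨n, hn⟩ := mem_iUnion.1 hq3
          refine ⟨n, q, hn, by rw [dist_comm]; exact hq1, ?_⟩
          filter_upwards [Ioi_mem_nhds hq2] with s hs using le_of_lt hs
      obtain ⟨n, q, hqn, hqd, hqe⟩ := hq
      refine ⟨{s | q ≤ s ∧ dist s t < δ / 2}, mem_nhdsWithin_of_mem_nhds
        (hqe.and (Metric.ball_mem_nhds t (half_pos hδ))), ?_⟩
      filter_upwards [eventually_ge_atTop n] with k hk s hs
      have h1 := lastTime_mem (hτ.mono hk hqn) hs.1
      calc dist s (lastTime (τ k) s) ≤ dist s q := by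
            rw [Subtype.dist_eq, Subtype.dist_eq, Real.dist_eq, Real.dist_eq,
              abs_of_nonneg (sub_nonneg.2 (Subtype.coe_le_coe.2 h1.2.2)),
              abs_of_nonneg (sub_nonneg.2 (Subtype.coe_le_coe.2 hs.1))]
            have : (q : ℝ) ≤ lastTime (τ k) s := h1.2.1
            linarith
        _ ≤ dist s t + dist t q := dist_triangle _ _ _
        _ < δ := by linarith [hs.2]
  exact key.mono fun n hn s => hn s (mem_univ s)

theorem tendsto_discretize_of_continuous (hτ : IsTimeGrid τ) {z : Cadlag T p}
    (hz : Continuous z.path) :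
    Tendsto (fun n => ‖discretize (τ n) z - z‖) atTop (𝓝 0) := by
  refine Metric.tendsto_nhds.2 fun ε hε => ?_
  obtain ⟨δ, hδ, h⟩ := Metric.uniformContinuous_iff.1
    (CompactSpace.uniformContinuous_of_continuous hz) (ε / 2) (half_pos hε)
  filter_upwards [hτ.eventually_dist_lt hδ] with n hn
  rw [dist_zero_right, norm_norm]
  refine lt_of_le_of_lt (norm_le (half_pos hε).le fun s => ?_) (half_lt_self hε)
  rw [sub_apply, discretize_apply, ← dist_eq_norm, dist_comm]
  exact (h (hn s)).le

/-- The step at `t` and its discretization differ on a short interval to the right of `t`, unless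
`t` lies in the grid; by hypothesis the form has no atom at such a `t`. -/
theorem tendsto_bilin_step (hτ : IsTimeGrid τ) {B : Cadlag T p →L[ℝ] Cadlag T p →L[ℝ] ℝ}
    (hB : ∀ t ∈ atomTimes B, ∃ n, t ∈ τ n) (t : Icc (0 : ℝ) T) (v : Euc p) :
    Tendsto (fun n => ‖B (step t v - discretize (τ n) (step t v))‖) atTop (𝓝 0) := by
  by_cases ht : ∃ n, t ∈ τ n
  · obtain ⟨n, hn⟩ := ht
    refine tendsto_const_nhds.congr' ?_
    filter_upwards [eventually_ge_atTop n] with k hk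
    have : discretize (τ k) (step t v) = step t v := by
      refine ext fun s => ?_
      rw [discretize_apply, step_apply, step_apply]
      congr 1
      refine propext ⟨fun h => h.trans (hτ.lastTime_le k s).2, fun h => ?_⟩
      exact (lastTime_mem (hτ.mono hk hn) h).2.1
    rw [this, sub_self, map_zero, norm_zero]
  have hatom : ∀ a : Fin p,
      Tendsto (fun r => ‖B (block t r (EuclideanSpace.single a 1))‖) (𝓝[>] t) (𝓝 0) := by
    by_contra hcon
    push Not at hcon
    exact ht (hB t hcon)
  -- the first time of the grid after `t`
  have hne : ∀ n, ((τ n).filter (t < ·)).Nonempty := by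
    intro n
    obtain ⟨r, hr, hrs⟩ := hτ.last n
    exact ⟨r, Finset.mem_filter.2 ⟨hr, lt_of_le_of_ne (hrs t) fun h => ht ⟨n, h ▸ hr⟩⟩⟩
  set r : ℕ → Icc (0 : ℝ) T := fun n => ((τ n).filter (t < ·)).min' (hne n) with hr
  have hrmem : ∀ n, r n ∈ τ n ∧ t < r n := fun n =>
    Finset.mem_filter.1 (((τ n).filter (t < ·)).min'_mem (hne n))
  have hrle : ∀ n, ∀ q ∈ τ n, t < q → r n ≤ q := fun n q hq htq =>
    Finset.min'_le _ _ (Finset.mem_filter.2 ⟨hq, htq⟩)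
  have heq : ∀ n, step t v - discretize (τ n) (step t v)
      = ∑ a, v a • block t (r n) (EuclideanSpace.single a 1) := by
    intro n
    refine ext fun s => ?_
    rw [sub_apply, discretize_apply, step_apply, step_apply, sum_apply]
    simp_rw [smul_apply, block_apply]
    have h1 : (t ≤ lastTime (τ n) s) ↔ r n ≤ s := by
      constructor
      · intro h
        refine (hrle n _ (hτ.lastTime_le n s).1 (lt_of_le_of_ne h fun h' => ht ⟨n, ?_⟩)).trans
          (hτ.lastTime_le n s).2
        rw [h']
        exact (hτ.lastTime_le n s).1
      · intro h
        exact (hrmem n).2.le.trans (lastTime_mem (hrmem n).1 h).2.1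
    simp only [h1]
    by_cases h2 : t ≤ s
    · by_cases h3 : r n ≤ s
      · simp [h2, h3]
      · rw [if_pos h2, if_neg h3]
        ext b
        simp [h2, not_le.1 h3, Pi.single_apply]
    · have h3 : ¬ r n ≤ s := fun h => h2 ((hrmem n).2.le.trans h)
      simp [h2, h3]
  have hrt : Tendsto r atTop (𝓝[>] t) := by
    refine tendsto_nhdsWithin_iff.2 ⟨?_, Eventually.of_forall fun n => (hrmem n).2⟩
    refine tendsto_order.2 ⟨fun a ha => Eventually.of_forall fun n => ha.trans (hrmem n).2,
      fun b hb => ?_⟩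
    obtain ⟨q, ⟨hq1, hq2⟩, hq3⟩ := hτ.dense.inter_open_nonempty _ (isOpen_Ioo (a := t) (b := b))
      (nonempty_Ioo.2 hb)
    obtain ⟨n, hn⟩ := mem_iUnion.1 hq3
    filter_upwards [eventually_ge_atTop n] with k hk
    exact (hrle k q (hτ.mono hk hn) hq1).trans_lt hq2
  have hlim : Tendsto (fun n => ∑ a, |v a| * ‖B (block t (r n) (EuclideanSpace.single a 1))‖) atTop
      (𝓝 (∑ a : Fin p, |v a| * 0)) :=
    tendsto_finsetSum _ fun a _ => ((hatom a).comp hrt).const_mul _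
  simp only [mul_zero, Finset.sum_const_zero] at hlim
  refine squeeze_zero (fun _ => norm_nonneg _) (fun n => ?_) hlim
  rw [heq, map_sum]
  refine (norm_sum_le _ _).trans (Finset.sum_le_sum fun a _ => ?_)
  rw [map_smul, norm_smul, Real.norm_eq_abs]

/-- A bilinear form does not distinguish a path from its discretizations in the limit, once the grid
exhausts the atoms of the form. There is no exceptional path, although the discretizations need not
converge in norm. -/
theorem tendsto_bilin (hT : 0 ≤ T) (hτ : IsTimeGrid τ) {B : Cadlag T p →L[ℝ] Cadlag T p →L[ℝ] ℝ}
    (hB : ∀ t ∈ atomTimes B, ∃ n, t ∈ τ n) (x : Cadlag T p) :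
    Tendsto (fun n => ‖B (x - discretize (τ n) x)‖) atTop (𝓝 0) := by
  let V : Submodule ℝ (Cadlag T p) :=
    { carrier := {x | Tendsto (fun n => ‖B (x - discretize (τ n) x)‖) atTop (𝓝 0)}
      add_mem' := by
        intro x y hx hy
        have := Tendsto.add hx hy
        rw [add_zero] at this
        refine squeeze_zero (fun _ => norm_nonneg _) (fun n => ?_) this
        rw [map_add, add_sub_add_comm, map_add]
        exact norm_add_le _ _
      zero_mem' := by simp
      smul_mem' := by
        intro c x hx
        have := Tendsto.const_mul ‖c‖ hx
        rw [mul_zero] at this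
        refine this.congr fun n => ?_
        rw [map_smul, ← smul_sub, map_smul, norm_smul] }
  refine mem_of_step_mem hT (V := V) ?_ (fun t v => hτ.tendsto_bilin_step hB t v) x
  refine isClosed_of_closure_subset fun x hx => ?_
  refine Metric.tendsto_nhds.2 fun ε hε => ?_
  have hC : 0 < ‖B‖ * 2 + 1 := by positivity
  obtain ⟨y, hy, hxy⟩ := Metric.mem_closure_iff.1 hx (ε / 2 / (‖B‖ * 2 + 1)) (by positivity)
  filter_upwards [(Metric.tendsto_nhds.1 hy) (ε / 2) (half_pos hε)] with n hn
  rw [dist_zero_right, norm_norm] at hn ⊢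
  have h1 : x - discretize (τ n) x = (x - y - discretize (τ n) (x - y))
      + (y - discretize (τ n) y) := by
    rw [map_sub]; abel
  rw [h1, map_add]
  have h2 : ‖B (x - y - discretize (τ n) (x - y))‖ ≤ ‖B‖ * (2 * ‖x - y‖) := by
    refine (B.le_opNorm _).trans ?_
    gcongr
    calc _ ≤ ‖x - y‖ + ‖discretize (τ n) (x - y)‖ := norm_sub_le _ _
      _ ≤ 2 * ‖x - y‖ := by linarith [norm_discretize_le (τ n) (x - y)]
  rw [dist_eq_norm, lt_div_iff₀ hC] at hxy
  have h3 := norm_nonneg (x - y)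
  calc _ ≤ ‖B (x - y - discretize (τ n) (x - y))‖ + ‖B (y - discretize (τ n) y)‖ := norm_add_le _ _
    _ < ε := by nlinarith

end IsTimeGrid

end Cadlag


/-! ### Expectations of random paths -/

namespace Cadlag

variable {T : ℝ} {p : ℕ}

/-- A functional is the pointwise limit of its values on discretized paths, each of which is a
linear combination of finitely many coordinates. -/
theorem exists_grid_tendsto_apply (hT : 0 ≤ T) (ℓ : Cadlag T p →L[ℝ] ℝ) :
    ∃ τ : ℕ → Finset (Icc (0 : ℝ) T), IsTimeGrid τ ∧
      ∀ x, Tendsto (fun n => ℓ (discretize (τ n) x)) atTop (𝓝 (ℓ x)) := by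
  obtain ⟨τ, hτ, h⟩ := exists_isTimeGrid hT (countable_atomTimes (ℓ.smulRight ℓ))
  refine ⟨τ, hτ, fun x => ?_⟩
  by_cases hℓ : ℓ = 0
  · simp [hℓ]
  have h1 := (hτ.tendsto_bilin hT h x).mul_const ‖ℓ‖⁻¹
  rw [zero_mul] at h1
  have h2 : Tendsto (fun n => ‖ℓ x - ℓ (discretize (τ n) x)‖) atTop (𝓝 0) := by
    refine h1.congr fun n => ?_
    rw [ContinuousLinearMap.smulRight_apply, norm_smul, mul_assoc,
      mul_inv_cancel₀ (norm_ne_zero_iff.2 hℓ), mul_one, map_sub]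
  rw [tendsto_iff_norm_sub_tendsto_zero]
  simpa only [norm_sub_rev] using h2

theorem IsTimeGrid.discretize_eq {τ : ℕ → Finset (Icc (0 : ℝ) T)} (hτ : IsTimeGrid τ) (n : ℕ)
    (x : Cadlag T p) : discretize (τ n) x = ∑ r ∈ τ n, ∑ a, x.path r a • cell (τ n) r a := by
  obtain ⟨r, hr, hrs⟩ := hτ.first n
  exact discretize_eq_sum hr hrs x

theorem measurable_coord (t : Icc (0 : ℝ) T) (a : Fin p) :
    Measurable fun x : Cadlag T p => x.path t a :=
  (EuclideanSpace.proj (𝕜 := ℝ) a).continuous.measurable.comp (measurable_eval t)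

theorem IsTimeGrid.measurable_discretize {τ : ℕ → Finset (Icc (0 : ℝ) T)} (n : ℕ) :
    Measurable fun x : Cadlag T p => discretize (τ n) x :=
  measurable_iff.2 fun s => by
    simp_rw [discretize_apply]
    exact measurable_eval _

variable {α : Type*} [MeasurableSpace α] {μ : Measure α} {Y : α → Cadlag T p}

theorem integrable_norm (hY : AEMeasurable Y μ) (hint : ∫⁻ a, ‖Y a‖ₑ ∂μ < ∞) :
    Integrable (fun a => ‖Y a‖) μ :=
  ⟨(measurable_norm.comp_aemeasurable hY).aestronglyMeasurable, by
    simpa [HasFiniteIntegral] using hint⟩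

theorem integrable_path (hY : AEMeasurable Y μ) (hint : ∫⁻ a, ‖Y a‖ₑ ∂μ < ∞)
    (s : Icc (0 : ℝ) T) : Integrable (fun a => (Y a).path s) μ :=
  (integrable_norm hY hint).mono' ((measurable_eval s).comp_aemeasurable hY).aestronglyMeasurable
    (Eventually.of_forall fun a => norm_apply_le (Y a) s)

theorem isCadlag_integral (hY : AEMeasurable Y μ) (hint : ∫⁻ a, ‖Y a‖ₑ ∂μ < ∞) :
    IsCadlag fun s => ∫ a, (Y a).path s ∂μ := by
  intro t
  have hm : ∀ s, AEStronglyMeasurable (fun a => (Y a).path s) μ := fun s =>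
    (integrable_path hY hint s).aestronglyMeasurable
  have hb : ∀ s, ∀ᵐ a ∂μ, ‖(Y a).path s‖ ≤ ‖Y a‖ := fun s =>
    Eventually.of_forall fun a => norm_apply_le (Y a) s
  constructor
  · exact tendsto_integral_filter_of_dominated_convergence _ (Eventually.of_forall hm)
      (Eventually.of_forall hb) (integrable_norm hY hint)
      (Eventually.of_forall fun a => ((Y a).isCadlag t).1)
  · choose l hl using fun a => ((Y a).isCadlag t).2
    exact ⟨_, tendsto_integral_filter_of_dominated_convergence _ (Eventually.of_forall hm)
      (Eventually.of_forall hb) (integrable_norm hY hint) (Eventually.of_forall hl)⟩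

theorem path_meanPath (hY : AEMeasurable Y μ) (hint : ∫⁻ a, ‖Y a‖ₑ ∂μ < ∞) (s : Icc (0 : ℝ) T) :
    (meanPath μ Y).path s = ∫ a, (Y a).path s ∂μ :=
  path_toCadlag (isCadlag_integral hY hint) s

theorem norm_meanPath_le (hY : AEMeasurable Y μ) (hint : ∫⁻ a, ‖Y a‖ₑ ∂μ < ∞) :
    ‖meanPath μ Y‖ ≤ ∫ a, ‖Y a‖ ∂μ := by
  refine norm_le (integral_nonneg fun _ => norm_nonneg _) fun s => ?_
  rw [path_meanPath hY hint]
  exact norm_integral_le_of_norm_le (integrable_norm hY hint)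
    (Eventually.of_forall fun a => norm_apply_le (Y a) s)

theorem enorm_meanPath_le (hY : AEMeasurable Y μ) (hint : ∫⁻ a, ‖Y a‖ₑ ∂μ < ∞) :
    ‖meanPath μ Y‖ₑ ≤ ∫⁻ a, ‖Y a‖ₑ ∂μ := by
  rw [← ofReal_norm]
  refine (ENNReal.ofReal_le_ofReal (norm_meanPath_le hY hint)).trans (le_of_eq ?_)
  rw [ofReal_integral_eq_lintegral_ofReal (integrable_norm hY hint)
    (Eventually.of_forall fun _ => norm_nonneg _)]
  simp_rw [ofReal_norm]

/-- Every continuous linear functional on the (non-separable) space of càdlàg paths is measurable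
for the σ-field generated by the coordinate maps. -/
theorem measurable_clm (hT : 0 ≤ T) (ℓ : Cadlag T p →L[ℝ] ℝ) : Measurable ℓ := by
  obtain ⟨τ, hτ, h⟩ := exists_grid_tendsto_apply hT ℓ
  refine measurable_of_tendsto_metrizable (fun n => ?_) (tendsto_pi_nhds.2 h)
  simp_rw [hτ.discretize_eq, map_sum, map_smul]
  exact Finset.measurable_sum _ fun r _ => Finset.measurable_sum _ fun a _ =>
    (measurable_coord r a).smul_const _

theorem integrable_clm (hT : 0 ≤ T) (hY : AEMeasurable Y μ) (hint : ∫⁻ a, ‖Y a‖ₑ ∂μ < ∞)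
    (ℓ : Cadlag T p →L[ℝ] ℝ) : Integrable (fun a => ℓ (Y a)) μ :=
  ((integrable_norm hY hint).const_mul ‖ℓ‖).mono'
    ((measurable_clm hT ℓ).comp_aemeasurable hY).aestronglyMeasurable
    (Eventually.of_forall fun _ => ℓ.le_opNorm _)

/-- A continuous linear functional commutes with the pointwise expectation, although a random path
need not be Bochner integrable for the sup norm. -/
theorem clm_meanPath (hT : 0 ≤ T) (hY : AEMeasurable Y μ) (hint : ∫⁻ a, ‖Y a‖ₑ ∂μ < ∞)
    (ℓ : Cadlag T p →L[ℝ] ℝ) : ℓ (meanPath μ Y) = ∫ a, ℓ (Y a) ∂μ := by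
  obtain ⟨τ, hτ, h⟩ := exists_grid_tendsto_apply hT ℓ
  have hfin : ∀ n, ℓ (discretize (τ n) (meanPath μ Y)) = ∫ a, ℓ (discretize (τ n) (Y a)) ∂μ := by
    intro n
    simp_rw [hτ.discretize_eq, map_sum, map_smul, path_meanPath hY hint]
    have hi : ∀ r a, Integrable (fun ω => (Y ω).path r a) μ := fun r a =>
      (EuclideanSpace.proj (𝕜 := ℝ) a).integrable_comp (integrable_path hY hint r)
    rw [integral_finsetSum _ fun r _ => integrable_finsetSum _ fun _ _ => (hi r _).smul_const _]
    refine Finset.sum_congr rfl fun r _ => ?_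
    rw [integral_finsetSum _ fun _ _ => (hi r _).smul_const _]
    refine Finset.sum_congr rfl fun a _ => ?_
    rw [integral_smul_const]
    congr 1
    exact ((EuclideanSpace.proj (𝕜 := ℝ) a).integral_comp_comm (integrable_path hY hint r)).symm
  refine tendsto_nhds_unique (h _) ?_
  simp_rw [hfin]
  refine tendsto_integral_of_dominated_convergence (fun a => ‖ℓ‖ * ‖Y a‖) (fun n => ?_)
    ((integrable_norm hY hint).const_mul ‖ℓ‖) (fun n => Eventually.of_forall fun _ => ?_)
    (Eventually.of_forall fun _ => h _)
  · exact ((measurable_clm hT ℓ).comp (IsTimeGrid.measurable_discretize n)).comp_aemeasurable hY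
      |>.aestronglyMeasurable
  · exact (ℓ.le_opNorm _).trans (mul_le_mul_of_nonneg_left (norm_discretize_le _ _) (by positivity))

end Cadlag


/-! ### Test functions of class `M` -/

section TestFunctions

variable {T : ℝ} {p : ℕ}

theorem abs_apply_self_le_of_quadNorm_le {A : Cadlag T p →L[ℝ] Cadlag T p →L[ℝ] ℝ} {q : ℝ}
    (hq : 0 ≤ q) (h : quadNorm A ≤ ENNReal.ofReal q) (w : Cadlag T p) : |A w w| ≤ q * ‖w‖ ^ 2 := by
  by_cases hw : w = 0
  · simp [hw]
  have hw' : 0 < ‖w‖ := norm_pos_iff.2 hw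
  have h1 : ‖(‖w‖⁻¹ • w)‖ = 1 := by
    rw [norm_smul, norm_inv, norm_norm, inv_mul_cancel₀ hw'.ne']
  have h2 : ‖A (‖w‖⁻¹ • w) (‖w‖⁻¹ • w)‖ₑ ≤ ENNReal.ofReal q :=
    (le_iSup₂ (f := fun (w : Cadlag T p) (_ : ‖w‖ = 1) => ‖A w w‖ₑ) _ h1).trans h
  rw [← ofReal_norm, ENNReal.ofReal_le_ofReal_iff hq, map_smul, map_smul,
    smul_apply, norm_smul, norm_smul, norm_inv, norm_norm, Real.norm_eq_abs] at h2
  have h3 : |A w w| = ‖w‖ ^ 2 * (‖w‖⁻¹ * (‖w‖⁻¹ * |A w w|)) := by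
    field_simp
  rw [h3, mul_comm q]
  gcongr

/-- Polarization: for a symmetric form the operator norm is at most twice the norm on the
diagonal. -/
theorem opNorm_le_of_quadNorm_le {A : Cadlag T p →L[ℝ] Cadlag T p →L[ℝ] ℝ} {q : ℝ}
    (hq : 0 ≤ q) (h : quadNorm A ≤ ENNReal.ofReal q) (hA : ∀ x y, A x y = A y x) :
    ‖A‖ ≤ 2 * q := by
  refine ContinuousLinearMap.opNorm_le_of_unit_norm (by positivity) fun x hx => ?_
  refine ContinuousLinearMap.opNorm_le_of_unit_norm (by positivity) fun y hy => ?_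
  have h1 := abs_apply_self_le_of_quadNorm_le hq h (x + y)
  have h2 := abs_apply_self_le_of_quadNorm_le hq h (x - y)
  have h3 : A x y = (A (x + y) (x + y) - A (x - y) (x - y)) / 4 := by
    simp only [map_add, map_sub, add_apply, sub_apply,
      hA y x]
    ring
  have h4 : ‖x + y‖ ^ 2 ≤ 2 ^ 2 := by
    gcongr
    calc ‖x + y‖ ≤ ‖x‖ + ‖y‖ := norm_add_le _ _
      _ = 2 := by rw [hx, hy]; norm_num
  have h5 : ‖x - y‖ ^ 2 ≤ 2 ^ 2 := by
    gcongr
    calc ‖x - y‖ ≤ ‖x‖ + ‖y‖ := norm_sub_le _ _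
      _ = 2 := by rw [hx, hy]; norm_num
  have h6 := abs_le.1 (h1.trans (mul_le_mul_of_nonneg_left h4 hq))
  have h7 := abs_le.1 (h2.trans (mul_le_mul_of_nonneg_left h5 hq))
  rw [h3, Real.norm_eq_abs, abs_le]
  constructor <;> linarith

theorem quadNorm_le_of_opNorm_le {A : Cadlag T p →L[ℝ] Cadlag T p →L[ℝ] ℝ} {q : ℝ}
    (h : ‖A‖ ≤ q) : quadNorm A ≤ ENNReal.ofReal q := by
  refine iSup₂_le fun w hw => ?_
  rw [← ofReal_norm]
  refine ENNReal.ofReal_le_ofReal ((A.le_opNorm₂ w w).trans ?_)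
  rwa [hw, mul_one, mul_one]

theorem le_mul_of_div_le {a M : ℝ≥0∞} (hM : M ≠ ∞) {r c : ℝ} (hr : a = ENNReal.ofReal r)
    {b : ℝ≥0∞} (hb : b = ENNReal.ofReal c) (hc : 0 < c) (h : a / b ≤ M) : r ≤ M.toReal * c := by
  subst hr hb
  have h1 := (ENNReal.div_le_iff (by simpa using hc) ENNReal.ofReal_ne_top).1 h
  rw [← ENNReal.ofReal_toReal hM, ← ENNReal.ofReal_mul ENNReal.toReal_nonneg] at h1
  exact (ENNReal.ofReal_le_ofReal_iff (by positivity)).1 h1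

theorem one_add_enorm_pow (w : Cadlag T p) (n : ℕ) :
    1 + ‖w‖ₑ ^ n = ENNReal.ofReal (1 + ‖w‖ ^ n) := by
  rw [ENNReal.ofReal_add zero_le_one (by positivity), ENNReal.ofReal_one,
    ENNReal.ofReal_pow (norm_nonneg _), ofReal_norm]

/-- Quantitative form of membership in the class `M`: growth bounds for `g`, `Dg` and `D²g` and a
Lipschitz bound for `D²g`. The norms of `D²g` are operator norms here, which by polarization are at
most twice the norms on the diagonal used in `normM`; this is the factor `2`. -/
structure HasBounds (g : Cadlag T p → ℝ) (c : ℝ) : Prop where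
  nonneg : 0 ≤ c
  differentiable : Differentiable ℝ g
  differentiable_fderiv : Differentiable ℝ (fderiv ℝ g)
  abs_le : ∀ w, |g w| ≤ c * (1 + ‖w‖ ^ 3)
  norm_fderiv_le : ∀ w, ‖fderiv ℝ g w‖ ≤ c * (1 + ‖w‖ ^ 2)
  norm_D2_le : ∀ w, ‖D2 g w‖ ≤ 2 * c * (1 + ‖w‖)
  norm_D2_sub_le : ∀ w h, ‖D2 g (w + h) - D2 g w‖ ≤ 2 * c * ‖h‖

theorem D2_symm {g : Cadlag T p → ℝ} (h1 : Differentiable ℝ g) (h2 : Differentiable ℝ (fderiv ℝ g))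
    (w x y : Cadlag T p) : D2 g w x y = D2 g w y x :=
  second_derivative_symmetric (fun z => (h1 z).hasFDerivAt) (h2 w).hasFDerivAt x y

theorem MemM.hasBounds {g : Cadlag T p → ℝ} (hg : MemM g) : HasBounds g (normM g).toReal := by
  have hM := hg.normM_lt_top.ne
  have e1 : ∀ w, ‖g w‖ₑ / (1 + ‖w‖ₑ ^ 3) ≤ normM g := fun w =>
    (le_iSup (fun w => ‖g w‖ₑ / (1 + ‖w‖ₑ ^ 3)) w).trans
      (le_self_add.trans (le_self_add.trans le_self_add))
  have e2 : ∀ w, ‖fderiv ℝ g w‖ₑ / (1 + ‖w‖ₑ ^ 2) ≤ normM g := fun w =>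
    (le_iSup (fun w => ‖fderiv ℝ g w‖ₑ / (1 + ‖w‖ₑ ^ 2)) w).trans
      (le_add_self.trans (le_self_add.trans le_self_add))
  have e3 : ∀ w, quadNorm (D2 g w) / (1 + ‖w‖ₑ) ≤ normM g := fun w =>
    (le_iSup (fun w => quadNorm (D2 g w) / (1 + ‖w‖ₑ)) w).trans (le_add_self.trans le_self_add)
  have e4 : ∀ w h, quadNorm (D2 g (w + h) - D2 g w) / ‖h‖ₑ ≤ normM g := fun w h =>
    (le_iSup₂ (f := fun w h => quadNorm (D2 g (w + h) - D2 g w) / ‖h‖ₑ) w h).trans le_add_self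
  have hsymm := D2_symm hg.differentiable hg.differentiable_fderiv
  have hquad : ∀ (A : Cadlag T p →L[ℝ] Cadlag T p →L[ℝ] ℝ) {c : ℝ} {b : ℝ≥0∞},
      b = ENNReal.ofReal c → 0 < c → quadNorm A / b ≤ normM g → (∀ x y, A x y = A y x) →
      ‖A‖ ≤ 2 * ((normM g).toReal * c) := by
    intro A c b hb hc h hA
    refine opNorm_le_of_quadNorm_le (by positivity) ?_ hA
    rw [ENNReal.ofReal_mul ENNReal.toReal_nonneg, ENNReal.ofReal_toReal hM, ← hb]
    refine (ENNReal.div_le_iff ?_ ?_).1 h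
    · rw [hb]; simpa using hc
    · rw [hb]; exact ENNReal.ofReal_ne_top
  refine ⟨ENNReal.toReal_nonneg, hg.differentiable, hg.differentiable_fderiv, fun w => ?_,
    fun w => ?_, fun w => ?_, fun w h => ?_⟩
  · exact le_mul_of_div_le hM (Real.enorm_eq_ofReal_abs _) (one_add_enorm_pow w 3) (by positivity)
      (e1 w)
  · exact le_mul_of_div_le hM (ofReal_norm _).symm (one_add_enorm_pow w 2) (by positivity) (e2 w)
  · rw [mul_assoc]
    refine hquad _ ?_ (by positivity) (e3 w) (hsymm w)
    simpa using one_add_enorm_pow w 1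
  · by_cases h0 : h = 0
    · have : D2 g w - D2 g w = 0 := sub_self (D2 g w)
      rw [h0, add_zero, this, norm_zero, mul_zero]
      exact ContinuousLinearMap.opNorm_zero.le
    rw [mul_assoc]
    refine hquad _ (ofReal_norm _).symm (norm_pos_iff.2 h0) (e4 w h) fun x y => ?_
    rw [sub_apply, sub_apply, sub_apply,
      sub_apply, hsymm, hsymm w]

theorem HasBounds.memM {g : Cadlag T p → ℝ} {c : ℝ} (hg : HasBounds g c) : MemM g := by
  refine ⟨hg.differentiable, hg.differentiable_fderiv, ?_⟩
  have hc := hg.nonneg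
  have key : ∀ {a b : ℝ≥0∞} {r s : ℝ}, a ≤ ENNReal.ofReal r → b = ENNReal.ofReal s →
      r ≤ 2 * c * s → a / b ≤ ENNReal.ofReal (2 * c) := by
    intro a b r s ha hb hrs
    refine ENNReal.div_le_of_le_mul (ha.trans ?_)
    rw [hb, ← ENNReal.ofReal_mul (by positivity)]
    exact ENNReal.ofReal_le_ofReal hrs
  rw [normM]
  simp only [ENNReal.add_lt_top]
  have top : ENNReal.ofReal (2 * c) < ∞ := ENNReal.ofReal_lt_top
  refine ⟨⟨⟨?_, ?_⟩, ?_⟩, ?_⟩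
  · refine lt_of_le_of_lt (iSup_le fun w => ?_) top
    refine key (Real.enorm_eq_ofReal_abs _).le (one_add_enorm_pow w 3) ((hg.abs_le w).trans ?_)
    gcongr
    linarith
  · refine lt_of_le_of_lt (iSup_le fun w => ?_) top
    refine key (ofReal_norm _).ge (one_add_enorm_pow w 2) ((hg.norm_fderiv_le w).trans ?_)
    gcongr
    linarith
  · refine lt_of_le_of_lt (iSup_le fun w => ?_) top
    refine key (quadNorm_le_of_opNorm_le (hg.norm_D2_le w)) ?_ le_rfl
    simpa using one_add_enorm_pow w 1
  · refine lt_of_le_of_lt (iSup₂_le fun w h => ?_) top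
    exact key (quadNorm_le_of_opNorm_le (hg.norm_D2_sub_le w h)) (ofReal_norm _).symm le_rfl

/-- A Taylor estimate along a segment. -/
theorem norm_sub_sub_le_of_hasDerivAt {E : Type*} [NormedAddCommGroup E] [NormedSpace ℝ E]
    {φ φ' : ℝ → E} (hφ : ∀ t, HasDerivAt φ (φ' t) t) {C : ℝ} {k : ℕ}
    (h : ∀ t ∈ Ico (0 : ℝ) 1, ‖φ' t‖ ≤ C * t ^ k) : ‖φ 1 - φ 0‖ ≤ C / (k + 1) := by
  have hB : ∀ t : ℝ, HasDerivAt (fun t : ℝ => C / (k + 1) * t ^ (k + 1)) (C * t ^ k) t := by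
    intro t
    have := (hasDerivAt_pow (k + 1) t).const_mul (C / (k + 1))
    refine this.congr_deriv ?_
    have : (k : ℝ) + 1 ≠ 0 := by positivity
    push_cast
    field_simp
  have h1 := image_norm_le_of_norm_deriv_right_le_deriv_boundary' (f := fun t => φ t - φ 0)
    (f' := φ') (a := 0) (b := 1) (B := fun t => C / (k + 1) * t ^ (k + 1)) (B' := fun t => C * t ^ k)
    (fun t _ => ((hφ t).continuousAt.sub continuousAt_const).continuousWithinAt)
    (fun t _ => ((hφ t).sub_const _).hasDerivWithinAt) (by simp)
    (fun t _ => (hB t).continuousAt.continuousWithinAt)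
    (fun t _ => (hB t).hasDerivWithinAt) h (x := 1) (right_mem_Icc.2 zero_le_one)
  simpa using h1

namespace HasBounds

variable {g : Cadlag T p → ℝ} {c : ℝ}

theorem hasDerivAt_line {F : Type*} [NormedAddCommGroup F] [NormedSpace ℝ F] {G : Cadlag T p → F}
    (hG : Differentiable ℝ G) (w h : Cadlag T p) (t : ℝ) :
    HasDerivAt (fun t : ℝ => G (w + t • h)) (fderiv ℝ G (w + t • h) h) t := by
  have h1 : HasDerivAt (fun t : ℝ => w + t • h) h t := by
    simpa using ((hasDerivAt_id t).smul_const h).const_add w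
  exact (hG _).hasFDerivAt.comp_hasDerivAt t h1

theorem norm_line_le (w h : Cadlag T p) {t : ℝ} (ht : t ∈ Ico (0 : ℝ) 1) :
    ‖w + t • h‖ ≤ ‖w‖ + ‖h‖ := by
  refine (norm_add_le _ _).trans (add_le_add_right ?_ _)
  rw [norm_smul, Real.norm_of_nonneg ht.1]
  exact mul_le_of_le_one_left (norm_nonneg _) ht.2.le

/-- The first-order Taylor formula for the derivative, with the constant `1/2` in front of the
Lipschitz constant `2c` of the second derivative. -/
theorem norm_fderiv_sub_sub_le (hg : HasBounds g c) (w h : Cadlag T p) :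
    ‖fderiv ℝ g (w + h) - fderiv ℝ g w - D2 g w h‖ ≤ c * ‖h‖ ^ 2 := by
  have hd : ∀ t : ℝ, HasDerivAt (fun t : ℝ => fderiv ℝ g (w + t • h) - t • D2 g w h)
      (D2 g (w + t • h) h - D2 g w h) t := fun t =>
    ((hasDerivAt_line hg.differentiable_fderiv w h t).fun_sub
      ((hasDerivAt_id' t).smul_const (D2 g w h))).congr_deriv (by rw [one_smul]; rfl)
  have h1 := norm_sub_sub_le_of_hasDerivAt hd (C := 2 * c * ‖h‖ ^ 2) (k := 1) (fun t ht => by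
    change ‖(D2 g (w + t • h) - D2 g w) h‖ ≤ _
    refine (ContinuousLinearMap.le_opNorm _ _).trans ?_
    refine (mul_le_mul_of_nonneg_right (hg.norm_D2_sub_le w (t • h)) (norm_nonneg _)).trans ?_
    rw [norm_smul, Real.norm_of_nonneg ht.1]
    exact le_of_eq (by ring))
  simp only [one_smul, zero_smul, add_zero, sub_zero] at h1
  rw [sub_right_comm]
  refine h1.trans (le_of_eq ?_)
  push_cast
  ring

/-- Second-order Taylor formula. -/
theorem abs_sub_sub_sub_le (hg : HasBounds g c) (w h : Cadlag T p) :
    |g (w + h) - g w - fderiv ℝ g w h - D2 g w h h / 2| ≤ c / 3 * ‖h‖ ^ 3 := by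
  have hd : ∀ t : ℝ, HasDerivAt
      (fun t : ℝ => g (w + t • h) - t * fderiv ℝ g w h - t ^ 2 * (D2 g w h h / 2))
      ((fderiv ℝ g (w + t • h) - fderiv ℝ g w - D2 g w (t • h)) h) t := fun t => by
    have h1 := ((hasDerivAt_line hg.differentiable w h t).fun_sub
      ((hasDerivAt_id' t).mul_const (fderiv ℝ g w h))).fun_sub
      ((hasDerivAt_pow 2 t).mul_const (D2 g w h h / 2))
    refine h1.congr_deriv ?_
    rw [map_smul, sub_apply, sub_apply, smul_apply, smul_eq_mul]
    push_cast
    ring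
  have h1 := norm_sub_sub_le_of_hasDerivAt hd (C := c * ‖h‖ ^ 3) (k := 2) (fun t ht => by
    refine (ContinuousLinearMap.le_opNorm _ _).trans ?_
    refine (mul_le_mul_of_nonneg_right (hg.norm_fderiv_sub_sub_le w (t • h))
      (norm_nonneg _)).trans ?_
    rw [norm_smul, Real.norm_of_nonneg ht.1]
    exact le_of_eq (by ring))
  simp only [one_smul, zero_smul, add_zero, one_mul, zero_mul, one_pow, sub_zero,
    Real.norm_eq_abs] at h1
  norm_num at h1
  refine le_trans (le_of_eq ?_) (h1.trans (le_of_eq ?_))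
  · congr 1; ring
  · ring

theorem abs_sub_le (hg : HasBounds g c) (w h : Cadlag T p) :
    |g (w + h) - g w| ≤ c * (1 + (‖w‖ + ‖h‖) ^ 2) * ‖h‖ := by
  have hc := hg.nonneg
  have h1 := norm_sub_sub_le_of_hasDerivAt (hasDerivAt_line hg.differentiable w h)
    (C := c * (1 + (‖w‖ + ‖h‖) ^ 2) * ‖h‖) (k := 0) (fun t ht => by
      refine (ContinuousLinearMap.le_opNorm _ _).trans ?_
      rw [pow_zero, mul_one]
      refine mul_le_mul_of_nonneg_right ((hg.norm_fderiv_le _).trans ?_) (norm_nonneg _)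
      have := norm_line_le w h ht
      gcongr)
  simpa using h1

end HasBounds

/-- A derivative of a measurable function along a measurable direction is measurable. -/
theorem measurable_fderiv_apply {F : Cadlag T p → ℝ} (hF : Measurable F) (hd : Differentiable ℝ F) :
    Measurable fun q : Cadlag T p × Cadlag T p => fderiv ℝ F q.1 q.2 := by
  refine measurable_of_tendsto_metrizable (f := fun (n : ℕ) q =>
    ((n : ℝ) + 1) • (F (q.1 + ((n : ℝ) + 1)⁻¹ • q.2) - F q.1)) (fun n => ?_) ?_
  · have h1 : Measurable fun q : Cadlag T p × Cadlag T p => ((n : ℝ) + 1)⁻¹ • q.2 :=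
      measurable_snd.const_smul ((n : ℝ) + 1)⁻¹
    have h2 : Measurable fun q : Cadlag T p × Cadlag T p => q.1 + ((n : ℝ) + 1)⁻¹ • q.2 :=
      measurable_fst.add h1
    exact measurable_const.mul ((hF.comp h2).sub (hF.comp measurable_fst))
  · refine tendsto_pi_nhds.2 fun q => ?_
    have hc : Tendsto (fun n : ℕ => ‖(n : ℝ) + 1‖) atTop atTop :=
      tendsto_norm_atTop_atTop.comp (tendsto_natCast_atTop_atTop.atTop_add tendsto_const_nhds)
    exact (hd q.1).hasFDerivAt.lim _ hc

theorem measurable_D2_apply {g : Cadlag T p → ℝ} (hg : Measurable g) (h1 : Differentiable ℝ g)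
    (h2 : Differentiable ℝ (fderiv ℝ g)) :
    Measurable fun q : Cadlag T p × Cadlag T p × Cadlag T p => D2 g q.1 q.2.1 q.2.2 := by
  have hm := measurable_fderiv_apply hg h1
  refine measurable_of_tendsto_metrizable (f := fun (n : ℕ) q =>
    ((n : ℝ) + 1) • (fderiv ℝ g (q.1 + ((n : ℝ) + 1)⁻¹ • q.2.1) q.2.2 - fderiv ℝ g q.1 q.2.2))
    (fun n => ?_) ?_
  · have h3 : Measurable fun q : Cadlag T p × Cadlag T p × Cadlag T p =>
        ((n : ℝ) + 1)⁻¹ • q.2.1 := (measurable_fst.comp measurable_snd).const_smul ((n : ℝ) + 1)⁻¹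
    have h4 : Measurable fun q : Cadlag T p × Cadlag T p × Cadlag T p =>
        q.1 + ((n : ℝ) + 1)⁻¹ • q.2.1 := measurable_fst.add h3
    have h5 : Measurable fun q : Cadlag T p × Cadlag T p × Cadlag T p => q.2.2 :=
      measurable_snd.comp measurable_snd
    exact measurable_const.mul
      ((hm.comp (h4.prodMk h5)).sub (hm.comp (measurable_fst.prodMk h5)))
  · refine tendsto_pi_nhds.2 fun q => ?_
    have hc : Tendsto (fun n : ℕ => ‖(n : ℝ) + 1‖) atTop atTop :=
      tendsto_norm_atTop_atTop.comp (tendsto_natCast_atTop_atTop.atTop_add tendsto_const_nhds)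
    have hl := (h2 q.1).hasFDerivAt.lim q.2.1 hc
    exact (ContinuousLinearMap.apply ℝ ℝ q.2.2).continuous.continuousAt.tendsto.comp hl

end TestFunctions


/-! ### Regularity of the Stein solution -/

section WeakIntegral

variable {E : Type*} [NormedAddCommGroup E] [NormedSpace ℝ E]
  {Θ : Type*} [MeasurableSpace Θ] {ρ : Measure Θ}

theorem hasFDerivAt_of_norm_le_sq {F : Type*} [NormedAddCommGroup F] [NormedSpace ℝ F] {f : E → F}
    {A : E →L[ℝ] F} {w : E} {C : ℝ} (h : ∀ k, ‖k‖ ≤ 1 → ‖f (w + k) - f w - A k‖ ≤ C * ‖k‖ ^ 2) :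
    HasFDerivAt f A w := by
  rw [hasFDerivAt_iff_isLittleO_nhds_zero]
  have h1 : (fun k : E => f (w + k) - f w - A k) =O[𝓝 0] fun k => ‖k‖ ^ 2 := by
    refine Asymptotics.IsBigO.of_bound C ?_
    filter_upwards [Metric.closedBall_mem_nhds (0 : E) zero_lt_one] with k hk
    rw [norm_pow, norm_norm]
    exact h k (by simpa using hk)
  refine h1.trans_isLittleO ?_
  have h2 : (fun k : E => ‖k‖ ^ 2) =o[𝓝 0] fun k => ‖k‖ ^ 1 :=
    (Asymptotics.isLittleO_pow_pow one_lt_two).comp_tendsto tendsto_norm_zero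
  simp only [pow_one] at h2
  exact h2.of_norm_right

/-- The weak integral of a family of functionals which are measurable only along each vector. -/
theorem exists_weak_integral {L : Θ → E →L[ℝ] ℝ} {K : Θ → ℝ} (hK : Integrable K ρ)
    (hm : ∀ h, AEStronglyMeasurable (fun θ => L θ h) ρ) (hb : ∀ᵐ θ ∂ρ, ‖L θ‖ ≤ K θ) :
    ∃ A : E →L[ℝ] ℝ, (∀ h, Integrable (fun θ => L θ h) ρ) ∧ (∀ h, A h = ∫ θ, L θ h ∂ρ) ∧
      ‖A‖ ≤ ∫ θ, K θ ∂ρ := by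
  have hle : ∀ h, ∀ᵐ θ ∂ρ, ‖L θ h‖ ≤ K θ * ‖h‖ := fun h => hb.mono fun θ hθ =>
    ((L θ).le_opNorm h).trans (mul_le_mul_of_nonneg_right hθ (norm_nonneg h))
  have hi : ∀ h, Integrable (fun θ => L θ h) ρ := fun h => (hK.mul_const ‖h‖).mono' (hm h) (hle h)
  have hK0 : 0 ≤ ∫ θ, K θ ∂ρ :=
    integral_nonneg_of_ae (hb.mono fun θ hθ => (norm_nonneg (L θ)).trans hθ)
  let A₀ : E →ₗ[ℝ] ℝ :=
    { toFun := fun h => ∫ θ, L θ h ∂ρ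
      map_add' := fun x y => by simp_rw [map_add]; exact integral_add (hi x) (hi y)
      map_smul' := fun c x => by
        simp_rw [map_smul]; exact integral_smul c _ }
  refine ⟨A₀.mkContinuous (∫ θ, K θ ∂ρ) fun h => ?_, hi, fun h => rfl,
    LinearMap.mkContinuous_norm_le _ hK0 _⟩
  rw [← integral_mul_const]
  exact norm_integral_le_of_norm_le (hK.mul_const ‖h‖) (hle h)

/-- The weak integral of a family of bilinear forms. -/
theorem exists_weak_integral₂ {L : Θ → E →L[ℝ] E →L[ℝ] ℝ} {K : Θ → ℝ} (hK : Integrable K ρ)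
    (hm : ∀ h k, AEStronglyMeasurable (fun θ => L θ h k) ρ) (hb : ∀ᵐ θ ∂ρ, ‖L θ‖ ≤ K θ) :
    ∃ A : E →L[ℝ] E →L[ℝ] ℝ, (∀ h k, Integrable (fun θ => L θ h k) ρ) ∧
      (∀ h k, A h k = ∫ θ, L θ h k ∂ρ) ∧ ‖A‖ ≤ ∫ θ, K θ ∂ρ := by
  have hK0 : 0 ≤ ∫ θ, K θ ∂ρ :=
    integral_nonneg_of_ae (hb.mono fun θ hθ => (norm_nonneg (L θ)).trans hθ)
  choose A hi hA hAn using fun h : E => exists_weak_integral (L := fun θ => L θ h)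
    (hK.mul_const ‖h‖) (hm h) (hb.mono fun θ hθ =>
      ((L θ).le_opNorm h).trans (mul_le_mul_of_nonneg_right hθ (norm_nonneg h)))
  let A₀ : E →ₗ[ℝ] E →L[ℝ] ℝ :=
    { toFun := A
      map_add' := fun x y => by
        ext k
        rw [add_apply, hA, hA, hA, ← integral_add (hi x k) (hi y k)]
        simp_rw [map_add, add_apply]
      map_smul' := fun c x => by
        ext k
        rw [RingHom.id_apply, smul_apply, hA, hA, ← integral_smul]
        simp_rw [map_smul, smul_apply] }
  refine ⟨A₀.mkContinuous (∫ θ, K θ ∂ρ) fun h => ?_, hi, fun h k => hA h k,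
    LinearMap.mkContinuous_norm_le _ hK0 _⟩
  rw [← integral_mul_const]
  exact hAn h

end WeakIntegral

section OrnsteinUhlenbeck

variable {T : ℝ} {p : ℕ}

theorem measurable_ouPoint : Measurable fun q : Cadlag T p × ℝ × Cadlag T p =>
    ouPoint q.1 q.2.1 q.2.2 := by
  have h1 : Measurable fun q : Cadlag T p × ℝ × Cadlag T p => Real.exp (-q.2.1) :=
    (Real.continuous_exp.comp continuous_neg).measurable.comp (measurable_fst.comp measurable_snd)
  have h2 : Measurable fun q : Cadlag T p × ℝ × Cadlag T p => √(1 - Real.exp (-2 * q.2.1)) := by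
    have : Continuous fun s : ℝ => √(1 - Real.exp (-2 * s)) := by fun_prop
    exact this.measurable.comp (measurable_fst.comp measurable_snd)
  exact (h1.smul measurable_fst).add (h2.smul (measurable_snd.comp measurable_snd))

theorem ou_coeff {s : ℝ} (hs : 0 ≤ s) : 0 ≤ √(1 - Real.exp (-2 * s)) ∧ √(1 - Real.exp (-2 * s)) ≤ 1 ∧
    1 - √(1 - Real.exp (-2 * s)) ≤ Real.exp (-s) ∧ Real.exp (-s) ≤ 1 := by
  have h1 : Real.exp (-2 * s) = Real.exp (-s) ^ 2 := by
    rw [← Real.exp_nat_mul]; congr 1; push_cast; ring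
  have h2 : Real.exp (-s) ≤ 1 := Real.exp_le_one_iff.2 (by linarith)
  have h3 := Real.exp_pos (-s)
  refine ⟨Real.sqrt_nonneg _, Real.sqrt_le_one.2 ?_, ?_, h2⟩
  · rw [h1]; nlinarith
  · have : 1 - Real.exp (-s) ≤ √(1 - Real.exp (-2 * s)) := by
      refine Real.le_sqrt_of_sq_le ?_
      rw [h1]; nlinarith
    linarith

theorem norm_ouPoint_le (w z : Cadlag T p) {s : ℝ} (hs : 0 ≤ s) : ‖ouPoint w s z‖ ≤ ‖w‖ + ‖z‖ := by
  obtain ⟨h1, h2, -, h4⟩ := ou_coeff hs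
  refine (norm_add_le _ _).trans (add_le_add ?_ ?_)
  · rw [norm_smul, Real.norm_of_nonneg (Real.exp_pos _).le]
    exact mul_le_of_le_one_left (norm_nonneg _) h4
  · rw [norm_smul, Real.norm_of_nonneg h1]
    exact mul_le_of_le_one_left (norm_nonneg _) h2

theorem norm_ouPoint_sub_le (w z : Cadlag T p) {s : ℝ} (hs : 0 ≤ s) :
    ‖ouPoint w s z - z‖ ≤ Real.exp (-s) * (‖w‖ + ‖z‖) := by
  obtain ⟨h1, h2, h3, h4⟩ := ou_coeff hs
  have : ouPoint w s z - z = Real.exp (-s) • w - (1 - √(1 - Real.exp (-2 * s))) • z := by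
    rw [ouPoint, sub_smul, one_smul]; abel
  rw [this, mul_add]
  refine (norm_sub_le _ _).trans (add_le_add ?_ ?_)
  · rw [norm_smul, Real.norm_of_nonneg (Real.exp_pos _).le]
  · rw [norm_smul, Real.norm_of_nonneg (by linarith)]
    gcongr

theorem ouPoint_add (w h z : Cadlag T p) (s : ℝ) :
    ouPoint (w + h) s z = ouPoint w s z + Real.exp (-s) • h := by
  rw [ouPoint, ouPoint, smul_add]; abel

/-- The product of Lebesgue measure on `(0,∞)` and the law `γ`. -/
noncomputable def ouMeasure (γ : Measure (Cadlag T p)) : Measure (ℝ × Cadlag T p) :=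
  (volume.restrict (Ioi (0 : ℝ))).prod γ

theorem integrableOn_exp {k : ℝ} (hk : 0 < k) :
    IntegrableOn (fun s => Real.exp (-k * s)) (Ioi (0 : ℝ)) :=
  exp_neg_integrableOn_Ioi 0 hk

theorem integral_exp_Ioi {k : ℝ} (hk : 0 < k) :
    ∫ s in Ioi (0 : ℝ), Real.exp (-k * s) = 1 / k := by
  have := integral_exp_mul_Ioi (a := -k) (by linarith) 0
  rw [this]
  simp

variable {γ : Measure (Cadlag T p)}

theorem ae_ouMeasure_pos : ∀ᵐ θ ∂ouMeasure γ, 0 < θ.1 :=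
  Measure.quasiMeasurePreserving_fst.ae (ae_restrict_mem measurableSet_Ioi)

theorem aestronglyMeasurable_ou {F : Cadlag T p → ℝ} (hF : Measurable F) (w : Cadlag T p) :
    AEStronglyMeasurable (fun θ : ℝ × Cadlag T p => F (ouPoint w θ.1 θ.2)) (ouMeasure γ) :=
  (hF.comp (measurable_ouPoint.comp
    (measurable_const.prodMk measurable_id))).aestronglyMeasurable

variable [IsProbabilityMeasure γ]

theorem integrable_weight (hγ : Integrable (fun z => ‖z‖ ^ 3) γ) {k : ℝ} (hk : 0 < k) :
    Integrable (fun θ : ℝ × Cadlag T p => Real.exp (-k * θ.1) * (1 + ‖θ.2‖ ^ 3)) (ouMeasure γ) :=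
  Integrable.mul_prod (f := fun s => Real.exp (-k * s)) (g := fun z : Cadlag T p => 1 + ‖z‖ ^ 3)
    (integrableOn_exp hk) ((integrable_const 1).add hγ)

theorem integrable_exp_fst {k : ℝ} (hk : 0 < k) :
    Integrable (fun θ : ℝ × Cadlag T p => Real.exp (-k * θ.1)) (ouMeasure γ) ∧
      ∫ θ, Real.exp (-k * θ.1) ∂ouMeasure γ = 1 / k := by
  have h1 := Integrable.mul_prod (μ := volume.restrict (Ioi (0 : ℝ))) (ν := γ)
    (f := fun s => Real.exp (-k * s)) (g := fun _ => (1 : ℝ)) (integrableOn_exp hk)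
    (integrable_const 1)
  simp only [mul_one] at h1
  refine ⟨h1, ?_⟩
  rw [ouMeasure, integral_prod _ h1]
  simpa using integral_exp_Ioi hk

theorem measurable_exp_fst (k : ℝ) :
    Measurable fun θ : ℝ × Cadlag T p => Real.exp (-k * θ.1) := by
  have : Continuous fun s : ℝ => Real.exp (-k * s) := by fun_prop
  exact this.measurable.comp measurable_fst

variable {g : Cadlag T p → ℝ} {c : ℝ}

theorem HasBounds.abs_ou_sub_le (hg : HasBounds g c) (w z : Cadlag T p) {s : ℝ} (hs : 0 ≤ s) :
    |g (ouPoint w s z) - g z| ≤ 64 * c * (1 + ‖w‖ ^ 3) * (Real.exp (-1 * s) * (1 + ‖z‖ ^ 3)) := by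
  have hc := hg.nonneg
  have h1 := hg.abs_sub_le z (ouPoint w s z - z)
  rw [add_sub_cancel] at h1
  have h2 := norm_ouPoint_sub_le w z hs
  obtain ⟨-, -, -, h4⟩ := ou_coeff hs
  have hx := norm_nonneg w
  have hz := norm_nonneg z
  have h5 : Real.exp (-s) * (‖w‖ + ‖z‖) ≤ ‖w‖ + ‖z‖ := mul_le_of_le_one_left (by positivity) h4
  have hpoly : (1 + (‖w‖ + 2 * ‖z‖) ^ 2) * (‖w‖ + ‖z‖) ≤ 64 * (1 + ‖w‖ ^ 3) * (1 + ‖z‖ ^ 3) := by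
    have e0 : 0 ≤ ‖w‖ ^ 3 := by positivity
    have e1 : 0 ≤ ‖z‖ ^ 3 := by positivity
    have e2 : (1 + (‖w‖ + 2 * ‖z‖) ^ 2) * (‖w‖ + ‖z‖)
        ≤ (1 + (‖w‖ + 2 * ‖z‖) ^ 2) * (‖w‖ + 2 * ‖z‖) := by gcongr; linarith
    have e3 : ∀ y : ℝ, 0 ≤ y → (1 + y ^ 2) * y ≤ 1 + 2 * y ^ 3 := fun y hy => by
      rcases le_total y 1 with h | h
      · nlinarith [pow_nonneg hy 3]
      · nlinarith [mul_nonneg hy (sub_nonneg.2 h), mul_nonneg (mul_nonneg hy (sub_nonneg.2 h)) hy]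
    have e4 : (‖w‖ + 2 * ‖z‖) ^ 3 ≤ 4 * (‖w‖ ^ 3 + 8 * ‖z‖ ^ 3) := by
      have := add_pow_le hx (by positivity : 0 ≤ 2 * ‖z‖) 3
      norm_num [mul_pow] at this
      linarith
    have e5 := e3 (‖w‖ + 2 * ‖z‖) (by positivity)
    nlinarith [mul_nonneg e0 e1]
  have h6 : ‖z‖ + ‖ouPoint w s z - z‖ ≤ ‖w‖ + 2 * ‖z‖ := by linarith
  calc |g (ouPoint w s z) - g z| ≤ c * (1 + (‖z‖ + ‖ouPoint w s z - z‖) ^ 2) * ‖ouPoint w s z - z‖ := h1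
    _ ≤ c * (1 + (‖w‖ + 2 * ‖z‖) ^ 2) * (Real.exp (-s) * (‖w‖ + ‖z‖)) := by
        gcongr
    _ = c * Real.exp (-s) * ((1 + (‖w‖ + 2 * ‖z‖) ^ 2) * (‖w‖ + ‖z‖)) := by ring
    _ ≤ c * Real.exp (-s) * (64 * (1 + ‖w‖ ^ 3) * (1 + ‖z‖ ^ 3)) := by gcongr
    _ = _ := by rw [neg_one_mul]; ring

theorem HasBounds.norm_exp_smul_fderiv_le (hg : HasBounds g c) (w z : Cadlag T p) {s : ℝ}
    (hs : 0 ≤ s) : ‖Real.exp (-1 * s) • fderiv ℝ g (ouPoint w s z)‖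
      ≤ 4 * c * (1 + ‖w‖ ^ 2) * (Real.exp (-1 * s) * (1 + ‖z‖ ^ 3)) := by
  have hc := hg.nonneg
  have hx := norm_nonneg w
  have hz := norm_nonneg z
  have h2 := norm_ouPoint_le w z hs
  have e1 : 0 ≤ ‖z‖ ^ 3 := by positivity
  have e2 : ‖z‖ ^ 2 ≤ 1 + ‖z‖ ^ 3 := by
    rcases le_total ‖z‖ 1 with h | h
    · nlinarith
    · nlinarith [mul_nonneg (sq_nonneg ‖z‖) (sub_nonneg.2 h)]
  have hpoly : 1 + (‖w‖ + ‖z‖) ^ 2 ≤ 4 * (1 + ‖w‖ ^ 2) * (1 + ‖z‖ ^ 3) := by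
    nlinarith [sq_nonneg (‖w‖ - ‖z‖), mul_nonneg (sq_nonneg ‖w‖) e1]
  rw [norm_smul, Real.norm_of_nonneg (Real.exp_pos _).le]
  calc _ ≤ Real.exp (-1 * s) * (c * (1 + (‖w‖ + ‖z‖) ^ 2)) := by
        gcongr
        exact (hg.norm_fderiv_le _).trans (by gcongr)
    _ ≤ Real.exp (-1 * s) * (c * (4 * (1 + ‖w‖ ^ 2) * (1 + ‖z‖ ^ 3))) := by gcongr
    _ = _ := by ring

theorem two_add_norm_le (w z : Cadlag T p) : 2 + ‖w‖ + ‖z‖ ≤ 3 * (1 + ‖w‖) * (1 + ‖z‖ ^ 3) := by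
  have hx := norm_nonneg w
  have hz := norm_nonneg z
  have e1 : 0 ≤ ‖z‖ ^ 3 := by positivity
  have e2 : ‖z‖ ≤ 1 + ‖z‖ ^ 3 := by
    rcases le_total ‖z‖ 1 with h | h
    · linarith
    · nlinarith [mul_nonneg hz (sub_nonneg.2 h), mul_nonneg (sq_nonneg ‖z‖) (sub_nonneg.2 h)]
  nlinarith [mul_nonneg hx e1]

theorem HasBounds.norm_exp_smul_D2_le (hg : HasBounds g c) (w z : Cadlag T p) {s : ℝ}
    (hs : 0 ≤ s) : ‖Real.exp (-2 * s) • D2 g (ouPoint w s z)‖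
      ≤ 6 * c * (1 + ‖w‖) * (Real.exp (-2 * s) * (1 + ‖z‖ ^ 3)) := by
  have hc := hg.nonneg
  have h2 := norm_ouPoint_le w z hs
  have hpoly := two_add_norm_le w z
  refine (ContinuousLinearMap.opNorm_smul_le _ _).trans ?_
  rw [Real.norm_of_nonneg (Real.exp_pos _).le]
  calc _ ≤ Real.exp (-2 * s) * (2 * c * (2 + ‖w‖ + ‖z‖)) := by
        refine mul_le_mul_of_nonneg_left ((hg.norm_D2_le _).trans ?_) (Real.exp_pos _).le
        refine mul_le_mul_of_nonneg_left ?_ (by positivity)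
        linarith
    _ ≤ Real.exp (-2 * s) * (2 * c * (3 * (1 + ‖w‖) * (1 + ‖z‖ ^ 3))) := by gcongr
    _ = _ := by ring

/-- Taylor estimate for the integrand of the Stein solution. -/
theorem HasBounds.abs_ou_taylor_le (hg : HasBounds g c) (w h z : Cadlag T p) (hh : ‖h‖ ≤ 1) {s : ℝ}
    (hs : 0 ≤ s) : |g (ouPoint (w + h) s z) - g (ouPoint w s z)
        - (Real.exp (-1 * s) • fderiv ℝ g (ouPoint w s z)) h|
      ≤ 3 * c * (1 + ‖w‖) * ‖h‖ ^ 2 * (Real.exp (-2 * s) * (1 + ‖z‖ ^ 3)) := by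
  have hc := hg.nonneg
  obtain ⟨-, -, -, h4⟩ := ou_coeff hs
  set e := Real.exp (-s) with he
  have he0 : 0 < e := Real.exp_pos _
  have he2 : Real.exp (-2 * s) = e ^ 2 := by
    rw [he, ← Real.exp_nat_mul]; congr 1; push_cast; ring
  set y := ouPoint w s z with hy
  have hyn : ‖y‖ ≤ ‖w‖ + ‖z‖ := norm_ouPoint_le w z hs
  have h1 := hg.abs_sub_sub_sub_le y (e • h)
  have hk : ‖e • h‖ = e * ‖h‖ := by rw [norm_smul, Real.norm_of_nonneg he0.le]
  have hk1 : e * ‖h‖ ≤ 1 := mul_le_one₀ h4 (norm_nonneg _) hh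
  have h2 : |D2 g y (e • h) (e • h)| ≤ 2 * c * (1 + ‖y‖) * (e * ‖h‖) * (e * ‖h‖) := by
    refine ((D2 g y).le_opNorm₂ _ _).trans ?_
    rw [hk]
    have := hg.norm_D2_le y
    gcongr
  have h3 : (e * ‖h‖) ^ 3 ≤ (e * ‖h‖) ^ 2 := pow_le_pow_of_le_one (by positivity) hk1 (by norm_num)
  rw [hk] at h1
  rw [neg_one_mul, ← he, smul_apply, ← map_smul, he2, ouPoint_add, ← hy, ← he]
  have h5 : |g (y + e • h) - g y - fderiv ℝ g y (e • h)|
      ≤ c / 3 * (e * ‖h‖) ^ 3 + c * (1 + ‖y‖) * (e * ‖h‖) ^ 2 := by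
    have h6 : g (y + e • h) - g y - fderiv ℝ g y (e • h)
        = (g (y + e • h) - g y - fderiv ℝ g y (e • h) - D2 g y (e • h) (e • h) / 2)
          + D2 g y (e • h) (e • h) / 2 := by ring
    rw [h6]
    refine (abs_add_le _ _).trans (add_le_add h1 ?_)
    rw [abs_div, abs_two]
    linarith
  refine h5.trans ?_
  have hpoly := two_add_norm_le w z
  calc c / 3 * (e * ‖h‖) ^ 3 + c * (1 + ‖y‖) * (e * ‖h‖) ^ 2
      ≤ c * (e * ‖h‖) ^ 2 + c * (1 + ‖y‖) * (e * ‖h‖) ^ 2 := by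
        have : c / 3 ≤ c := by linarith
        gcongr
    _ = c * (e * ‖h‖) ^ 2 * (2 + ‖y‖) := by ring
    _ ≤ c * (e * ‖h‖) ^ 2 * (3 * (1 + ‖w‖) * (1 + ‖z‖ ^ 3)) := by
        gcongr
        linarith
    _ = _ := by ring

theorem HasBounds.integrable_ou_sub (hg : HasBounds g c) (hgm : Measurable g)
    (hγ : Integrable (fun z => ‖z‖ ^ 3) γ) (w : Cadlag T p) :
    Integrable (fun θ : ℝ × Cadlag T p => g (ouPoint w θ.1 θ.2) - g θ.2) (ouMeasure γ) := by
  refine ((integrable_weight hγ zero_lt_one).const_mul (64 * c * (1 + ‖w‖ ^ 3))).mono'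
    ((aestronglyMeasurable_ou hgm w).sub (hgm.comp measurable_snd).aestronglyMeasurable) ?_
  exact ae_ouMeasure_pos.mono fun θ hθ => hg.abs_ou_sub_le w θ.2 hθ.le

theorem HasBounds.integrable_comp_add (hg : HasBounds g c) (hgm : Measurable g)
    (hγ : Integrable (fun z => ‖z‖ ^ 3) γ) (w : Cadlag T p) {φ : Cadlag T p → Cadlag T p}
    (hφ : Measurable φ) (hb : ∀ z, ‖φ z‖ ≤ ‖w‖ + ‖z‖) : Integrable (fun z => g (φ z)) γ := by
  have hc := hg.nonneg
  refine (((integrable_const (1 + 4 * ‖w‖ ^ 3)).add (hγ.const_mul 4)).const_mul c).mono'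
    (hgm.comp hφ).aestronglyMeasurable (Eventually.of_forall fun z => ?_)
  refine (hg.abs_le _).trans (mul_le_mul_of_nonneg_left ?_ hc)
  have h1 : ‖φ z‖ ^ 3 ≤ (‖w‖ + ‖z‖) ^ 3 := pow_le_pow_left₀ (norm_nonneg _) (hb z) 3
  have h2 := add_pow_le (norm_nonneg w) (norm_nonneg z) 3
  norm_num at h2
  simp only [Pi.add_apply]
  linarith

theorem HasBounds.integrable_ou (hg : HasBounds g c) (hgm : Measurable g)
    (hγ : Integrable (fun z => ‖z‖ ^ 3) γ) (w : Cadlag T p) {s : ℝ} (hs : 0 ≤ s) :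
    Integrable (fun z => g (ouPoint w s z)) γ := by
  have hm : Measurable fun z : Cadlag T p => ouPoint w s z :=
    (measurable_id.const_smul (√(1 - Real.exp (-2 * s)))).const_add (Real.exp (-s) • w)
  exact hg.integrable_comp_add hgm hγ w hm fun z => norm_ouPoint_le w z hs

theorem HasBounds.integrable_self (hg : HasBounds g c) (hgm : Measurable g)
    (hγ : Integrable (fun z => ‖z‖ ^ 3) γ) : Integrable g γ :=
  hg.integrable_comp_add hgm hγ 0 measurable_id fun z => by simp

theorem HasBounds.integrableOn_ou (hg : HasBounds g c) (hgm : Measurable g)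
    (hγ : Integrable (fun z => ‖z‖ ^ 3) γ) (w : Cadlag T p) :
    IntegrableOn (fun s => (∫ z, g (ouPoint w s z) ∂γ) - ∫ z, g z ∂γ) (Ioi (0 : ℝ)) := by
  refine (hg.integrable_ou_sub hgm hγ w).integral_prod_left.congr ?_
  filter_upwards [ae_restrict_mem measurableSet_Ioi] with s hs
  exact integral_sub (hg.integrable_ou hgm hγ w (le_of_lt hs)) (hg.integrable_self hgm hγ)

theorem HasBounds.steinSolution_eq (hg : HasBounds g c) (hgm : Measurable g)
    (hγ : Integrable (fun z => ‖z‖ ^ 3) γ) (w : Cadlag T p) :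
    steinSolution γ id g w = -∫ θ, (g (ouPoint w θ.1 θ.2) - g θ.2) ∂ouMeasure γ := by
  rw [steinSolution, ouMeasure, integral_prod _ (hg.integrable_ou_sub hgm hγ w)]
  congr 1
  refine integral_congr_ae ?_
  filter_upwards [ae_restrict_mem measurableSet_Ioi] with s hs
  exact (integral_sub (hg.integrable_ou hgm hγ w (le_of_lt hs)) (hg.integrable_self hgm hγ)).symm

theorem measurable_steinSolution (hgm : Measurable g) : Measurable (steinSolution γ id g) := by
  have hm : Measurable fun q : (Cadlag T p × ℝ) × Cadlag T p => ouPoint q.1.1 q.1.2 q.2 := by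
    have c1 : Continuous fun s : ℝ => Real.exp (-s) := by fun_prop
    have c2 : Continuous fun s : ℝ => √(1 - Real.exp (-2 * s)) := by fun_prop
    have hs : Measurable fun q : (Cadlag T p × ℝ) × Cadlag T p => q.1.2 :=
      measurable_snd.comp measurable_fst
    exact ((c1.measurable.comp hs).smul (measurable_fst.comp measurable_fst)).add
      ((c2.measurable.comp hs).smul measurable_snd)
  have h1 : Measurable fun q : (Cadlag T p × ℝ) × Cadlag T p => g (ouPoint q.1.1 q.1.2 q.2) :=
    hgm.comp hm
  have h2 : StronglyMeasurable fun q : Cadlag T p × ℝ =>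
      (∫ z, g (ouPoint q.1 q.2 z) ∂γ) - ∫ z, g z ∂γ :=
    (h1.stronglyMeasurable.integral_prod_right').sub stronglyMeasurable_const
  exact (h2.integral_prod_right' (ν := volume.restrict (Ioi (0 : ℝ)))).measurable.neg

/-- The Stein solution belongs to `M`. The first-order Taylor remainder of its derivative has the
constant `c/3`, against `c` for `g`: the integral of `e⁻³ˢ` gives the factor `1/3`. -/
theorem HasBounds.steinSolution_hasBounds (hg : HasBounds g c) (hgm : Measurable g)
    (hγ : Integrable (fun z => ‖z‖ ^ 3) γ) :
    (∃ c', HasBounds (steinSolution γ id g) c') ∧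
      ∀ w h, ‖fderiv ℝ (steinSolution γ id g) (w + h) - fderiv ℝ (steinSolution γ id g) w
        - D2 (steinSolution γ id g) w h‖ ≤ c / 3 * ‖h‖ ^ 2 := by
  have hc := hg.nonneg
  obtain ⟨I1, hI1⟩ : ∃ I1 : ℝ, I1 = ∫ θ, Real.exp (-1 * θ.1) * (1 + ‖θ.2‖ ^ 3) ∂ouMeasure γ :=
    ⟨_, rfl⟩
  obtain ⟨I2, hI2⟩ : ∃ I2 : ℝ, I2 = ∫ θ, Real.exp (-2 * θ.1) * (1 + ‖θ.2‖ ^ 3) ∂ouMeasure γ :=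
    ⟨_, rfl⟩
  have hI1p : 0 ≤ I1 := hI1 ▸ integral_nonneg fun θ => by positivity
  have hI2p : 0 ≤ I2 := hI2 ▸ integral_nonneg fun θ => by positivity
  have hw1 := integrable_weight hγ (zero_lt_one' ℝ)
  have hw2 := integrable_weight hγ (zero_lt_two' ℝ)
  have hf0 : ∀ w, |steinSolution γ id g w| ≤ 64 * c * (1 + ‖w‖ ^ 3) * I1 := fun w => by
    rw [hg.steinSolution_eq hgm hγ, abs_neg, hI1, ← integral_const_mul]
    exact norm_integral_le_of_norm_le
      (f := fun θ : ℝ × Cadlag T p => g (ouPoint w θ.1 θ.2) - g θ.2)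
      (hw1.const_mul (64 * c * (1 + ‖w‖ ^ 3)))
      (ae_ouMeasure_pos.mono fun θ hθ => hg.abs_ou_sub_le w θ.2 hθ.le)
  have hA : ∀ w, ∃ A : Cadlag T p →L[ℝ] ℝ,
      (∀ h, Integrable (fun θ : ℝ × Cadlag T p =>
        (Real.exp (-1 * θ.1) • fderiv ℝ g (ouPoint w θ.1 θ.2)) h) (ouMeasure γ)) ∧
      (∀ h, A h = ∫ θ, (Real.exp (-1 * θ.1) • fderiv ℝ g (ouPoint w θ.1 θ.2)) h ∂ouMeasure γ) ∧
      ‖A‖ ≤ 4 * c * (1 + ‖w‖ ^ 2) * I1 := fun w => by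
    have hm : ∀ h, Measurable fun y : Cadlag T p => fderiv ℝ g y h := fun h =>
      (measurable_fderiv_apply hgm hg.differentiable).comp (measurable_id.prodMk measurable_const)
    obtain ⟨A, h1, h2, h3⟩ := exists_weak_integral
      (L := fun θ : ℝ × Cadlag T p => Real.exp (-1 * θ.1) • fderiv ℝ g (ouPoint w θ.1 θ.2))
      (hw1.const_mul (4 * c * (1 + ‖w‖ ^ 2)))
      (fun h => (measurable_exp_fst 1).aestronglyMeasurable.mul (aestronglyMeasurable_ou (hm h) w))
      (ae_ouMeasure_pos.mono fun θ hθ => hg.norm_exp_smul_fderiv_le w θ.2 hθ.le)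
    exact ⟨A, h1, h2, by rwa [integral_const_mul, ← hI1] at h3⟩
  choose A hAi hAe hAn using hA
  have hB : ∀ w, ∃ B : Cadlag T p →L[ℝ] Cadlag T p →L[ℝ] ℝ,
      (∀ h k, Integrable (fun θ : ℝ × Cadlag T p =>
        (Real.exp (-2 * θ.1) • D2 g (ouPoint w θ.1 θ.2)) h k) (ouMeasure γ)) ∧
      (∀ h k, B h k = ∫ θ, (Real.exp (-2 * θ.1) • D2 g (ouPoint w θ.1 θ.2)) h k ∂ouMeasure γ) ∧
      ‖B‖ ≤ 6 * c * (1 + ‖w‖) * I2 := fun w => by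
    have hm : ∀ h k, Measurable fun y : Cadlag T p => D2 g y h k := fun h k => by
      have hp : Measurable fun y : Cadlag T p => (y, h, k) := measurable_id.prodMk measurable_const
      exact (measurable_D2_apply hgm hg.differentiable hg.differentiable_fderiv).comp hp
    obtain ⟨B, h1, h2, h3⟩ := exists_weak_integral₂
      (L := fun θ : ℝ × Cadlag T p => Real.exp (-2 * θ.1) • D2 g (ouPoint w θ.1 θ.2))
      (hw2.const_mul (6 * c * (1 + ‖w‖)))
      (fun h k => (measurable_exp_fst 2).aestronglyMeasurable.mul
        (aestronglyMeasurable_ou (hm h k) w))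
      (ae_ouMeasure_pos.mono fun θ hθ => hg.norm_exp_smul_D2_le w θ.2 hθ.le)
    exact ⟨B, h1, h2, by rwa [integral_const_mul, ← hI2] at h3⟩
  choose B hBi hBe hBn using hB
  have hfd : ∀ w, HasFDerivAt (steinSolution γ id g) (-A w) w := fun w => by
    refine hasFDerivAt_of_norm_le_sq (C := 3 * c * (1 + ‖w‖) * I2) fun h hh => ?_
    have e1 : steinSolution γ id g (w + h) - steinSolution γ id g w - (-A w) h
        = -∫ θ, (g (ouPoint (w + h) θ.1 θ.2) - g (ouPoint w θ.1 θ.2)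
          - (Real.exp (-1 * θ.1) • fderiv ℝ g (ouPoint w θ.1 θ.2)) h) ∂ouMeasure γ := by
      have i1 := hg.integrable_ou_sub hgm hγ (w + h)
      have i2 := hg.integrable_ou_sub hgm hγ w
      have i3 := (i1.sub i2).sub (hAi w h)
      rw [hg.steinSolution_eq hgm hγ, hg.steinSolution_eq hgm hγ, neg_apply, hAe w h]
      have e2 : ∀ θ : ℝ × Cadlag T p, g (ouPoint (w + h) θ.1 θ.2) - g (ouPoint w θ.1 θ.2)
          - (Real.exp (-1 * θ.1) • fderiv ℝ g (ouPoint w θ.1 θ.2)) h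
          = (g (ouPoint (w + h) θ.1 θ.2) - g θ.2) - (g (ouPoint w θ.1 θ.2) - g θ.2)
            - (Real.exp (-1 * θ.1) • fderiv ℝ g (ouPoint w θ.1 θ.2)) h := fun θ => by ring
      simp_rw [e2]
      have e3 := integral_sub (i1.sub i2) (hAi w h)
      simp only [Pi.sub_apply] at e3
      rw [e3, integral_sub i1 i2]
      ring
    rw [e1, norm_neg]
    refine (norm_integral_le_of_norm_le (hw2.const_mul (3 * c * (1 + ‖w‖) * ‖h‖ ^ 2))
      (ae_ouMeasure_pos.mono fun θ hθ => hg.abs_ou_taylor_le w h θ.2 hh hθ.le)).trans_eq ?_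
    rw [integral_const_mul, ← hI2]
    ring
  have hfeq : fderiv ℝ (steinSolution γ id g) = fun w => -A w := funext fun w => (hfd w).fderiv
  obtain ⟨hi3, hv3⟩ := integrable_exp_fst (γ := γ) (zero_lt_three' ℝ)
  have hTaylor : ∀ w h, ‖(-A (w + h)) - (-A w) - (-B w) h‖ ≤ c / 3 * ‖h‖ ^ 2 := fun w h => by
    refine ContinuousLinearMap.opNorm_le_bound _ (by positivity) fun k => ?_
    have e1 : ((-A (w + h)) - (-A w) - (-B w) h) k = -∫ θ,
        ((Real.exp (-1 * θ.1) • fderiv ℝ g (ouPoint (w + h) θ.1 θ.2)) k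
          - (Real.exp (-1 * θ.1) • fderiv ℝ g (ouPoint w θ.1 θ.2)) k
          - (Real.exp (-2 * θ.1) • D2 g (ouPoint w θ.1 θ.2)) h k) ∂ouMeasure γ := by
      have e3 := integral_sub ((hAi (w + h) k).sub (hAi w k)) (hBi w h k)
      simp only [Pi.sub_apply] at e3
      rw [e3, integral_sub (hAi _ k) (hAi _ k), ← hAe, ← hAe, ← hBe]
      change -A (w + h) k - -A w k - -B w h k = _
      ring
    rw [e1, norm_neg]
    refine (norm_integral_le_of_norm_le (hi3.const_mul (c * ‖h‖ ^ 2 * ‖k‖)) ?_).trans_eq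
      (by rw [integral_const_mul, hv3]; ring)
    refine Eventually.of_forall fun θ => ?_
    set e := Real.exp (-θ.1) with he
    have he0 : 0 < e := Real.exp_pos _
    have he2 : Real.exp (-2 * θ.1) = e * e := by
      rw [he, ← Real.exp_add]; congr 1; ring
    have he3 : Real.exp (-3 * θ.1) = e * (e * e) := by
      rw [he, ← Real.exp_add, ← Real.exp_add]; congr 1; ring
    rw [neg_one_mul, ← he, he2, he3, ouPoint_add, ← he]
    set y := ouPoint w θ.1 θ.2
    have e2 : (e • fderiv ℝ g (y + e • h)) k - (e • fderiv ℝ g y) k - ((e * e) • D2 g y) h k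
        = e * (fderiv ℝ g (y + e • h) - fderiv ℝ g y - D2 g y (e • h)) k := by
      change e * fderiv ℝ g (y + e • h) k - e * fderiv ℝ g y k - e * e * D2 g y h k = _
      rw [sub_apply, sub_apply, map_smul, smul_apply, smul_eq_mul]
      ring
    rw [e2, norm_mul, Real.norm_of_nonneg he0.le]
    have h4 := hg.norm_fderiv_sub_sub_le y (e • h)
    rw [norm_smul, Real.norm_of_nonneg he0.le] at h4
    calc _ ≤ e * (c * (e * ‖h‖) ^ 2 * ‖k‖) := by
          refine mul_le_mul_of_nonneg_left ?_ he0.le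
          exact (ContinuousLinearMap.le_opNorm _ k).trans
            (mul_le_mul_of_nonneg_right h4 (norm_nonneg k))
      _ = _ := by ring
  have hfd2 : ∀ w, HasFDerivAt (fun w => -A w) (-B w) w := fun w =>
    hasFDerivAt_of_norm_le_sq fun h _ => hTaylor w h
  have hD2 : ∀ w, D2 (steinSolution γ id g) w = -B w := fun w => by
    rw [D2, hfeq]
    exact (hfd2 w).fderiv
  have hLip : ∀ w h, ‖B (w + h) - B w‖ ≤ 2 * c / 3 * ‖h‖ := fun w h => by
    refine ContinuousLinearMap.opNorm_le_bound₂ _ (by positivity) fun k l => ?_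
    have e1 : (B (w + h) - B w) k l = ∫ θ,
        ((Real.exp (-2 * θ.1) • D2 g (ouPoint (w + h) θ.1 θ.2)) k l
          - (Real.exp (-2 * θ.1) • D2 g (ouPoint w θ.1 θ.2)) k l) ∂ouMeasure γ := by
      rw [integral_sub (hBi _ k l) (hBi _ k l), ← hBe, ← hBe]
      rfl
    rw [e1]
    refine (norm_integral_le_of_norm_le (hi3.const_mul (2 * c * ‖h‖ * ‖k‖ * ‖l‖)) ?_).trans_eq
      (by rw [integral_const_mul, hv3]; ring)
    refine Eventually.of_forall fun θ => ?_
    set e := Real.exp (-θ.1) with he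
    have he0 : 0 < e := Real.exp_pos _
    have he2 : Real.exp (-2 * θ.1) = e * e := by
      rw [he, ← Real.exp_add]; congr 1; ring
    have he3 : Real.exp (-3 * θ.1) = e * (e * e) := by
      rw [he, ← Real.exp_add, ← Real.exp_add]; congr 1; ring
    rw [he2, he3, ouPoint_add, ← he]
    set y := ouPoint w θ.1 θ.2
    have e2 : ((e * e) • D2 g (y + e • h)) k l - ((e * e) • D2 g y) k l
        = (e * e) * (D2 g (y + e • h) - D2 g y) k l := by
      change e * e * D2 g (y + e • h) k l - e * e * D2 g y k l
        = (e * e) * (D2 g (y + e • h) k l - D2 g y k l)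
      ring
    rw [e2, norm_mul, Real.norm_of_nonneg (by positivity)]
    have h4 := hg.norm_D2_sub_le y (e • h)
    rw [norm_smul, Real.norm_of_nonneg he0.le] at h4
    calc _ ≤ e * e * (2 * c * (e * ‖h‖) * ‖k‖ * ‖l‖) := by
          refine mul_le_mul_of_nonneg_left ?_ (by positivity)
          refine (ContinuousLinearMap.le_opNorm₂ _ k l).trans ?_
          gcongr
      _ = _ := by ring
  refine ⟨⟨64 * c * I1 + 6 * c * I2 + c, ?_, fun w => (hfd w).differentiableAt, ?_, fun w => ?_,
    fun w => ?_, fun w => ?_, fun w h => ?_⟩, fun w h => ?_⟩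
  · positivity
  · rw [hfeq]
    exact fun w => (hfd2 w).differentiableAt
  · refine (hf0 w).trans ?_
    have : 0 ≤ (6 * c * I2 + c) * (1 + ‖w‖ ^ 3) := by positivity
    linarith
  · rw [hfeq, norm_neg]
    refine (hAn w).trans ?_
    have : 0 ≤ (60 * c * I1 + 6 * c * I2 + c) * (1 + ‖w‖ ^ 2) := by positivity
    linarith
  · rw [hD2, ContinuousLinearMap.opNorm_neg]
    refine (hBn w).trans ?_
    have : 0 ≤ (128 * c * I1 + 6 * c * I2 + 2 * c) * (1 + ‖w‖) := by positivity
    linarith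
  · have e : D2 (steinSolution γ id g) (w + h) - D2 (steinSolution γ id g) w
        = -(B (w + h) - B w) := by
      rw [hD2, hD2]
      abel
    rw [e, ContinuousLinearMap.opNorm_neg]
    refine (hLip w h).trans ?_
    have : 0 ≤ (128 * c * I1 + 12 * c * I2 + 4 / 3 * c) * ‖h‖ := by positivity
    linarith
  · rw [hfeq, hD2]
    exact hTaylor w h

end OrnsteinUhlenbeck


/-! ### The law of the Gaussian process on the space of càdlàg paths -/

namespace Cadlag

variable {T : ℝ} {p : ℕ}

/-- The vector of the values of a path at the times in a finite set. -/
noncomputable def evalOn (I : Finset (Icc (0 : ℝ) T)) (x : Cadlag T p) (t : I) : Euc p := x.path t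

theorem measurable_evalOn (I : Finset (Icc (0 : ℝ) T)) :
    Measurable (evalOn I : Cadlag T p → I → Euc p) :=
  measurable_pi_lambda _ fun t => measurable_eval t.1

theorem norm_evalOn_le (I : Finset (Icc (0 : ℝ) T)) (x : Cadlag T p) : ‖evalOn I x‖ ≤ ‖x‖ :=
  (pi_norm_le_iff_of_nonneg (norm_nonneg _)).2 fun t => norm_apply_le x t

/-- A law on the path space is determined by its finite-dimensional distributions. -/
theorem measure_ext {μ ν : Measure (Cadlag T p)} [IsProbabilityMeasure μ] [IsProbabilityMeasure ν]
    (h : ∀ I, μ.map (evalOn I) = ν.map (evalOn I)) : μ = ν := by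
  have hm : Measurable (path : Cadlag T p → Icc (0 : ℝ) T → Euc p) :=
    measurable_pi_lambda _ fun t => measurable_eval t
  have e : ∀ (ρ : Measure (Cadlag T p)) (I : Finset (Icc (0 : ℝ) T)),
      (ρ.map path).map I.restrict = ρ.map (evalOn I) := fun ρ I => by
    rw [Measure.map_map (Finset.measurable_restrict I) hm]
    rfl
  have hp : ∀ I : Finset (Icc (0 : ℝ) T), IsProbabilityMeasure (ν.map (evalOn I)) := fun I =>
    Measure.isProbabilityMeasure_map (measurable_evalOn I).aemeasurable
  have key : μ.map path = ν.map path :=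
    IsProjectiveLimit.unique (P := fun I => ν.map (evalOn I))
      (fun I => (e μ I).trans (h I)) (fun I => e ν I)
  refine Measure.ext fun A hA => ?_
  obtain ⟨B, hB, rfl⟩ := hA
  change μ (path ⁻¹' B) = ν (path ⁻¹' B)
  rw [← Measure.map_apply hm hB, key, Measure.map_apply hm hB]

end Cadlag

/-- The law on the path space of a continuous centred Gaussian process with covariance
`∫ J_u(s) J_u(t)ᵀ Lam(du)`. Continuity enters only through the convergence of the discretizations
along a time grid, which is a measurable condition on the path. -/
structure IsGaussianPathLaw {T : ℝ} {p d : ℕ} (γ : Measure (Cadlag T p)) (J : Euc d → Cadlag T p)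
    (Lam : Measure (Euc d)) : Prop where
  isGaussian : ∀ I, IsGaussian (γ.map (Cadlag.evalOn I))
  centred : ∀ s, ∫ z, z.path s ∂γ = 0
  cov : ∀ s t i j, ∫ z, z.path s i * z.path t j ∂γ = ∫ u, (J u).path s i * (J u).path t j ∂Lam
  tendsto_discretize : ∀ τ, Cadlag.IsTimeGrid τ →
    ∀ᵐ z ∂γ, Tendsto (fun n => ‖Cadlag.discretize (τ n) z - z‖) atTop (𝓝 0)

section GaussianLaw

open Cadlag

variable {T : ℝ} {p d : ℕ} {Ω' : Type*} [MeasurableSpace Ω'] {Q : Measure Ω'}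
  {Z : Icc (0 : ℝ) T → Ω' → Euc p} {J : Euc d → Cadlag T p} {Lam : Measure (Euc d)}

namespace IsCentredGaussianWithCov

theorem ae_path (hZ : IsCentredGaussianWithCov Q Z J Lam) :
    ∀ᵐ ω ∂Q, ∀ t, (toCadlag fun s => Z s ω).path t = Z t ω := by
  filter_upwards [hZ.continuous_paths] with ω hω t
  refine path_toCadlag (fun t => ⟨hω.continuousWithinAt, Z t ω, ?_⟩) t
  exact hω.continuousAt.tendsto.mono_left nhdsWithin_le_nhds

/-- The path of the process is measurable up to a null set, although only the single values `Z s`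
are assumed to be (almost everywhere) measurable. -/
theorem aemeasurable_path (hZ : IsCentredGaussianWithCov Q Z J Lam) :
    AEMeasurable (fun ω => (toCadlag fun s => Z s ω : Cadlag T p)) Q := by
  obtain ⟨D, hD, hd⟩ := TopologicalSpace.exists_countable_dense (Icc (0 : ℝ) T)
  have hae := fun s => hZ.gaussian.aemeasurable s
  have h1 : ∀ᵐ ω ∂Q, (∀ s ∈ D, Z s ω = (hae s).mk (Z s) ω) ∧ (Continuous fun s => Z s ω) ∧
      ∀ t, (toCadlag fun s => Z s ω : Cadlag T p).path t = Z t ω := by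
    filter_upwards [(ae_ball_iff hD).2 fun s _ => (hae s).ae_eq_mk, hZ.continuous_paths, hZ.ae_path]
      with ω h1 h2 h3 using ⟨h1, h2, h3⟩
  obtain ⟨G, hGQ, hGm, hG⟩ := h1.exists_measurable_mem
  classical
  refine ⟨fun ω => if ω ∈ G then toCadlag fun s => Z s ω else 0, measurable_iff.2 fun t => ?_, ?_⟩
  · obtain ⟨u, hu, hut⟩ := mem_closure_iff_seq_limit.1 (hd t)
    refine measurable_of_tendsto_metrizable
      (f := fun n ω => if ω ∈ G then (hae (u n)).mk (Z (u n)) ω else 0)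
      (fun n => Measurable.ite hGm (hae (u n)).measurable_mk measurable_const) ?_
    rw [tendsto_pi_nhds]
    intro ω
    by_cases hω : ω ∈ G
    · obtain ⟨e1, e2, e3⟩ := hG ω hω
      simp only [hω, if_true, e3]
      refine ((e2.tendsto t).comp hut).congr fun n => e1 _ (hu n)
    · simp only [hω, if_false]
      exact tendsto_const_nhds
  · filter_upwards [hGQ] with ω hω
    rw [if_pos hω]

theorem isGaussianPathLaw (hZ : IsCentredGaussianWithCov Q Z J Lam) :
    IsGaussianPathLaw (Q.map fun ω => (toCadlag fun s => Z s ω : Cadlag T p)) J Lam := by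
  have hm := hZ.aemeasurable_path
  refine ⟨fun I => ?_, fun s => ?_, fun s t i j => ?_, fun τ hτ => ?_⟩
  · have h1 := (hZ.gaussian.hasGaussianLaw I).isGaussian_map
    have h2 : (Q.map fun ω => (toCadlag fun s => Z s ω : Cadlag T p)).map (evalOn I)
        = Q.map fun ω => I.restrict (Z · ω) := by
      rw [AEMeasurable.map_map_of_aemeasurable (measurable_evalOn I).aemeasurable hm]
      refine Measure.map_congr ?_
      filter_upwards [hZ.ae_path] with ω hω
      exact funext fun t => hω t
    rwa [h2]
  · rw [integral_map hm (measurable_eval s).aestronglyMeasurable, ← hZ.centred s]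
    exact integral_congr_ae (hZ.ae_path.mono fun ω hω => hω s)
  · have hst : Measurable fun z : Cadlag T p => z.path s i * z.path t j :=
      (measurable_coord s i).mul (measurable_coord t j)
    rw [integral_map hm hst.aestronglyMeasurable]
    refine Eq.trans ?_ (hZ.cov s t i j)
    refine integral_congr_ae ?_
    filter_upwards [hZ.ae_path] with ω hω
    rw [hω s, hω t]
  · refine (ae_map_iff hm ?_).2 ?_
    · exact measurableSet_tendsto _ fun n =>
        Cadlag.measurable_norm.comp ((IsTimeGrid.measurable_discretize n).sub measurable_id)
    · filter_upwards [hZ.ae_path, hZ.continuous_paths] with ω h1 h2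
      exact hτ.tendsto_discretize_of_continuous (h2.congr fun t => (h1 t).symm)

end IsCentredGaussianWithCov

namespace IsGaussianPathLaw

variable {γ : Measure (Cadlag T p)}

theorem isProbabilityMeasure (hγ : IsGaussianPathLaw γ J Lam) : IsProbabilityMeasure γ := by
  have h := hγ.isGaussian ∅
  have h1 := h.toIsProbabilityMeasure
  exact Measure.isProbabilityMeasure_of_map (evalOn ∅)

theorem integral_id_map_evalOn (hγ : IsGaussianPathLaw γ J Lam) (I : Finset (Icc (0 : ℝ) T)) :
    (γ.map (evalOn I))[id] = 0 := by
  have h := hγ.isGaussian I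
  have hi : Integrable id (γ.map (evalOn I)) := IsGaussian.integrable_id
  have h1 := (measurable_evalOn (T := T) (p := p) I).aemeasurable (μ := γ)
  rw [integral_map h1 hi.aestronglyMeasurable]
  have hi' := (integrable_map_measure hi.aestronglyMeasurable h1).1 hi
  ext1 t
  refine (eval_integral (fun t => hi'.eval t) t).trans ?_
  exact hγ.centred t

/-- Rotation invariance of the centred Gaussian law. -/
theorem map_add_smul_prod (hγ : IsGaussianPathLaw γ J Lam) {a b : ℝ} (hab : a ^ 2 + b ^ 2 = 1) :
    (γ.prod γ).map (fun q => a • q.1 + b • q.2) = γ := by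
  have hP := hγ.isProbabilityMeasure
  have hm : Measurable fun q : Cadlag T p × Cadlag T p => a • q.1 + b • q.2 :=
    (measurable_fst.const_smul a).add (measurable_snd.const_smul b)
  have hP' := Measure.isProbabilityMeasure_map hm.aemeasurable (μ := γ.prod γ)
  obtain ⟨θ, hc, hs⟩ : ∃ θ, Real.cos θ = a ∧ Real.sin θ = b := by
    have hz : ‖(⟨a, b⟩ : ℂ)‖ = 1 := by
      rw [Complex.norm_def, Complex.normSq_mk, ← sq, ← sq, hab, Real.sqrt_one]
    refine ⟨Complex.arg ⟨a, b⟩, ?_, ?_⟩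
    · rw [Complex.cos_arg (norm_ne_zero_iff.1 (by rw [hz]; exact one_ne_zero)), hz, div_one]
    · rw [Complex.sin_arg, hz, div_one]
  refine measure_ext fun I => ?_
  have hG := hγ.isGaussian I
  have h1 := IsGaussian.map_rotation_eq_self (hγ.integral_id_map_evalOn I) θ
  have h2 := congrArg (Measure.map Prod.fst) h1
  rw [Measure.map_fst_prod, Measure.map_map measurable_fst
    (ContinuousLinearMap.rotation θ).continuous.measurable, measure_univ, one_smul] at h2
  refine Eq.trans ?_ h2
  rw [Measure.map_prod_map _ _ (measurable_evalOn I) (measurable_evalOn I),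
    Measure.map_map (measurable_evalOn I) hm, Measure.map_map
    (measurable_fst.comp (ContinuousLinearMap.rotation θ).continuous.measurable)
    ((measurable_evalOn I).prodMap (measurable_evalOn I))]
  congr 1
  funext q
  simp only [Function.comp_apply, ContinuousLinearMap.rotation_apply, hc, hs]
  rfl

/-- The third moment of the norm is finite: Fernique's bound for the values on a finite set of times
does not depend on the set. -/
theorem integrable_norm_pow_three (hT : 0 ≤ T) (hγ : IsGaussianPathLaw γ J Lam) :
    Integrable (fun z => ‖z‖ ^ 3) γ := by
  have hP := hγ.isProbabilityMeasure
  obtain ⟨τ, hτ, -⟩ := exists_isTimeGrid hT (countable_empty (α := Icc (0 : ℝ) T))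
  obtain ⟨n, hn⟩ : ∃ n : ℕ, (3 / 4 : ℝ≥0∞) < γ {z | ‖z‖ ≤ n} := by
    have h1 : Tendsto (fun n : ℕ => γ {z | ‖z‖ ≤ n}) atTop (𝓝 (γ (⋃ n : ℕ, {z | ‖z‖ ≤ n}))) :=
      tendsto_measure_iUnion_atTop fun m n hmn z (hz : ‖z‖ ≤ m) =>
        hz.trans (Nat.cast_le.2 hmn)
    have h2 : (⋃ n : ℕ, {z : Cadlag T p | ‖z‖ ≤ n}) = univ :=
      eq_univ_of_forall fun z => mem_iUnion.2 (exists_nat_ge ‖z‖)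
    rw [h2, measure_univ] at h1
    refine (h1.eventually (lt_mem_nhds ?_)).exists
    refine ENNReal.div_lt_of_lt_mul ?_
    norm_num
  have hc0 : (2⁻¹ : ℝ≥0∞) < 3 / 4 := by
    rw [ENNReal.lt_div_iff_mul_lt (by simp) (by simp)]
    have : (2⁻¹ : ℝ≥0∞) * 4 = 2 := by
      rw [show (4 : ℝ≥0∞) = 2 * 2 by norm_num, ← mul_assoc, ENNReal.inv_mul_cancel (by simp) (by simp),
        one_mul]
    rw [this]; norm_num
  have hc1 : (3 / 4 : ℝ≥0∞) < 1 := ENNReal.div_lt_of_lt_mul (by norm_num)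
  set k := Fernique.logRatio (3 / 4) * (n + 1 : ℝ)⁻¹ ^ 2 with hk
  have hkpos : 0 < k := mul_pos (Fernique.logRatio_pos hc0 hc1) (by positivity)
  obtain ⟨C, hC, hCb⟩ : ∃ C : ℝ≥0∞, C < ∞ ∧ ∀ I : Finset (Icc (0 : ℝ) T),
      ∫⁻ z, ENNReal.ofReal (Real.exp (k * ‖evalOn I z‖ ^ 2)) ∂γ ≤ C := by
    refine ⟨ENNReal.ofReal (Real.exp (Fernique.logRatio (3 / 4))) + ∑' n, ENNReal.ofReal
      (Real.exp (-2⁻¹ * Real.log ((3 / 4 : ℝ≥0∞) / (1 - 3 / 4)).toReal * 2 ^ n)), ?_, fun I => ?_⟩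
    rotate_left
    · have hG := hγ.isGaussian I
      have h1 := lintegral_exp_mul_sq_norm_le_of_map_rotation_eq_self (a := n + 1)
        (IsGaussian.map_rotation_eq_self (hγ.integral_id_map_evalOn I) _) (c := 3 / 4) ?_ hc0
      · rw [lintegral_map (by fun_prop) (measurable_evalOn I)] at h1
        exact h1
      · rw [Measure.map_apply (measurable_evalOn I)
          (measurableSet_le measurable_norm measurable_const)]
        refine hn.le.trans (measure_mono fun z (hz : ‖z‖ ≤ n) => ?_)
        exact (norm_evalOn_le I z).trans (hz.trans (by linarith))
    · refine ENNReal.add_lt_top.2 ⟨ENNReal.ofReal_lt_top, ?_⟩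
      refine Summable.tsum_ofReal_lt_top <|
        Real.summable_exp_nat_mul_of_ge ?_ (fun i ↦ mod_cast (Nat.lt_pow_self (by simp)).le)
      refine mul_neg_of_neg_of_pos (by simp) (Real.log_pos ?_)
      rw [ENNReal.toReal_div, ENNReal.toReal_sub_of_le hc1.le ENNReal.one_ne_top,
        ENNReal.toReal_div]
      norm_num
  have hb : ∀ m, ∫⁻ z, ‖evalOn (τ m) z‖ₑ ^ 3 ∂γ ≤ ENNReal.ofReal (1 + 2 / k ^ 2) * C := fun m => by
    refine le_trans ?_ (mul_le_mul_right (hCb (τ m)) _)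
    rw [← lintegral_const_mul' _ _ ENNReal.ofReal_ne_top]
    refine lintegral_mono fun z => ?_
    rw [← ofReal_norm, ← ENNReal.ofReal_pow (norm_nonneg _), ← ENNReal.ofReal_mul (by positivity)]
    refine ENNReal.ofReal_le_ofReal ?_
    set x := ‖evalOn (τ m) z‖
    have hx : 0 ≤ x := norm_nonneg _
    have h1 := Real.quadratic_le_exp_of_nonneg (x := k * x ^ 2) (by positivity)
    have h2 : x ^ 3 ≤ 1 + x ^ 4 := by
      rcases le_total x 1 with h | h
      · have := pow_le_one₀ (n := 3) hx h
        have : 0 ≤ x ^ 4 := by positivity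
        linarith
      · have := pow_le_pow_right₀ h (by norm_num : 3 ≤ 4)
        linarith
    refine h2.trans ?_
    rw [add_mul, one_mul]
    refine add_le_add (by nlinarith [sq_nonneg (k * x ^ 2), mul_nonneg hkpos.le (sq_nonneg x)]) ?_
    rw [div_mul_eq_mul_div, le_div_iff₀ (by positivity)]
    nlinarith [mul_nonneg hkpos.le (sq_nonneg x)]
  have hsup : ∀ z : Cadlag T p, ‖z‖ₑ ^ 3 = ⨆ m, ‖evalOn (τ m) z‖ₑ ^ 3 := fun z => by
    refine le_antisymm ?_ (iSup_le fun m => ?_)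
    · have h1 : ‖z‖ₑ ≤ ⨆ m, ‖evalOn (τ m) z‖ₑ := by
        rw [norm_eq_iSup_enorm hτ.dense fun t ht => ?_]
        · refine iSup₂_le fun t ht => ?_
          obtain ⟨m, hm⟩ := mem_iUnion.1 ht
          refine le_iSup_of_le m ?_
          rw [← ofReal_norm, ← ofReal_norm]
          exact ENNReal.ofReal_le_ofReal (norm_le_pi_norm (evalOn (τ m) z) ⟨t, hm⟩)
        · obtain ⟨r, hr, hl⟩ := hτ.last 0
          exact mem_iUnion.2 ⟨0, by rwa [le_antisymm (hl t) (ht r)] ⟩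
      refine (pow_le_pow_left₀ (zero_le) h1 3).trans_eq ?_
      exact ENNReal.iSup_pow_of_ne_zero three_ne_zero _
    · refine pow_le_pow_left₀ (zero_le) ?_ 3
      rw [← ofReal_norm, ← ofReal_norm]
      exact ENNReal.ofReal_le_ofReal (norm_evalOn_le _ z)
  have hfin : ∫⁻ z, ‖z‖ₑ ^ 3 ∂γ < ∞ := by
    simp_rw [hsup]
    rw [lintegral_iSup (fun m => ((measurable_evalOn (τ m)).enorm).pow_const 3) ?_]
    · exact (iSup_le hb).trans_lt (ENNReal.mul_lt_top ENNReal.ofReal_lt_top hC)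
    · intro m n hmn z
      refine pow_le_pow_left₀ (zero_le) ?_ 3
      rw [← ofReal_norm, ← ofReal_norm]
      refine ENNReal.ofReal_le_ofReal ((pi_norm_le_iff_of_nonneg (norm_nonneg _)).2 fun t => ?_)
      exact norm_le_pi_norm (evalOn (τ n) z) ⟨t.1, hτ.mono hmn t.2⟩
  refine ⟨(Cadlag.measurable_norm.pow_const 3).aestronglyMeasurable, ?_⟩
  refine lt_of_le_of_lt (lintegral_mono fun z => ?_) hfin
  rw [enorm_pow, enorm_norm]

end IsGaussianPathLaw

end GaussianLaw


/-! ### The Stein equation -/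

section SteinEquation

variable {T : ℝ} {p : ℕ} {γ : Measure (Cadlag T p)}

/-- Invariance of `γ ⊗ γ` under rotations, in the form used for centred Gaussian laws. -/
def IsRotationInvariant (γ : Measure (Cadlag T p)) : Prop :=
  ∀ a b : ℝ, a ^ 2 + b ^ 2 = 1 → (γ.prod γ).map (fun q => a • q.1 + b • q.2) = γ

theorem measurable_ouPoint_right (w : Cadlag T p) (s : ℝ) :
    Measurable fun z : Cadlag T p => ouPoint w s z :=
  (measurable_id.const_smul (√(1 - Real.exp (-2 * s)))).const_add (Real.exp (-s) • w)

theorem exp_neg_two_mul (s : ℝ) : Real.exp (-2 * s) = Real.exp (-s) ^ 2 := by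
  rw [← Real.exp_nat_mul]; congr 1; push_cast; ring

theorem measurable_ouPoint_ouPoint (w : Cadlag T p) (t s : ℝ) :
    Measurable fun q : Cadlag T p × Cadlag T p => ouPoint (ouPoint w t q.1) s q.2 :=
  (((measurable_ouPoint_right w t).comp measurable_fst).const_smul (Real.exp (-s))).add
    (measurable_snd.const_smul (√(1 - Real.exp (-2 * s))))

/-- The semigroup property of the Ornstein–Uhlenbeck semigroup (Mehler's formula). -/
theorem IsRotationInvariant.map_ouPoint_ouPoint (hγ : IsRotationInvariant γ) (w : Cadlag T p)
    {t s : ℝ} (ht : 0 < t) (hs : 0 ≤ s) :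
    (γ.prod γ).map (fun q => ouPoint (ouPoint w t q.1) s q.2) = γ.map (ouPoint w (s + t)) := by
  obtain ⟨x, hx⟩ : ∃ x, x = Real.exp (-s) := ⟨_, rfl⟩
  obtain ⟨y, hy⟩ : ∃ y, y = Real.exp (-t) := ⟨_, rfl⟩
  have hx0 : 0 < x := hx ▸ Real.exp_pos _
  have hy0 : 0 < y := hy ▸ Real.exp_pos _
  have hx1 : x ≤ 1 := hx ▸ Real.exp_le_one_iff.2 (by linarith)
  have hy1 : y < 1 := hy ▸ Real.exp_lt_one_iff.2 (by linarith)
  have hxy : Real.exp (-(s + t)) = x * y := by rw [hx, hy, ← Real.exp_add]; congr 1; ring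
  have hρ : 0 < 1 - (x * y) ^ 2 := by
    have : x * y < 1 := by nlinarith
    nlinarith [mul_pos hx0 hy0]
  set ρ := √(1 - (x * y) ^ 2) with hρd
  have hρ0 : 0 < ρ := Real.sqrt_pos.2 hρ
  have hρ2 : ρ ^ 2 = 1 - (x * y) ^ 2 := Real.sq_sqrt hρ.le
  set α := √(1 - y ^ 2) with hα
  have hα2 : α ^ 2 = 1 - y ^ 2 := Real.sq_sqrt (by nlinarith)
  set β := √(1 - x ^ 2) with hβ
  have hβ2 : β ^ 2 = 1 - x ^ 2 := Real.sq_sqrt (by nlinarith)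
  have hab : (x * α / ρ) ^ 2 + (β / ρ) ^ 2 = 1 := by
    rw [div_pow, div_pow, ← add_div, mul_pow, hα2, hβ2, hρ2, div_eq_one_iff_eq hρ.ne']
    ring
  have hm : Measurable fun q : Cadlag T p × Cadlag T p => (x * α / ρ) • q.1 + (β / ρ) • q.2 :=
    (measurable_fst.const_smul (x * α / ρ)).add (measurable_snd.const_smul (β / ρ))
  conv_rhs => rw [← hγ _ _ hab, Measure.map_map (measurable_ouPoint_right w _) hm]
  congr 1
  funext q
  simp only [ouPoint, Function.comp_apply, exp_neg_two_mul, hxy, ← hx, ← hy, ← hα, ← hβ, ← hρd,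
    smul_add, smul_smul, mul_div_cancel₀ _ hρ0.ne']
  abel

theorem IsRotationInvariant.map_neg [IsProbabilityMeasure γ] (hγ : IsRotationInvariant γ) :
    γ.map (fun z => -z) = γ := by
  have h := hγ (-1) 0 (by norm_num)
  simp only [zero_smul, add_zero, neg_one_smul] at h
  have h2 : (γ.prod γ).map (fun q => -q.1) = ((γ.prod γ).map Prod.fst).map fun z => -z := by
    rw [Measure.map_map measurable_neg measurable_fst]
    rfl
  rw [h2, Measure.map_fst_prod, measure_univ, one_smul] at h
  exact h

theorem IsRotationInvariant.integral_clm_eq_zero [IsProbabilityMeasure γ]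
    (hγ : IsRotationInvariant γ) {ℓ : Cadlag T p →L[ℝ] ℝ} (hℓ : Measurable ℓ) :
    ∫ z, ℓ z ∂γ = 0 := by
  have h : ∫ z, ℓ z ∂γ = ∫ z, ℓ z ∂(γ.map fun z => -z) := by rw [hγ.map_neg]
  rw [integral_map measurable_neg.aemeasurable hℓ.aestronglyMeasurable] at h
  have h2 : ∫ z, ℓ (-z) ∂γ = -∫ z, ℓ z ∂γ := by
    rw [← integral_neg]
    exact integral_congr_ae (Eventually.of_forall fun z => _root_.map_neg ℓ z)
  linarith

variable [IsProbabilityMeasure γ] {g : Cadlag T p → ℝ} {c : ℝ}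

theorem HasBounds.integral_ou_ou (hg : HasBounds g c) (hgm : Measurable g)
    (hγ : Integrable (fun z => ‖z‖ ^ 3) γ) (hrot : IsRotationInvariant γ) (w : Cadlag T p)
    {t s : ℝ} (ht : 0 < t) (hs : 0 ≤ s) :
    ∫ z, ∫ z', g (ouPoint (ouPoint w t z) s z') ∂γ ∂γ = ∫ z, g (ouPoint w (s + t) z) ∂γ := by
  have hm := measurable_ouPoint_ouPoint w t s
  have hm' := measurable_ouPoint_right w (s + t)
  have h1 := hg.integrable_ou hgm hγ w (by linarith : 0 ≤ s + t)
  have h2 : Integrable g (γ.map (ouPoint w (s + t))) :=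
    (integrable_map_measure hgm.aestronglyMeasurable hm'.aemeasurable).2 h1
  rw [← hrot.map_ouPoint_ouPoint w ht hs] at h2
  have h3 := (integrable_map_measure hgm.aestronglyMeasurable hm.aemeasurable).1 h2
  have h4 := integral_prod _ h3
  have h5 := integral_map hm.aemeasurable (μ := γ.prod γ) hgm.aestronglyMeasurable
  rw [hrot.map_ouPoint_ouPoint w ht hs, integral_map hm'.aemeasurable hgm.aestronglyMeasurable]
    at h5
  rw [h5]
  exact h4.symm

/-- The function `s ↦ E g(w e^{-s} + √(1 - e^{-2s}) Z) - E g(Z)` whose integral is `-f(w)`. -/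
noncomputable def ouCentred (γ : Measure (Cadlag T p)) (g : Cadlag T p → ℝ) (w : Cadlag T p)
    (s : ℝ) : ℝ := (∫ z, g (ouPoint w s z) ∂γ) - ∫ z, g z ∂γ

theorem Measurable.ouCentred {α : Type*} [MeasurableSpace α] {φ : α → Cadlag T p} {ψ : α → ℝ}
    (hgm : Measurable g) (hφ : Measurable φ) (hψ : Measurable ψ) :
    Measurable fun a => ouCentred γ g (φ a) (ψ a) := by
  have c1 : Continuous fun s : ℝ => Real.exp (-s) := by fun_prop
  have c2 : Continuous fun s : ℝ => √(1 - Real.exp (-2 * s)) := by fun_prop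
  have hm : Measurable fun q : α × Cadlag T p => ouPoint (φ q.1) (ψ q.1) q.2 :=
    (((c1.measurable.comp hψ).smul hφ).comp measurable_fst).add
      (((c2.measurable.comp hψ).comp measurable_fst).smul measurable_snd)
  have h1 : Measurable fun q : α × Cadlag T p => g (ouPoint (φ q.1) (ψ q.1) q.2) := hgm.comp hm
  exact ((h1.stronglyMeasurable.integral_prod_right').sub stronglyMeasurable_const).measurable

theorem HasBounds.abs_ouCentred_le (hg : HasBounds g c) (hgm : Measurable g)
    (hγ : Integrable (fun z => ‖z‖ ^ 3) γ) (w : Cadlag T p) {s : ℝ} (hs : 0 ≤ s) :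
    |ouCentred γ g w s|
      ≤ 64 * c * (1 + ‖w‖ ^ 3) * (Real.exp (-1 * s) * ∫ z, (1 + ‖z‖ ^ 3) ∂γ) := by
  rw [ouCentred, ← integral_sub (hg.integrable_ou hgm hγ w hs) (hg.integrable_self hgm hγ),
    ← integral_const_mul, ← integral_const_mul]
  have hK : Integrable (fun z => 1 + ‖z‖ ^ 3) γ := (integrable_const 1).add hγ
  exact norm_integral_le_of_norm_le (f := fun z => g (ouPoint w s z) - g z)
    ((hK.const_mul (Real.exp (-1 * s))).const_mul (64 * c * (1 + ‖w‖ ^ 3)))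
    (Eventually.of_forall fun z => hg.abs_ou_sub_le w z hs)

theorem HasBounds.integral_steinSolution_ouPoint (hg : HasBounds g c) (hgm : Measurable g)
    (hγ : Integrable (fun z => ‖z‖ ^ 3) γ) (hrot : IsRotationInvariant γ) (w : Cadlag T p)
    {t : ℝ} (ht : 0 < t) : ∫ z, steinSolution γ id g (ouPoint w t z) ∂γ
      = -∫ s in Ioi (0 : ℝ), ouCentred γ g w (s + t) := by
  have hc := hg.nonneg
  have hint : Integrable (fun q : Cadlag T p × ℝ => ouCentred γ g (ouPoint w t q.1) q.2)
      (γ.prod (volume.restrict (Ioi (0 : ℝ)))) := by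
    have hm : Measurable fun q : Cadlag T p × ℝ => ouCentred γ g (ouPoint w t q.1) q.2 :=
      Measurable.ouCentred hgm ((measurable_ouPoint_right w t).comp measurable_fst) measurable_snd
    have hd : Integrable (fun q : Cadlag T p × ℝ => (1 + (‖w‖ + ‖q.1‖) ^ 3) * Real.exp (-1 * q.2))
        (γ.prod (volume.restrict (Ioi (0 : ℝ)))) := by
      refine Integrable.mul_prod (f := fun z : Cadlag T p => 1 + (‖w‖ + ‖z‖) ^ 3)
        (g := fun s => Real.exp (-1 * s)) ?_ (integrableOn_exp zero_lt_one)
      refine ((integrable_const (1 + 4 * ‖w‖ ^ 3)).add (hγ.const_mul 4)).mono' ?_ ?_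
      · exact (((Cadlag.measurable_norm.const_add ‖w‖).pow_const 3).const_add 1).aestronglyMeasurable
      · refine Eventually.of_forall fun z => ?_
        rw [Real.norm_of_nonneg (by positivity)]
        have h2 := add_pow_le (norm_nonneg w) (norm_nonneg z) 3
        norm_num at h2
        simp only [Pi.add_apply]
        linarith
    refine (hd.const_mul (64 * c * ∫ z, (1 + ‖z‖ ^ 3) ∂γ)).mono' hm.aestronglyMeasurable ?_
    have hpos : ∀ᵐ q ∂γ.prod (volume.restrict (Ioi (0 : ℝ))), 0 < q.2 :=
      Measure.quasiMeasurePreserving_snd.ae (ae_restrict_mem measurableSet_Ioi)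
    filter_upwards [hpos] with q hq
    refine (hg.abs_ouCentred_le hgm hγ _ hq.le).trans ?_
    have hI : 0 ≤ ∫ z, (1 + ‖z‖ ^ 3) ∂γ := integral_nonneg fun z => by positivity
    have h1 := norm_ouPoint_le w q.1 ht.le
    calc _ ≤ 64 * c * (1 + (‖w‖ + ‖q.1‖) ^ 3) * (Real.exp (-1 * q.2) * ∫ z, (1 + ‖z‖ ^ 3) ∂γ) := by
          gcongr
      _ = _ := by ring
  have h1 : ∀ z, steinSolution γ id g (ouPoint w t z)
      = -∫ s in Ioi (0 : ℝ), ouCentred γ g (ouPoint w t z) s := fun z => rfl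
  simp_rw [h1]
  rw [integral_neg, integral_integral_swap hint]
  congr 1
  refine setIntegral_congr_fun measurableSet_Ioi fun s (hs : 0 < s) => ?_
  have h2 := hg.integral_ou_ou hgm hγ hrot w ht hs.le
  have hi : Integrable (fun z => ∫ z', g (ouPoint (ouPoint w t z) s z') ∂γ) γ := by
    have hm := measurable_ouPoint_ouPoint w t s
    have h3 := hg.integrable_ou hgm hγ w (by linarith : 0 ≤ s + t)
    have h4 : Integrable g (γ.map (ouPoint w (s + t))) :=
      (integrable_map_measure hgm.aestronglyMeasurable
        (measurable_ouPoint_right w (s + t)).aemeasurable).2 h3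
    rw [← hrot.map_ouPoint_ouPoint w ht hs.le] at h4
    exact ((integrable_map_measure hgm.aestronglyMeasurable hm.aemeasurable).1 h4).integral_prod_left
  simp only [ouCentred]
  rw [integral_sub hi (integrable_const _), h2, integral_const, probReal_univ, one_smul]

theorem HasBounds.integral_steinSolution_sub (hg : HasBounds g c) (hgm : Measurable g)
    (hγ : Integrable (fun z => ‖z‖ ^ 3) γ) (hrot : IsRotationInvariant γ) (w : Cadlag T p)
    {t : ℝ} (ht : 0 < t) :
    (∫ z, steinSolution γ id g (ouPoint w t z) ∂γ) - steinSolution γ id g w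
      = ∫ s in (0 : ℝ)..t, ouCentred γ g w s := by
  have hi : IntegrableOn (ouCentred γ g w) (Ioi 0) := hg.integrableOn_ou hgm hγ w
  rw [hg.integral_steinSolution_ouPoint hgm hγ hrot w ht]
  have h1 : ∫ s in Ioi (0 : ℝ), ouCentred γ g w (s + t) = ∫ s in Ioi t, ouCentred γ g w s := by
    have h := (measurePreserving_add_right volume t).setIntegral_preimage_emb
      (measurableEmbedding_addRight t) (ouCentred γ g w) (Ioi t)
    rwa [Set.preimage_add_const_Ioi, sub_self] at h
  have h2 : steinSolution γ id g w = -∫ s in Ioi (0 : ℝ), ouCentred γ g w s := rfl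
  have h3 := intervalIntegral.integral_interval_add_Ioi hi (hi.mono_set (Ioi_subset_Ioi ht.le))
  rw [h1, h2, ← h3]
  ring

theorem HasBounds.tendsto_integral_ouCentred (hg : HasBounds g c) (hgm : Measurable g)
    (hγ : Integrable (fun z => ‖z‖ ^ 3) γ) (w : Cadlag T p) :
    Tendsto (fun t => t⁻¹ * ∫ s in (0 : ℝ)..t, ouCentred γ g w s) (𝓝[>] 0)
      (𝓝 (g w - ∫ z, g z ∂γ)) := by
  have hc := hg.nonneg
  have hi : IntegrableOn (ouCentred γ g w) (Ioi 0) := hg.integrableOn_ou hgm hγ w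
  have hm : StronglyMeasurable (ouCentred γ g w) :=
    (Measurable.ouCentred (γ := γ) hgm (measurable_const (a := w)) measurable_id).stronglyMeasurable
  have h0 : ∀ z, ouPoint w 0 z = w := fun z => by simp [ouPoint]
  have hv : ouCentred γ g w 0 = g w - ∫ z, g z ∂γ := by
    simp only [ouCentred, h0, integral_const, probReal_univ, one_smul]
  have hcont : ContinuousWithinAt (ouCentred γ g w) (Ioi 0) 0 := by
    refine ContinuousWithinAt.sub ?_ continuousWithinAt_const
    refine tendsto_integral_filter_of_dominated_convergence
      (fun z => c * (1 + 4 * ‖w‖ ^ 3 + 4 * ‖z‖ ^ 3)) ?_ ?_ ?_ ?_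
    · exact Eventually.of_forall fun s =>
        (hgm.comp (measurable_ouPoint_right w s)).aestronglyMeasurable
    · filter_upwards [self_mem_nhdsWithin] with s hs
      refine Eventually.of_forall fun z => (hg.abs_le _).trans ?_
      have h1 : ‖ouPoint w s z‖ ^ 3 ≤ (‖w‖ + ‖z‖) ^ 3 :=
        pow_le_pow_left₀ (norm_nonneg _) (norm_ouPoint_le w z (le_of_lt hs)) 3
      have h2 := add_pow_le (norm_nonneg w) (norm_nonneg z) 3
      norm_num at h2
      refine mul_le_mul_of_nonneg_left ?_ hc
      linarith
    · exact ((integrable_const (1 + 4 * ‖w‖ ^ 3)).add (hγ.const_mul 4)).const_mul c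
    · refine Eventually.of_forall fun z => ?_
      have hcz : Continuous fun s => ouPoint w s z := by unfold ouPoint; fun_prop
      exact ((hg.differentiable.continuous.comp hcz).tendsto 0).mono_left nhdsWithin_le_nhds
  have hd := intervalIntegral.integral_hasDerivWithinAt_right (a := (0 : ℝ)) (b := 0)
    (f := ouCentred γ g w) (s := Ici 0) (t := Ioi 0) IntervalIntegrable.refl ?_ hcont
  · rw [hasDerivWithinAt_iff_tendsto_slope] at hd
    rw [← hv]
    have he : Ici (0 : ℝ) \ {0} = Ioi 0 := Ici_sdiff_left
    rw [he] at hd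
    refine hd.congr fun t => ?_
    rw [slope_def_field, intervalIntegral.integral_same, sub_zero, sub_zero, div_eq_inv_mul]
  · exact hm.stronglyMeasurableAtFilter

theorem tendsto_inv_mul_one_sub_exp (k : ℝ) :
    Tendsto (fun t => t⁻¹ * (1 - Real.exp (-k * t))) (𝓝[>] 0) (𝓝 k) := by
  have h1 : HasDerivAt (fun t => 1 - Real.exp (-k * t)) k 0 := by
    have h := (((hasDerivAt_id (0 : ℝ)).const_mul (-k)).exp).const_sub 1
    refine h.congr_deriv ?_
    simp
  have h2 := (hasDerivAt_iff_tendsto_slope_zero.1 h1).mono_left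
    (nhdsWithin_mono (0 : ℝ) fun t (ht : 0 < t) => ht.ne')
  refine h2.congr fun t => ?_
  simp

/-- The Stein equation `g(w) - E g(Z) = -Df(w)[w] + E D²f(w)[Z,Z]`. Both sides are the right
derivative at `t = 0` of `t ↦ E f(w e^{-t} + √(1 - e^{-2t}) Z)`: on the left by the semigroup
property, on the right by Taylor expansion of `f`. -/
theorem HasBounds.stein_equation (hT : 0 ≤ T) (hg : HasBounds g c) (hgm : Measurable g)
    (hγ : Integrable (fun z => ‖z‖ ^ 3) γ) (hrot : IsRotationInvariant γ) (w : Cadlag T p) :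
    g w - ∫ z, g z ∂γ = -fderiv ℝ (steinSolution γ id g) w w
      + ∫ z, D2 (steinSolution γ id g) w z z ∂γ := by
  obtain ⟨⟨c', hf⟩, -⟩ := hg.steinSolution_hasBounds hgm hγ
  have hc := hf.nonneg
  have hfm : Measurable (steinSolution γ id g) := measurable_steinSolution hgm
  set f := steinSolution γ id g with hfd
  set A := fderiv ℝ f w with hA
  set B := D2 f w with hB
  have hAm : Measurable A := Cadlag.measurable_clm hT A
  have hBm : Measurable (B w) := Cadlag.measurable_clm hT (B w)
  have hBBm : Measurable fun z => B z z := by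
    have hp : Measurable fun z : Cadlag T p => (w, z, z) :=
      measurable_const.prodMk (measurable_id.prodMk measurable_id)
    exact (measurable_D2_apply hfm hf.differentiable hf.differentiable_fderiv).comp hp
  have hW : Integrable (fun z : Cadlag T p => 1 + ‖z‖ ^ 3) γ := (integrable_const 1).add hγ
  have hle : ∀ x : ℝ, 0 ≤ x → x ≤ 1 + x ^ 3 ∧ x ^ 2 ≤ 1 + x ^ 3 := fun x hx => by
    have h3 : 0 ≤ x ^ 3 := by positivity
    rcases le_total x 1 with h | h
    · exact ⟨by linarith, by nlinarith⟩
    · exact ⟨by nlinarith [mul_nonneg hx (sub_nonneg.2 h),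
        mul_nonneg (sq_nonneg x) (sub_nonneg.2 h)],
        by nlinarith [mul_nonneg (sq_nonneg x) (sub_nonneg.2 h)]⟩
  have hiA : ∀ ℓ : Cadlag T p →L[ℝ] ℝ, Measurable ℓ → Integrable (fun z => ℓ z) γ := fun ℓ hℓ => by
    refine (hW.const_mul ‖ℓ‖).mono' hℓ.aestronglyMeasurable (Eventually.of_forall fun z => ?_)
    exact (ℓ.le_opNorm z).trans
      (mul_le_mul_of_nonneg_left (hle _ (norm_nonneg z)).1 (norm_nonneg ℓ))
  have hiB : Integrable (fun z => B z z) γ := by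
    refine (hW.const_mul ‖B‖).mono' hBBm.aestronglyMeasurable (Eventually.of_forall fun z => ?_)
    refine (B.le_opNorm₂ z z).trans ?_
    rw [mul_assoc, ← sq]
    exact mul_le_mul_of_nonneg_left (hle _ (norm_nonneg z)).2 (norm_nonneg B)
  have hK : Integrable (fun z : Cadlag T p => (‖w‖ + ‖z‖) ^ 3) γ := by
    refine ((integrable_const (4 * ‖w‖ ^ 3)).add (hγ.const_mul 4)).mono'
      ((Cadlag.measurable_norm.const_add ‖w‖).pow_const 3).aestronglyMeasurable
      (Eventually.of_forall fun z => ?_)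
    rw [Real.norm_of_nonneg (by positivity)]
    have h2 := add_pow_le (norm_nonneg w) (norm_nonneg z) 3
    norm_num at h2
    simp only [Pi.add_apply]
    linarith
  set I := ∫ z, B z z ∂γ with hI
  set K := ∫ z, (‖w‖ + ‖z‖) ^ 3 ∂γ with hKd
  have hTaylor : ∀ t, 0 < t → |((∫ z, f (ouPoint w t z) ∂γ) - f w)
      - (-(1 - Real.exp (-1 * t)) * A w + (1 - Real.exp (-1 * t)) ^ 2 / 2 * B w w
        + (1 - Real.exp (-2 * t)) / 2 * I)|
      ≤ c' / 3 * K * ((1 - Real.exp (-2 * t)) * √(1 - Real.exp (-2 * t))) := fun t ht => by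
    obtain ⟨h1, h2, h3, h4⟩ := ou_coeff ht.le
    obtain ⟨β, hβ⟩ : ∃ β, β = √(1 - Real.exp (-2 * t)) := ⟨_, rfl⟩
    obtain ⟨α, hα⟩ : ∃ α, α = 1 - Real.exp (-t) := ⟨_, rfl⟩
    have hβ2 : 1 - Real.exp (-2 * t) = β ^ 2 := by
      rw [hβ, Real.sq_sqrt]
      exact sub_nonneg.2 (Real.exp_le_one_iff.2 (by linarith))
    rw [← hβ] at h1 h2 h3
    have hαβ : α ≤ β := by rw [hα]; linarith
    have hα0 : 0 ≤ α := by rw [hα]; linarith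
    have hou : ∀ z, ouPoint w t z = w + (-(α • w) + β • z) := fun z => by
      rw [ouPoint, ← hβ, hα, sub_smul, one_smul]; abel
    have hAe : ∀ z, A (-(α • w) + β • z) = -α * A w + β * A z := fun z => by
      rw [map_add, map_neg, map_smul, map_smul, smul_eq_mul, smul_eq_mul]; ring
    have hBe : ∀ z, B (-(α • w) + β • z) (-(α • w) + β • z)
        = α ^ 2 * B w w - 2 * α * β * B w z + β ^ 2 * B z z := fun z => by
      have hs : B z w = B w z := D2_symm hf.differentiable hf.differentiable_fderiv w z w
      simp only [map_add, map_neg, map_smul, add_apply, neg_apply, smul_apply, smul_eq_mul, hs]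
      ring
    have hi1 : Integrable (fun z => f (ouPoint w t z)) γ := hf.integrable_ou hfm hγ w ht.le
    have hi2 : Integrable (fun z => -α * A w + β * A z) γ :=
      (integrable_const _).add ((hiA A hAm).const_mul β)
    have hi3' : Integrable (fun z => α ^ 2 * B w w - 2 * α * β * B w z) γ :=
      (integrable_const _).sub ((hiA (B w) hBm).const_mul (2 * α * β))
    have hi3 : Integrable (fun z => (α ^ 2 * B w w - 2 * α * β * B w z + β ^ 2 * B z z) / 2) γ :=
      (hi3'.add (hiB.const_mul (β ^ 2))).div_const 2
    have e1 : ∫ z, (-α * A w + β * A z) ∂γ = -α * A w := by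
      rw [integral_add (integrable_const _) ((hiA A hAm).const_mul β), integral_const,
        integral_const_mul, hrot.integral_clm_eq_zero hAm, probReal_univ, one_smul, mul_zero,
        add_zero]
    have e2 : ∫ z, (α ^ 2 * B w w - 2 * α * β * B w z + β ^ 2 * B z z) / 2 ∂γ
        = (α ^ 2 * B w w + β ^ 2 * I) / 2 := by
      rw [integral_div, integral_add hi3' (hiB.const_mul (β ^ 2)),
        integral_sub (integrable_const _) ((hiA (B w) hBm).const_mul (2 * α * β)), integral_const,
        integral_const_mul, integral_const_mul, hrot.integral_clm_eq_zero hBm, probReal_univ,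
        one_smul, mul_zero, sub_zero]
    have e3 : ((∫ z, f (ouPoint w t z) ∂γ) - f w)
        - (-(1 - Real.exp (-1 * t)) * A w + (1 - Real.exp (-1 * t)) ^ 2 / 2 * B w w
          + (1 - Real.exp (-2 * t)) / 2 * I)
        = ∫ z, (f (ouPoint w t z) - f w - (-α * A w + β * A z)
          - (α ^ 2 * B w w - 2 * α * β * B w z + β ^ 2 * B z z) / 2) ∂γ := by
      have hi4 : Integrable (fun z => f (ouPoint w t z) - f w) γ := hi1.sub (integrable_const _)
      have hi5 : Integrable (fun z => f (ouPoint w t z) - f w - (-α * A w + β * A z)) γ :=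
        hi4.sub hi2
      rw [integral_sub hi5 hi3, integral_sub hi4 hi2, integral_sub hi1 (integrable_const _),
        integral_const, probReal_univ, one_smul, e1, e2, neg_one_mul, ← hα, hβ2]
      ring
    rw [e3]
    refine (norm_integral_le_of_norm_le
      (f := fun z => f (ouPoint w t z) - f w - (-α * A w + β * A z)
          - (α ^ 2 * B w w - 2 * α * β * B w z + β ^ 2 * B z z) / 2)
      (hK.const_mul (c' / 3 * β ^ 3)) (Eventually.of_forall fun z => ?_)).trans_eq ?_
    · have h5 := hf.abs_sub_sub_sub_le w (-(α • w) + β • z)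
      rw [← hA, ← hB, hAe, hBe, ← hou] at h5
      refine h5.trans ?_
      have h6 : ‖-(α • w) + β • z‖ ≤ β * (‖w‖ + ‖z‖) := by
        refine (norm_add_le _ _).trans ?_
        rw [norm_neg, norm_smul, norm_smul, Real.norm_of_nonneg hα0, Real.norm_of_nonneg h1, mul_add]
        gcongr
      calc c' / 3 * ‖-(α • w) + β • z‖ ^ 3 ≤ c' / 3 * (β * (‖w‖ + ‖z‖)) ^ 3 := by gcongr
        _ = _ := by ring
    · rw [integral_const_mul, ← hKd, hβ2, Real.sqrt_sq h1]
      ring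
  have l1 := tendsto_inv_mul_one_sub_exp 1
  have l2 := tendsto_inv_mul_one_sub_exp 2
  have l3 : Tendsto (fun t => 1 - Real.exp (-1 * t)) (𝓝[>] 0) (𝓝 0) := by
    have : Continuous fun t => 1 - Real.exp (-1 * t) := by fun_prop
    have h := (this.tendsto 0).mono_left (nhdsWithin_le_nhds (s := Ioi (0 : ℝ)))
    simpa using h
  have l4 : Tendsto (fun t => √(1 - Real.exp (-2 * t))) (𝓝[>] 0) (𝓝 0) := by
    have : Continuous fun t => √(1 - Real.exp (-2 * t)) := by fun_prop
    have h := (this.tendsto 0).mono_left (nhdsWithin_le_nhds (s := Ioi (0 : ℝ)))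
    simpa using h
  have lmain : Tendsto (fun t => t⁻¹ * (-(1 - Real.exp (-1 * t)) * A w
      + (1 - Real.exp (-1 * t)) ^ 2 / 2 * B w w + (1 - Real.exp (-2 * t)) / 2 * I))
      (𝓝[>] 0) (𝓝 (-A w + I)) := by
    have h := ((l1.mul_const (-A w)).add ((l1.mul l3).mul_const (B w w / 2))).add
      (l2.mul_const (I / 2))
    have e : 1 * -A w + 1 * 0 * (B w w / 2) + 2 * (I / 2) = -A w + I := by ring
    rw [e] at h
    refine h.congr fun t => ?_
    ring
  have lerr : Tendsto (fun t => t⁻¹ * ((∫ z, f (ouPoint w t z) ∂γ) - f w)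
      - t⁻¹ * (-(1 - Real.exp (-1 * t)) * A w
      + (1 - Real.exp (-1 * t)) ^ 2 / 2 * B w w + (1 - Real.exp (-2 * t)) / 2 * I))
      (𝓝[>] 0) (𝓝 0) := by
    have h := (l2.mul l4).const_mul (c' / 3 * K)
    rw [mul_zero, mul_zero] at h
    refine squeeze_zero_norm' ?_ h
    filter_upwards [self_mem_nhdsWithin] with t (ht : 0 < t)
    rw [← mul_sub, norm_mul, norm_inv, Real.norm_of_nonneg ht.le]
    calc _ ≤ t⁻¹ * (c' / 3 * K * ((1 - Real.exp (-2 * t)) * √(1 - Real.exp (-2 * t)))) :=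
          mul_le_mul_of_nonneg_left (hTaylor t ht) (by positivity)
      _ = _ := by ring
  have l5 := lerr.add lmain
  simp only [sub_add_cancel, zero_add] at l5
  refine tendsto_nhds_unique (hg.tendsto_integral_ouCentred hgm hγ w) (l5.congr' ?_)
  filter_upwards [self_mem_nhdsWithin] with t ht
  rw [hg.integral_steinSolution_sub hgm hγ hrot w ht]

end SteinEquation


/-! ### The covariance identity for bilinear forms -/

theorem bilin_sum_smul {E ι : Type*} [NormedAddCommGroup E] [NormedSpace ℝ E] [Fintype ι]
    (B : E →L[ℝ] E →L[ℝ] ℝ) (v w : ι → ℝ) (e e' : ι → E) :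
    B (∑ i, v i • e i) (∑ j, w j • e' j) = ∑ i, ∑ j, B (e i) (e' j) * (v i * w j) := by
  rw [map_sum B, sum_apply]
  refine Finset.sum_congr rfl fun i _ => ?_
  rw [map_sum]
  refine Finset.sum_congr rfl fun j _ => ?_
  rw [map_smul, map_smul, smul_apply, smul_eq_mul, smul_eq_mul]
  ring

section FiniteDimensional

variable {ι : Type*} [Fintype ι]

/-- `μ` is the centred Gaussian law with covariance matrix `S`. -/
structure IsCentredGaussian (μ : Measure (EuclideanSpace ℝ ι)) (S : Matrix ι ι ℝ) : Prop where
  isGaussian : IsGaussian μ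
  mean : ∀ i, ∫ x, x i ∂μ = 0
  cov : ∀ i j, ∫ x, x i * x j ∂μ = S i j

namespace IsCentredGaussian

variable {μ ν : Measure (EuclideanSpace ℝ ι)} {S S' : Matrix ι ι ℝ}

theorem memLp (hμ : IsCentredGaussian μ S) (i : ι) : MemLp (fun x => x i) 2 μ := by
  have := hμ.isGaussian
  exact (IsGaussian.memLp_two_id (μ := μ)).continuousLinearMap_comp (EuclideanSpace.proj (𝕜 := ℝ) i)

theorem integral_id (hμ : IsCentredGaussian μ S) : μ[id] = 0 := by
  have := hμ.isGaussian
  ext i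
  refine (eval_integral_piLp (fun i => (hμ.memLp i).integrable one_le_two) i).trans ?_
  exact hμ.mean i

theorem integrable_mul (hμ : IsCentredGaussian μ S) (i j : ι) :
    Integrable (fun x => x i * x j) μ := (hμ.memLp i).integrable_mul (hμ.memLp j)

theorem unique (hμ : IsCentredGaussian μ S) (hν : IsCentredGaussian ν S) : μ = ν := by
  have h1 := hμ.isGaussian
  have h2 := hν.isGaussian
  have key : ∀ {ρ : Measure (EuclideanSpace ℝ ι)}, IsCentredGaussian ρ S → ∀ x y,
      covarianceBilin ρ x y = ∑ i, ∑ j, x i * y j * S i j := by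
    intro ρ hρ x y
    have := hρ.isGaussian
    rw [covarianceBilin_apply IsGaussian.memLp_two_id, hρ.integral_id]
    have e : ∀ z : EuclideanSpace ℝ ι, inner ℝ x (z - 0) * inner ℝ y (z - 0)
        = ∑ i, ∑ j, x i * y j * (z i * z j) := fun z => by
      simp only [sub_zero, PiLp.inner_apply, Finset.sum_mul_sum]
      refine Finset.sum_congr rfl fun i _ => Finset.sum_congr rfl fun j _ => ?_
      simp only [RCLike.inner_apply, conj_trivial]
      ring
    simp_rw [e]
    rw [integral_finsetSum _ fun i _ => integrable_finsetSum _ fun j _ =>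
      (hρ.integrable_mul i j).const_mul _]
    refine Finset.sum_congr rfl fun i _ => ?_
    rw [integral_finsetSum _ fun j _ => (hρ.integrable_mul i j).const_mul _]
    refine Finset.sum_congr rfl fun j _ => ?_
    rw [integral_const_mul, hρ.cov]
  refine IsGaussian.ext (hμ.integral_id.trans hν.integral_id.symm) ?_
  ext x y
  rw [key hμ, key hν]

theorem exists_of_posSemidef (hS : S.PosSemidef) : ∃ μ, IsCentredGaussian μ S := by
  classical
  have hmean : ∀ i, ∫ x, x i ∂(multivariateGaussian 0 S) = 0 := fun i => by
    refine (eval_integral_piLp (f := id) (fun i => ?_) i).symm.trans ?_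
    · exact ((IsGaussian.memLp_two_id (μ := multivariateGaussian 0 S)).continuousLinearMap_comp
        (EuclideanSpace.proj (𝕜 := ℝ) i)).integrable one_le_two
    · rw [integral_id_multivariateGaussian']
      rfl
  refine ⟨multivariateGaussian 0 S, inferInstance, hmean, fun i j => ?_⟩
  have h := covariance_eval_multivariateGaussian (μ := 0) hS i j
  rw [covariance, hmean, hmean] at h
  simpa using h

/-- Cross moments of independent centred Gaussian vectors. -/
theorem integral_add_smul_mul (hμ : IsCentredGaussian μ S) (hν : IsCentredGaussian ν S')
    (a b : ℝ) (i j : ι) :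
    ∫ q, (q.1 i + a * q.2 i) * (q.1 j + b * q.2 j) ∂(μ.prod ν) = S i j + a * b * S' i j := by
  have h1 := hμ.isGaussian
  have h2 := hν.isGaussian
  have e : ∀ q : EuclideanSpace ℝ ι × EuclideanSpace ℝ ι,
      (q.1 i + a * q.2 i) * (q.1 j + b * q.2 j)
        = (q.1 i * q.1 j * 1 + a * b * (1 * (q.2 i * q.2 j)))
          + (b * (q.1 i * q.2 j) + a * (q.1 j * q.2 i)) := fun q => by ring
  have i1 : ∀ i, Integrable (fun x : EuclideanSpace ℝ ι => x i) μ := fun i =>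
    (hμ.memLp i).integrable one_le_two
  have i2 : ∀ i, Integrable (fun x : EuclideanSpace ℝ ι => x i) ν := fun i =>
    (hν.memLp i).integrable one_le_two
  have j1 : Integrable (fun q : EuclideanSpace ℝ ι × EuclideanSpace ℝ ι => q.1 i * q.1 j * 1)
      (μ.prod ν) := (hμ.integrable_mul i j).mul_prod (integrable_const 1)
  have j2 : Integrable (fun q : EuclideanSpace ℝ ι × EuclideanSpace ℝ ι => 1 * (q.2 i * q.2 j))
      (μ.prod ν) := (integrable_const (1 : ℝ)).mul_prod (hν.integrable_mul i j)
  have j3 : ∀ i j, Integrable (fun q : EuclideanSpace ℝ ι × EuclideanSpace ℝ ι => q.1 i * q.2 j)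
      (μ.prod ν) := fun i j => (i1 i).mul_prod (i2 j)
  have hz : ∀ i j, ∫ q, q.1 i * q.2 j ∂(μ.prod ν) = 0 := fun i j =>
    (integral_prod_mul (fun x : EuclideanSpace ℝ ι => x i)
      (fun x : EuclideanSpace ℝ ι => x j)).trans (by simp [hμ.mean])
  simp_rw [e]
  have j4 : Integrable (fun q : EuclideanSpace ℝ ι × EuclideanSpace ℝ ι =>
      q.1 i * q.1 j * 1 + a * b * (1 * (q.2 i * q.2 j))) (μ.prod ν) := j1.add (j2.const_mul (a * b))
  have j5 : Integrable (fun q : EuclideanSpace ℝ ι × EuclideanSpace ℝ ι =>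
      b * (q.1 i * q.2 j) + a * (q.1 j * q.2 i)) (μ.prod ν) :=
    ((j3 i j).const_mul b).add ((j3 j i).const_mul a)
  rw [integral_add j4 j5, integral_add j1 (j2.const_mul (a * b)),
    integral_add ((j3 i j).const_mul b) ((j3 j i).const_mul a), integral_const_mul (a * b),
    integral_const_mul b, integral_const_mul a,
    integral_prod_mul (fun x : EuclideanSpace ℝ ι => x i * x j) (fun _ => (1 : ℝ)),
    show ∫ q, 1 * (q.2 i * q.2 j) ∂(μ.prod ν) = S' i j from
      (integral_prod_mul (fun _ : EuclideanSpace ℝ ι => (1 : ℝ))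
        (fun x : EuclideanSpace ℝ ι => x i * x j)).trans (by simp [hν.cov]),
    hz i j, hz j i, hμ.cov]
  simp

theorem add_smul_prod (hμ : IsCentredGaussian μ S) (hν : IsCentredGaussian ν S') {a : ℝ}
    (ha : a * a = 1) :
    IsCentredGaussian ((μ.prod ν).map fun q => q.1 + a • q.2) (S + S') := by
  have h1 := hμ.isGaussian
  have h2 := hν.isGaussian
  let L : EuclideanSpace ℝ ι × EuclideanSpace ℝ ι →L[ℝ] EuclideanSpace ℝ ι :=
    ContinuousLinearMap.fst ℝ _ _ + a • ContinuousLinearMap.snd ℝ _ _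
  have hL : ⇑L = fun q => q.1 + a • q.2 := rfl
  have hm : Measurable fun q : EuclideanSpace ℝ ι × EuclideanSpace ℝ ι => q.1 + a • q.2 :=
    measurable_fst.add (measurable_snd.const_smul a)
  refine ⟨?_, fun i => ?_, fun i j => ?_⟩
  · rw [← hL]
    infer_instance
  · rw [integral_map hm.aemeasurable (by fun_prop)]
    have i1 := (hμ.memLp i).integrable one_le_two
    have i2 := (hν.memLp i).integrable one_le_two
    have j1 : Integrable (fun q : EuclideanSpace ℝ ι × EuclideanSpace ℝ ι => q.1 i) (μ.prod ν) :=
      i1.comp_fst ν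
    have j2 : Integrable (fun q : EuclideanSpace ℝ ι × EuclideanSpace ℝ ι => q.2 i) (μ.prod ν) :=
      i2.comp_snd μ
    have e : ∫ q, (q.1 + a • q.2) i ∂(μ.prod ν) = ∫ q, (q.1 i + a * q.2 i) ∂(μ.prod ν) := rfl
    rw [e, integral_add j1 (j2.const_mul a), integral_const_mul, integral_prod _ j1,
      integral_prod _ j2]
    simp [hμ.mean, hν.mean]
  · rw [integral_map hm.aemeasurable (by fun_prop)]
    refine (hμ.integral_add_smul_mul hν a a i j).trans ?_
    rw [ha, one_mul]
    rfl

/-- Bound in `L¹` for a bilinear expression in square integrable functions, by the moments of a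
Gaussian vector with the same covariances. Gaussian vectors with the covariances over the sets where
the expression `b(X,X)` is positive and negative, say `y₊` and `y₋`, give
`∫ |b(X,X)| = E b(y₊ + y₋, y₊ - y₋)`, and both `y₊ + y₋` and `y₊ - y₋` have the law `μ`. -/
theorem integral_abs_le {α : Type*} [MeasurableSpace α] {Λ : Measure α} {X : ι → α → ℝ}
    (hXm : ∀ i, Measurable (X i)) (hX : ∀ i, MemLp (X i) 2 Λ)
    (hμ : IsCentredGaussian μ S) (hS : ∀ i j, S i j = ∫ u, X i u * X j u ∂Λ)
    (β : ι → ι → ℝ) {N₁ N₂ : EuclideanSpace ℝ ι → ℝ} (hN₁ : Integrable N₁ μ)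
    (hN₂ : Integrable N₂ μ) (hβ : ∀ x y : EuclideanSpace ℝ ι,
      |∑ i, ∑ j, β i j * (x i * y j)| ≤ N₁ x + N₂ y) :
    Integrable (fun u => ∑ i, ∑ j, β i j * (X i u * X j u)) Λ ∧
      ∫ u, |∑ i, ∑ j, β i j * (X i u * X j u)| ∂Λ ≤ ∫ x, N₁ x ∂μ + ∫ x, N₂ x ∂μ := by
  have hint : ∀ i j, Integrable (fun u => X i u * X j u) Λ := fun i j =>
    (hX i).integrable_mul (hX j)
  have hhi : Integrable (fun u => ∑ i, ∑ j, β i j * (X i u * X j u)) Λ :=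
    integrable_finsetSum _ fun i _ => integrable_finsetSum _ fun j _ => (hint i j).const_mul _
  refine ⟨hhi, ?_⟩
  set h : α → ℝ := fun u => ∑ i, ∑ j, β i j * (X i u * X j u) with hh
  have hhm : Measurable h := Finset.measurable_sum _ fun i _ => Finset.measurable_sum _ fun j _ =>
    ((hXm i).mul (hXm j)).const_mul _
  have hA : MeasurableSet {u | 0 ≤ h u} := measurableSet_le measurable_const hhm
  have hex : ∀ A : Set α, ∃ ρ, IsCentredGaussian ρ
      (Matrix.of fun i j => ∫ u in A, X i u * X j u ∂Λ) := fun A => by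
    refine exists_of_posSemidef (.of_dotProduct_mulVec_nonneg ?_ fun x => ?_)
    · ext i j
      simp [mul_comm]
    · have e : star x ⬝ᵥ (Matrix.of fun i j => ∫ u in A, X i u * X j u ∂Λ).mulVec x
          = ∫ u in A, (∑ i, x i * X i u) ^ 2 ∂Λ := by
        have e1 : ∀ u, (∑ i, x i * X i u) ^ 2 = ∑ i, ∑ j, x i * x j * (X i u * X j u) := fun u => by
          rw [sq, Finset.sum_mul_sum]
          exact Finset.sum_congr rfl fun i _ => Finset.sum_congr rfl fun j _ => by ring
        simp_rw [e1]
        rw [integral_finsetSum _ fun i _ => integrable_finsetSum _ fun j _ =>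
          ((hint i j).integrableOn.integrable).const_mul _]
        simp only [dotProduct, Matrix.mulVec, Matrix.of_apply, star_trivial, Finset.mul_sum]
        refine Finset.sum_congr rfl fun i _ => ?_
        rw [integral_finsetSum _ fun j _ => ((hint i j).integrableOn.integrable).const_mul _]
        refine Finset.sum_congr rfl fun j _ => ?_
        rw [integral_const_mul]
        ring
      rw [e]
      exact integral_nonneg fun u => sq_nonneg _
  obtain ⟨ρ, hρ⟩ := hex {u | 0 ≤ h u}
  obtain ⟨ρ', hρ'⟩ := hex {u | 0 ≤ h u}ᶜ
  have g1 := hρ.isGaussian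
  have g2 := hρ'.isGaussian
  have hsum : (Matrix.of fun i j => ∫ u in {u | 0 ≤ h u}, X i u * X j u ∂Λ)
      + (Matrix.of fun i j => ∫ u in {u | 0 ≤ h u}ᶜ, X i u * X j u ∂Λ) = S := by
    ext i j
    rw [Matrix.add_apply, Matrix.of_apply, Matrix.of_apply, integral_add_compl hA (hint i j), hS]
  have hmap : ∀ a : ℝ, a * a = 1 → (ρ.prod ρ').map (fun q => q.1 + a • q.2) = μ := fun a ha => by
    have := hρ.add_smul_prod hρ' ha
    rw [hsum] at this
    exact this.unique hμ
  have hmeas : ∀ a : ℝ, Measurable fun q : EuclideanSpace ℝ ι × EuclideanSpace ℝ ι =>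
      q.1 + a • q.2 := fun a => measurable_fst.add (measurable_snd.const_smul a)
  have hN : ∀ (a : ℝ), a * a = 1 → ∀ {F : EuclideanSpace ℝ ι → ℝ}, Integrable F μ →
      Integrable (fun q : EuclideanSpace ℝ ι × EuclideanSpace ℝ ι => F (q.1 + a • q.2)) (ρ.prod ρ') ∧
      ∫ q, F (q.1 + a • q.2) ∂(ρ.prod ρ') = ∫ x, F x ∂μ := fun a ha F hF => by
    rw [← hmap a ha] at hF ⊢
    exact ⟨(integrable_map_measure hF.aestronglyMeasurable (hmeas a).aemeasurable).1 hF,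
      (integral_map (hmeas a).aemeasurable hF.aestronglyMeasurable).symm⟩
  obtain ⟨k1, k2⟩ := hN 1 (by norm_num) hN₁
  obtain ⟨k3, k4⟩ := hN (-1) (by norm_num) hN₂
  -- the integral of `|h|` as a Gaussian expectation
  have hfin : ∀ A : Set α, ∫ u in A, h u ∂Λ
      = ∑ i, ∑ j, β i j * ∫ u in A, X i u * X j u ∂Λ := fun A => by
    rw [hh, integral_finsetSum _ fun i _ => integrable_finsetSum _ fun j _ =>
      ((hint i j).integrableOn.integrable).const_mul _]
    refine Finset.sum_congr rfl fun i _ => ?_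
    rw [integral_finsetSum _ fun j _ => ((hint i j).integrableOn.integrable).const_mul _]
    exact Finset.sum_congr rfl fun j _ => integral_const_mul _ _
  have habs : ∫ u, |h u| ∂Λ = ∫ u in {u | 0 ≤ h u}, h u ∂Λ - ∫ u in {u | 0 ≤ h u}ᶜ, h u ∂Λ := by
    rw [← integral_add_compl hA hhi.abs, sub_eq_add_neg, ← integral_neg]
    congr 1
    · exact setIntegral_congr_fun hA fun u hu => abs_of_nonneg hu
    · exact setIntegral_congr_fun hA.compl fun u hu => abs_of_neg (not_le.1 hu)
  have hprod : ∀ i j, Integrable (fun q : EuclideanSpace ℝ ι × EuclideanSpace ℝ ι =>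
      (q.1 i + 1 * q.2 i) * (q.1 j + -1 * q.2 j)) (ρ.prod ρ') := fun i j => by
    have m1 : ∀ i, MemLp (fun q : EuclideanSpace ℝ ι × EuclideanSpace ℝ ι => q.1 i) 2 (ρ.prod ρ') :=
      fun i => (hρ.memLp i).comp_fst ρ'
    have m2 : ∀ i, MemLp (fun q : EuclideanSpace ℝ ι × EuclideanSpace ℝ ι => q.2 i) 2 (ρ.prod ρ') :=
      fun i => (hρ'.memLp i).comp_snd ρ
    exact ((m1 i).add ((m2 i).const_mul 1)).integrable_mul ((m1 j).add ((m2 j).const_mul (-1)))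
  have hG : ∫ u, |h u| ∂Λ = ∫ q, ∑ i, ∑ j, β i j * ((q.1 i + 1 * q.2 i) * (q.1 j + -1 * q.2 j))
      ∂(ρ.prod ρ') := by
    rw [habs, hfin, hfin, integral_finsetSum _ fun i _ => integrable_finsetSum _ fun j _ =>
      (hprod i j).const_mul _, ← Finset.sum_sub_distrib]
    refine Finset.sum_congr rfl fun i _ => ?_
    rw [integral_finsetSum _ fun j _ => (hprod i j).const_mul _, ← Finset.sum_sub_distrib]
    refine Finset.sum_congr rfl fun j _ => ?_
    rw [integral_const_mul, hρ.integral_add_smul_mul hρ' 1 (-1) i j, Matrix.of_apply,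
      Matrix.of_apply]
    ring
  rw [hG, ← k2, ← k4, ← integral_add k1 k3]
  refine integral_mono (integrable_finsetSum _ fun i _ => integrable_finsetSum _ fun j _ =>
    (hprod i j).const_mul _) (k1.add k3) fun q => ?_
  exact (le_abs_self _).trans (hβ (q.1 + (1 : ℝ) • q.2) (q.1 + (-1 : ℝ) • q.2))

end IsCentredGaussian

end FiniteDimensional

section CovarianceIdentity

open Cadlag

variable {T : ℝ} {p d : ℕ} {γ : Measure (Cadlag T p)} {J : Euc d → Cadlag T p}
  {Lam : Measure (Euc d)}

namespace Cadlag

theorem discretize_discretize {τ σ : Finset (Icc (0 : ℝ) T)} (hστ : σ ⊆ τ)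
    (hσ : ∃ r ∈ σ, ∀ s, r ≤ s) (x : Cadlag T p) :
    discretize σ (discretize τ x) = discretize σ x := by
  obtain ⟨r, hr, hrs⟩ := hσ
  refine ext fun s => ?_
  rw [discretize_apply, discretize_apply, discretize_apply]
  have h1 := lastTime_mem hr (hrs s)
  have h2 := lastTime_mem (hστ h1.1) le_rfl
  rw [le_antisymm h2.2.2 h2.2.1]

/-- The values of the coordinates of a path at the times in a finite set, as a Euclidean vector. -/
noncomputable def coordsOn (I : Finset (Icc (0 : ℝ) T)) (x : Cadlag T p) :
    EuclideanSpace ℝ (I × Fin p) := WithLp.toLp 2 fun i => x.path i.1 i.2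

/-- The step function with given coordinates at the times in a finite set. -/
noncomputable def ofCoords (I : Finset (Icc (0 : ℝ) T)) :
    EuclideanSpace ℝ (I × Fin p) →ₗ[ℝ] Cadlag T p where
  toFun v := ∑ i, v i • cell I i.1 i.2
  map_add' v w := by
    rw [← Finset.sum_add_distrib]
    exact Finset.sum_congr rfl fun i _ => add_smul _ _ _
  map_smul' c v := by
    rw [RingHom.id_apply, Finset.smul_sum]
    exact Finset.sum_congr rfl fun i _ => mul_smul _ _ _

theorem ofCoords_apply (I : Finset (Icc (0 : ℝ) T)) (v : EuclideanSpace ℝ (I × Fin p)) :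
    ofCoords I v = ∑ i, v i • cell I i.1 i.2 := rfl

theorem IsTimeGrid.ofCoords_coordsOn {τ : ℕ → Finset (Icc (0 : ℝ) T)} (hτ : IsTimeGrid τ) (n : ℕ)
    (x : Cadlag T p) : ofCoords (τ n) (coordsOn (τ n) x) = discretize (τ n) x := by
  rw [hτ.discretize_eq, ofCoords_apply, Fintype.sum_prod_type,
    ← Finset.sum_coe_sort (τ n) fun r => ∑ a, x.path r a • cell (τ n) r a]
  rfl

theorem measurable_coordsOn (I : Finset (Icc (0 : ℝ) T)) :
    Measurable (coordsOn I : Cadlag T p → EuclideanSpace ℝ (I × Fin p)) :=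
  (WithLp.measurable_toLp 2 _).comp (measurable_pi_lambda _ fun i => measurable_coord i.1.1 i.2)

end Cadlag

namespace IsGaussianPathLaw

theorem isCentredGaussian (hγ : IsGaussianPathLaw γ J Lam) (I : Finset (Icc (0 : ℝ) T)) :
    IsCentredGaussian (γ.map (coordsOn I))
      (Matrix.of fun i j => ∫ u, (J u).path i.1 i.2 * (J u).path j.1 j.2 ∂Lam) := by
  have hG := hγ.isGaussian I
  let L : (I → Euc p) →L[ℝ] EuclideanSpace ℝ (I × Fin p) :=
    (PiLp.continuousLinearEquiv 2 ℝ fun _ : I × Fin p => ℝ).symm.toContinuousLinearMap.comp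
      (ContinuousLinearMap.pi fun i : I × Fin p =>
        (EuclideanSpace.proj (𝕜 := ℝ) i.2).comp (ContinuousLinearMap.proj i.1))
  have hL : γ.map (coordsOn I) = (γ.map (evalOn I)).map L := by
    rw [Measure.map_map L.continuous.measurable (measurable_evalOn I)]
    rfl
  have hgauss : IsGaussian (γ.map (coordsOn (p := p) I)) := by
    rw [hL]
    infer_instance
  have hm := (measurable_coordsOn (T := T) (p := p) I).aemeasurable (μ := γ)
  refine ⟨hgauss, fun i => ?_, fun i j => ?_⟩
  · rw [integral_map hm (by fun_prop)]
    have hi : Integrable (fun z : Cadlag T p => z.path i.1.1) γ := by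
      have h1 : Integrable id (γ.map (evalOn I)) := IsGaussian.integrable_id
      have h2 := (integrable_map_measure h1.aestronglyMeasurable
        (measurable_evalOn (T := T) (p := p) I).aemeasurable).1 h1
      exact h2.eval i.1
    have h3 := (EuclideanSpace.proj (𝕜 := ℝ) i.2).integral_comp_comm hi
    rw [hγ.centred, map_zero] at h3
    exact h3
  · rw [integral_map hm (by fun_prop)]
    exact hγ.cov _ _ _ _

theorem memLp_coord (hJ2 : ∀ s, MemLp (fun u => (J u).path s) 2 Lam) (s : Icc (0 : ℝ) T)
    (a : Fin p) : MemLp (fun u => (J u).path s a) 2 Lam :=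
  (hJ2 s).continuousLinearMap_comp (EuclideanSpace.proj (𝕜 := ℝ) a)

variable {τ : ℕ → Finset (Icc (0 : ℝ) T)} {B : Cadlag T p →L[ℝ] Cadlag T p →L[ℝ] ℝ}

theorem integral_discretize (hγ : IsGaussianPathLaw γ J Lam)
    (hJ2 : ∀ s, MemLp (fun u => (J u).path s) 2 Lam) (hτ : IsTimeGrid τ) (n : ℕ) :
    Integrable (fun u => B (discretize (τ n) (J u)) (discretize (τ n) (J u))) Lam ∧
      ∫ u, B (discretize (τ n) (J u)) (discretize (τ n) (J u)) ∂Lam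
        = ∫ z, B (discretize (τ n) z) (discretize (τ n) z) ∂γ := by
  have hμ := hγ.isCentredGaussian (τ n)
  have e : ∀ x : Cadlag T p, B (discretize (τ n) x) (discretize (τ n) x)
      = ∑ i : τ n × Fin p, ∑ j : τ n × Fin p,
        B (cell (τ n) i.1 i.2) (cell (τ n) j.1 j.2) * (x.path i.1 i.2 * x.path j.1 j.2) := fun x => by
    rw [← hτ.ofCoords_coordsOn, ofCoords_apply, bilin_sum_smul]
    rfl
  have h1 : ∀ i j : τ n × Fin p, Integrable (fun u => (J u).path i.1 i.2 * (J u).path j.1 j.2) Lam :=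
    fun i j => (memLp_coord hJ2 _ _).integrable_mul (memLp_coord hJ2 _ _)
  have h2 : ∀ i j : τ n × Fin p, Integrable (fun z : Cadlag T p =>
      z.path i.1 i.2 * z.path j.1 j.2) γ := fun i j => by
    have h := hμ.integrable_mul i j
    exact (integrable_map_measure h.aestronglyMeasurable
      (measurable_coordsOn (T := T) (p := p) (τ n)).aemeasurable).1 h
  simp_rw [e]
  refine ⟨integrable_finsetSum _ fun i _ => integrable_finsetSum _ fun j _ =>
    (h1 i j).const_mul _, ?_⟩
  rw [integral_finsetSum _ fun i _ => integrable_finsetSum _ fun j _ => (h1 i j).const_mul _,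
    integral_finsetSum _ fun i _ => integrable_finsetSum _ fun j _ => (h2 i j).const_mul _]
  refine Finset.sum_congr rfl fun i _ => ?_
  rw [integral_finsetSum _ fun j _ => (h1 i j).const_mul _,
    integral_finsetSum _ fun j _ => (h2 i j).const_mul _]
  refine Finset.sum_congr rfl fun j _ => ?_
  rw [integral_const_mul, integral_const_mul, hγ.cov]

/-- The increments of the discretized form are bounded in `L¹` by those of the Gaussian path. -/
theorem integral_abs_discretize_sub_le (hT : 0 ≤ T) (hγ : IsGaussianPathLaw γ J Lam)
    (hJm : Measurable J) (hJ2 : ∀ s, MemLp (fun u => (J u).path s) 2 Lam) (hτ : IsTimeGrid τ)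
    (hB : ∀ x y, B x y = B y x) (n k : ℕ) {δ : ℝ} (hδ : 0 < δ) :
    ∫ u, |B (discretize (τ n) (J u)) (discretize (τ n) (J u))
        - B (discretize (τ k) (J u)) (discretize (τ k) (J u))| ∂Lam
      ≤ ‖B‖ / (2 * δ) * ∫ z, ‖discretize (τ n) z - discretize (τ k) z‖ ^ 2 ∂γ
        + ‖B‖ * δ / 2 * ∫ z, ‖discretize (τ n) z + discretize (τ k) z‖ ^ 2 ∂γ := by
  set m := max n k with hm
  have hn : τ n ⊆ τ m := hτ.mono (le_max_left n k)
  have hk : τ k ⊆ τ m := hτ.mono (le_max_right n k)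
  have hμ := hγ.isCentredGaussian (τ m)
  have hμg := hμ.isGaussian
  have hP := hγ.isProbabilityMeasure
  have hγ3 := hγ.integrable_norm_pow_three hT
  let D : Cadlag T p →ₗ[ℝ] Cadlag T p := discretize (τ n) - discretize (τ k)
  let S : Cadlag T p →ₗ[ℝ] Cadlag T p := discretize (τ n) + discretize (τ k)
  have hD : ∀ x, D x = discretize (τ n) x - discretize (τ k) x := fun x => rfl
  have hS : ∀ x, S x = discretize (τ n) x + discretize (τ k) x := fun x => rfl
  have hDm : ∀ x, D (discretize (τ m) x) = D x := fun x => by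
    rw [hD, hD, discretize_discretize hn (hτ.first n), discretize_discretize hk (hτ.first k)]
  have hSm : ∀ x, S (discretize (τ m) x) = S x := fun x => by
    rw [hS, hS, discretize_discretize hn (hτ.first n), discretize_discretize hk (hτ.first k)]
  have hbil : ∀ v w : EuclideanSpace ℝ (τ m × Fin p), B (D (ofCoords (τ m) v)) (S (ofCoords (τ m) w))
      = ∑ i, ∑ j, B (D (cell (τ m) i.1 i.2)) (S (cell (τ m) j.1 j.2)) * (v i * w j) := fun v w => by
    simp only [ofCoords_apply, map_sum D, map_sum S, map_smul]
    exact bilin_sum_smul _ _ _ _ _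
  have hdiff : ∀ x, B (discretize (τ n) x) (discretize (τ n) x)
      - B (discretize (τ k) x) (discretize (τ k) x) = B (D x) (S x) := fun x => by
    rw [hD, hS, map_sub, map_add, _root_.sub_apply, _root_.sub_apply, hB (discretize (τ k) x) (discretize (τ n) x)]
    ring
  have hsq : ∀ (L : Cadlag T p →ₗ[ℝ] Cadlag T p) (_ : ∀ x, ‖L x‖ ≤ 2 * ‖x‖)
      (_ : ∀ x, L (discretize (τ m) x) = L x),
      Integrable (fun v => ‖L (ofCoords (τ m) v)‖ ^ 2) (γ.map (coordsOn (τ m))) ∧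
      ∫ v, ‖L (ofCoords (τ m) v)‖ ^ 2 ∂(γ.map (coordsOn (τ m))) = ∫ z, ‖L z‖ ^ 2 ∂γ := by
    intro L hL hLm
    have hc : Continuous fun v : EuclideanSpace ℝ (τ m × Fin p) => ‖L (ofCoords (τ m) v)‖ ^ 2 :=
      ((L.comp (ofCoords (τ m))).continuous_of_finiteDimensional.norm).pow 2
    have hcm := (measurable_coordsOn (T := T) (p := p) (τ m)).aemeasurable (μ := γ)
    have e : ∀ z : Cadlag T p, ‖L (ofCoords (τ m) (coordsOn (τ m) z))‖ ^ 2 = ‖L z‖ ^ 2 := fun z => by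
      rw [hτ.ofCoords_coordsOn, hLm]
    refine ⟨(integrable_map_measure hc.aestronglyMeasurable hcm).2 ?_, ?_⟩
    · refine (((integrable_const (1 : ℝ)).add hγ3).const_mul 4).mono'
        (hc.measurable.comp (measurable_coordsOn (τ m))).aestronglyMeasurable
        (Eventually.of_forall fun z => ?_)
      simp only [Function.comp_apply, e, Pi.add_apply]
      rw [Real.norm_of_nonneg (by positivity)]
      have h1 := hL z
      have h2 : ‖z‖ ^ 2 ≤ 1 + ‖z‖ ^ 3 := by
        have hz := norm_nonneg z
        have := pow_nonneg hz 3
        rcases le_total ‖z‖ 1 with h | h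
        · nlinarith
        · nlinarith [mul_nonneg (sq_nonneg ‖z‖) (sub_nonneg.2 h)]
      nlinarith [norm_nonneg (L z), norm_nonneg z]
    · rw [integral_map hcm hc.aestronglyMeasurable]
      simp_rw [e]
  have hnorm : ∀ (l : ℕ) (x : Cadlag T p), ‖discretize (τ l) x‖ ≤ ‖x‖ := fun l x =>
    norm_discretize_le _ _
  obtain ⟨i1, v1⟩ := hsq D (fun x => (norm_sub_le _ _).trans
    (by linarith [hnorm n x, hnorm k x])) hDm
  obtain ⟨i2, v2⟩ := hsq S (fun x => (norm_add_le _ _).trans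
    (by linarith [hnorm n x, hnorm k x])) hSm
  have hJc : ∀ i : τ m × Fin p, Measurable fun u => (J u).path i.1 i.2 := fun i =>
    (measurable_coord i.1.1 i.2).comp hJm
  have key := (hμ.integral_abs_le (Λ := Lam) (X := fun i u => (J u).path i.1 i.2)
    hJc (fun i => memLp_coord hJ2 _ _) (fun i j => rfl)
    (fun i j => B (D (cell (τ m) i.1 i.2)) (S (cell (τ m) j.1 j.2)))
    (i1.const_mul (‖B‖ / (2 * δ))) (i2.const_mul (‖B‖ * δ / 2)) fun v w => ?_).2
  · rw [integral_const_mul, integral_const_mul, v1, v2] at key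
    refine le_trans (le_of_eq ?_) key
    refine integral_congr_ae (Eventually.of_forall fun u => ?_)
    simp only []
    rw [hdiff, ← hDm, ← hSm, ← hτ.ofCoords_coordsOn, hbil]
    rfl
  · rw [← hbil]
    refine (B.le_opNorm₂ _ _).trans ?_
    set x := ‖D (ofCoords (τ m) v)‖
    set y := ‖S (ofCoords (τ m) w)‖
    have h1 : x * y ≤ x ^ 2 / (2 * δ) + δ / 2 * y ^ 2 := by
      have : x ^ 2 / (2 * δ) + δ / 2 * y ^ 2 - x * y = (x - δ * y) ^ 2 / (2 * δ) := by
        field_simp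
        ring
      have h2 : 0 ≤ (x - δ * y) ^ 2 / (2 * δ) := by positivity
      linarith
    calc ‖B‖ * x * y = ‖B‖ * (x * y) := by ring
      _ ≤ ‖B‖ * (x ^ 2 / (2 * δ) + δ / 2 * y ^ 2) := mul_le_mul_of_nonneg_left h1 (norm_nonneg B)
      _ = _ := by ring

/-- `E B(Z,Z) = ∫ B(J_u,J_u) Lam(du)` for bounded symmetric bilinear forms `B`. The forms of the
discretizations converge on the left by continuity of `Z`, and on the right for each `u` since the
grid exhausts the atoms of `B`; they form a Cauchy sequence in `L¹(Lam)`. -/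
theorem integral_bilin (hT : 0 ≤ T) (hγ : IsGaussianPathLaw γ J Lam)
    (hJm : Measurable J) (hJ2 : ∀ s, MemLp (fun u => (J u).path s) 2 Lam)
    (hB : ∀ x y, B x y = B y x) :
    Integrable (fun u => B (J u) (J u)) Lam ∧ ∫ u, B (J u) (J u) ∂Lam = ∫ z, B z z ∂γ := by
  have hP := hγ.isProbabilityMeasure
  have hγ3 := hγ.integrable_norm_pow_three hT
  obtain ⟨τ, hτ, hτB⟩ := exists_isTimeGrid hT (countable_atomTimes B)
  -- pointwise convergence
  have hpt : ∀ x, Tendsto (fun n => B (discretize (τ n) x) (discretize (τ n) x)) atTop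
      (𝓝 (B x x)) := fun x => by
    have h1 := (hτ.tendsto_bilin hT hτB x).mul_const (2 * ‖x‖)
    rw [zero_mul] at h1
    refine tendsto_iff_norm_sub_tendsto_zero.2
      (squeeze_zero (fun n => norm_nonneg _) (fun n => ?_) h1)
    have e : B (discretize (τ n) x) (discretize (τ n) x) - B x x
        = -B (x - discretize (τ n) x) (x + discretize (τ n) x) := by
      rw [map_sub, map_add, _root_.sub_apply, _root_.sub_apply, hB (discretize (τ n) x) x]
      ring
    rw [e, norm_neg]
    refine (ContinuousLinearMap.le_opNorm _ _).trans ?_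
    gcongr
    refine (norm_add_le _ _).trans ?_
    have := norm_discretize_le (τ n) x
    linarith
  have hsq : ∀ x : ℝ, 0 ≤ x → x ^ 2 ≤ 1 + x ^ 3 := fun x hx => by
    have := pow_nonneg hx 3
    rcases le_total x 1 with h | h
    · nlinarith
    · nlinarith [mul_nonneg (sq_nonneg x) (sub_nonneg.2 h)]
  have hW : Integrable (fun z : Cadlag T p => 1 + ‖z‖ ^ 3) γ := (integrable_const 1).add hγ3
  have hdm : ∀ n, Measurable fun z : Cadlag T p => discretize (τ n) z := fun n =>
    IsTimeGrid.measurable_discretize n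
  -- the discretization errors of the Gaussian path
  have hsqi : ∀ (F : Cadlag T p → Cadlag T p), Measurable F → (∀ z, ‖F z‖ ≤ 2 * ‖z‖) →
      Integrable (fun z => ‖F z‖ ^ 2) γ := fun F hF hFb => by
    refine (hW.const_mul 4).mono' ((Cadlag.measurable_norm.comp hF).pow_const 2).aestronglyMeasurable
      (Eventually.of_forall fun z => ?_)
    rw [Real.norm_of_nonneg (by positivity)]
    have h1 := pow_le_pow_left₀ (norm_nonneg _) (hFb z) 2
    have h2 := hsq _ (norm_nonneg z)
    rw [mul_pow] at h1
    linarith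
  have hnd : ∀ n (z : Cadlag T p), ‖discretize (τ n) z‖ ≤ ‖z‖ := fun n z => norm_discretize_le _ _
  have hei : ∀ n, Integrable (fun z => ‖discretize (τ n) z - z‖ ^ 2) γ := fun n =>
    hsqi _ ((hdm n).sub measurable_id) fun z => (norm_sub_le _ _).trans (by linarith [hnd n z])
  have hlim : Tendsto (fun n => ∫ z, ‖discretize (τ n) z - z‖ ^ 2 ∂γ) atTop (𝓝 0) := by
    have h0 : ∫ z : Cadlag T p, (0 : ℝ) ∂γ = 0 := integral_zero _ _
    rw [← h0]
    refine tendsto_integral_of_dominated_convergence (fun z => 4 * (1 + ‖z‖ ^ 3))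
      (fun n => (hei n).aestronglyMeasurable) (hW.const_mul 4) (fun n => ?_) ?_
    · refine Eventually.of_forall fun z => ?_
      rw [Real.norm_of_nonneg (by positivity)]
      have h3 : ‖discretize (τ n) z - z‖ ≤ 2 * ‖z‖ :=
        (norm_sub_le _ _).trans (by linarith [hnd n z])
      have h1 := pow_le_pow_left₀ (norm_nonneg _) h3 2
      have h2 := hsq _ (norm_nonneg z)
      rw [mul_pow] at h1
      linarith
    · filter_upwards [hγ.tendsto_discretize τ hτ] with z hz
      simpa using hz.pow 2
  set M := ∫ z : Cadlag T p, (1 + ‖z‖ ^ 3) ∂γ with hM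
  have hM0 : 0 ≤ M := integral_nonneg fun z => by positivity
  -- uniform smallness of the increments in `L¹`
  have hinc : ∀ δ : ℝ, 0 < δ → ∃ K, ∀ n ≥ K, ∀ k ≥ K,
      ∫ u, |B (discretize (τ n) (J u)) (discretize (τ n) (J u))
        - B (discretize (τ k) (J u)) (discretize (τ k) (J u))| ∂Lam ≤ ‖B‖ * (1 + 2 * M) * δ := by
    intro δ hδ
    have hev := hlim.eventually (gt_mem_nhds (by positivity : 0 < δ ^ 2 / 2))
    obtain ⟨K, hK⟩ := eventually_atTop.1 hev
    refine ⟨K, fun n hn k hk => (hγ.integral_abs_discretize_sub_le hT hJm hJ2 hτ hB n k hδ).trans ?_⟩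
    have h1 : ∫ z, ‖discretize (τ n) z - discretize (τ k) z‖ ^ 2 ∂γ ≤ 2 * δ ^ 2 := by
      have h3 : ∫ z, ‖discretize (τ n) z - discretize (τ k) z‖ ^ 2 ∂γ
          ≤ ∫ z, (2 * ‖discretize (τ n) z - z‖ ^ 2 + 2 * ‖discretize (τ k) z - z‖ ^ 2) ∂γ := by
        refine integral_mono (hsqi _ ((hdm n).sub (hdm k)) fun z => (norm_sub_le _ _).trans
          (by linarith [hnd n z, hnd k z])) (((hei n).const_mul 2).add ((hei k).const_mul 2))
          fun z => ?_
        have h4 : ‖discretize (τ n) z - discretize (τ k) z‖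
            ≤ ‖discretize (τ n) z - z‖ + ‖discretize (τ k) z - z‖ := by
          rw [← sub_sub_sub_cancel_right _ _ z]
          exact norm_sub_le _ _
        have h5 := pow_le_pow_left₀ (norm_nonneg _) h4 2
        simp only []
        nlinarith [sq_nonneg (‖discretize (τ n) z - z‖ - ‖discretize (τ k) z - z‖)]
      rw [integral_add ((hei n).const_mul 2) ((hei k).const_mul 2), integral_const_mul,
        integral_const_mul] at h3
      have h6 := hK n hn
      have h7 := hK k hk
      linarith
    have h2 : ∫ z, ‖discretize (τ n) z + discretize (τ k) z‖ ^ 2 ∂γ ≤ 4 * M := by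
      rw [hM, ← integral_const_mul]
      refine integral_mono (hsqi _ ((hdm n).add (hdm k)) fun z => (norm_add_le _ _).trans
          (by linarith [hnd n z, hnd k z])) (hW.const_mul 4) fun z => ?_
      have h3 : ‖discretize (τ n) z + discretize (τ k) z‖ ≤ 2 * ‖z‖ :=
        (norm_add_le _ _).trans (by linarith [hnd n z, hnd k z])
      have h1 := pow_le_pow_left₀ (norm_nonneg _) h3 2
      have h2 := hsq _ (norm_nonneg z)
      rw [mul_pow] at h1
      simp only []
      linarith
    have hBn := norm_nonneg B
    calc _ ≤ ‖B‖ / (2 * δ) * (2 * δ ^ 2) + ‖B‖ * δ / 2 * (4 * M) := by gcongr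
      _ = _ := by field_simp; ring
  have hFi := fun n => (hγ.integral_discretize (B := B) hJ2 hτ n).1
  have hFe := fun n => (hγ.integral_discretize (B := B) hJ2 hτ n).2
  have hmeas : AEStronglyMeasurable (fun u => B (J u) (J u)) Lam :=
    aestronglyMeasurable_of_tendsto_ae atTop (fun n => (hFi n).aestronglyMeasurable)
      (Eventually.of_forall fun u => hpt (J u))
  have hL1 : ∀ δ : ℝ, 0 < δ → ∃ K, ∀ k ≥ K,
      ∫⁻ u, ‖B (discretize (τ k) (J u)) (discretize (τ k) (J u)) - B (J u) (J u)‖ₑ ∂Lam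
        ≤ ENNReal.ofReal (‖B‖ * (1 + 2 * M) * δ) := by
    intro δ hδ
    obtain ⟨K, hK⟩ := hinc δ hδ
    refine ⟨K, fun k hk => ?_⟩
    have h1 : ∀ n, ∫⁻ u, ‖B (discretize (τ k) (J u)) (discretize (τ k) (J u))
        - B (discretize (τ n) (J u)) (discretize (τ n) (J u))‖ₑ ∂Lam
        = ENNReal.ofReal (∫ u, |B (discretize (τ k) (J u)) (discretize (τ k) (J u))
        - B (discretize (τ n) (J u)) (discretize (τ n) (J u))| ∂Lam) := fun n => by
      exact (ofReal_integral_norm_eq_lintegral_enorm ((hFi k).sub (hFi n))).symm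
    calc _ = ∫⁻ u, liminf (fun n => ‖B (discretize (τ k) (J u)) (discretize (τ k) (J u))
          - B (discretize (τ n) (J u)) (discretize (τ n) (J u))‖ₑ) atTop ∂Lam := by
          refine lintegral_congr fun u => ?_
          exact ((tendsto_const_nhds.sub (hpt (J u))).enorm).liminf_eq.symm
      _ ≤ liminf (fun n => ∫⁻ u, ‖B (discretize (τ k) (J u)) (discretize (τ k) (J u))
          - B (discretize (τ n) (J u)) (discretize (τ n) (J u))‖ₑ ∂Lam) atTop :=
          lintegral_liminf_le' fun n => ((hFi k).sub (hFi n)).aestronglyMeasurable.enorm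
      _ ≤ ENNReal.ofReal (‖B‖ * (1 + 2 * M) * δ) := by
          refine liminf_le_of_frequently_le' (Eventually.frequently ?_)
          filter_upwards [eventually_ge_atTop K] with n hn
          rw [h1]
          exact ENNReal.ofReal_le_ofReal (hK k hk n hn)
  have hint : Integrable (fun u => B (J u) (J u)) Lam := by
    obtain ⟨K, hK⟩ := hL1 1 zero_lt_one
    have h1 : Integrable (fun u => B (discretize (τ K) (J u)) (discretize (τ K) (J u))
        - B (J u) (J u)) Lam :=
      ⟨(hFi K).aestronglyMeasurable.sub hmeas, (hK K le_rfl).trans_lt ENNReal.ofReal_lt_top⟩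
    refine ((hFi K).sub h1).congr (Eventually.of_forall fun u => ?_)
    simp
  refine ⟨hint, ?_⟩
  have hconv : Tendsto (fun k => ∫ u, B (discretize (τ k) (J u)) (discretize (τ k) (J u)) ∂Lam) atTop
      (𝓝 (∫ u, B (J u) (J u) ∂Lam)) := by
    refine tendsto_integral_of_L1 _ hmeas (Eventually.of_forall hFi) ?_
    refine ENNReal.tendsto_nhds_zero.2 fun ε hε => ?_
    have hc : 0 ≤ ‖B‖ * (1 + 2 * M) := by positivity
    obtain ⟨δ, hδ, hδε⟩ : ∃ δ : ℝ, 0 < δ ∧ ENNReal.ofReal (‖B‖ * (1 + 2 * M) * δ) ≤ ε := by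
      by_cases hεt : ε = ∞
      · exact ⟨1, zero_lt_one, hεt ▸ le_top⟩
      refine ⟨ε.toReal / (‖B‖ * (1 + 2 * M) + 1),
        div_pos (ENNReal.toReal_pos hε.ne' hεt) (by positivity), ?_⟩
      rw [← ENNReal.ofReal_toReal hεt, ENNReal.toReal_ofReal ENNReal.toReal_nonneg]
      refine ENNReal.ofReal_le_ofReal ?_
      rw [← mul_div_assoc, div_le_iff₀ (by positivity)]
      have := ENNReal.toReal_nonneg (a := ε)
      nlinarith
    obtain ⟨K, hK⟩ := hL1 δ hδ
    filter_upwards [eventually_ge_atTop K] with k hk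
    exact (hK k hk).trans hδε
  have hconv' : Tendsto (fun k => ∫ z, B (discretize (τ k) z) (discretize (τ k) z) ∂γ) atTop
      (𝓝 (∫ z, B z z ∂γ)) := by
    refine tendsto_integral_of_dominated_convergence (fun z => ‖B‖ * (1 + ‖z‖ ^ 3)) (fun n => ?_)
      (hW.const_mul ‖B‖) (fun n => Eventually.of_forall fun z => ?_)
      (Eventually.of_forall fun z => hpt z)
    · have h : Measurable fun z : Cadlag T p => B (discretize (τ n) z) (discretize (τ n) z) := by
        simp_rw [← hτ.ofCoords_coordsOn n, ofCoords_apply, bilin_sum_smul]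
        have hc : ∀ i : τ n × Fin p, Measurable fun z : Cadlag T p => coordsOn (τ n) z i := fun i =>
          measurable_coord i.1.1 i.2
        exact Finset.measurable_sum _ fun i _ => Finset.measurable_sum _ fun j _ =>
          ((hc i).mul (hc j)).const_mul _
      exact h.aestronglyMeasurable
    · refine (B.le_opNorm₂ _ _).trans ?_
      rw [mul_assoc]
      refine mul_le_mul_of_nonneg_left ?_ (norm_nonneg B)
      have h1 := hnd n z
      have h2 := hsq _ (norm_nonneg z)
      nlinarith [norm_nonneg (discretize (τ n) z), norm_nonneg z]
  exact tendsto_nhds_unique hconv (hconv'.congr fun n => (hFe n).symm)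

end IsGaussianPathLaw

end CovarianceIdentity


/-! ### Integrals of càdlàg functions against random measures -/

section PathIntegral

open Cadlag

variable {T : ℝ} {p d : ℕ} {J : Euc d → Cadlag T p}

open Classical in
/-- The path `∫ J_u n(du)`, set to `0` if the integral does not converge absolutely. In contrast to
`integralPath`, it depends measurably on `n`. -/
noncomputable def absIntegralPath (J : Euc d → Cadlag T p) (n : Measure (Euc d)) : Cadlag T p :=
  if ∫⁻ u, ‖J u‖ₑ ∂n < ∞ then integralPath J n else 0

theorem measurable_lintegral_enorm (hJ : Measurable J) :
    Measurable fun n : Measure (Euc d) => ∫⁻ u, ‖J u‖ₑ ∂n :=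
  Measure.measurable_lintegral (Cadlag.measurable_enorm.comp hJ)

theorem absIntegralPath_eq {n : Measure (Euc d)} (h : ∫⁻ u, ‖J u‖ₑ ∂n < ∞) :
    absIntegralPath J n = integralPath J n := if_pos h

theorem path_integralPath (hJ : Measurable J) {n : Measure (Euc d)} (h : ∫⁻ u, ‖J u‖ₑ ∂n < ∞)
    (s : Icc (0 : ℝ) T) : (integralPath J n).path s = ∫ u, (J u).path s ∂n :=
  path_meanPath hJ.aemeasurable h s

theorem measurable_absIntegralPath (hJ : Measurable J) : Measurable (absIntegralPath J) := by
  classical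
  have hG : MeasurableSet {n : Measure (Euc d) | ∫⁻ u, ‖J u‖ₑ ∂n < ∞} :=
    measurableSet_lt (measurable_lintegral_enorm hJ) measurable_const
  refine measurable_iff.2 fun s => ?_
  have hc : ∀ a : Fin p, Measurable fun n : Measure (Euc d) =>
      (∫⁻ u, ENNReal.ofReal ((J u).path s a) ∂n).toReal
        - (∫⁻ u, ENNReal.ofReal (-(J u).path s a) ∂n).toReal := fun a => by
    have hm : Measurable fun u => (J u).path s a := (measurable_coord s a).comp hJ
    exact (Measure.measurable_lintegral hm.ennreal_ofReal).ennreal_toReal.sub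
      (Measure.measurable_lintegral hm.neg.ennreal_ofReal).ennreal_toReal
  have hv : Measurable fun n : Measure (Euc d) => (WithLp.toLp 2 fun a : Fin p =>
      (∫⁻ u, ENNReal.ofReal ((J u).path s a) ∂n).toReal
        - (∫⁻ u, ENNReal.ofReal (-(J u).path s a) ∂n).toReal : Euc p) :=
    (WithLp.measurable_toLp 2 _).comp (measurable_pi_lambda _ hc)
  suffices e : (fun n => (absIntegralPath J n).path s) = fun n : Measure (Euc d) =>
      if n ∈ {n : Measure (Euc d) | ∫⁻ u, ‖J u‖ₑ ∂n < ∞} then (WithLp.toLp 2 fun a : Fin p =>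
      (∫⁻ u, ENNReal.ofReal ((J u).path s a) ∂n).toReal
        - (∫⁻ u, ENNReal.ofReal (-(J u).path s a) ∂n).toReal : Euc p) else 0 by
    rw [e]
    exact Measurable.ite hG hv measurable_const
  funext n
  by_cases h : ∫⁻ u, ‖J u‖ₑ ∂n < ∞
  · refine Eq.trans ?_ (if_pos (c := n ∈ {n : Measure (Euc d) | ∫⁻ u, ‖J u‖ₑ ∂n < ∞}) h).symm
    rw [absIntegralPath_eq h, path_integralPath hJ h]
    have hi := integrable_path hJ.aemeasurable h s
    ext a
    have h1 := (EuclideanSpace.proj (𝕜 := ℝ) a).integral_comp_comm hi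
    refine h1.symm.trans ?_
    exact integral_eq_lintegral_pos_part_sub_lintegral_neg_part
      ((EuclideanSpace.proj (𝕜 := ℝ) a).integrable_comp hi)
  · refine Eq.trans ?_ (if_neg (c := n ∈ {n : Measure (Euc d) | ∫⁻ u, ‖J u‖ₑ ∂n < ∞}) h).symm
    rw [absIntegralPath, if_neg h]
    rfl

theorem enorm_absIntegralPath_le (hJ : Measurable J) (n : Measure (Euc d)) :
    ‖absIntegralPath J n‖ₑ ≤ ∫⁻ u, ‖J u‖ₑ ∂n := by
  by_cases h : ∫⁻ u, ‖J u‖ₑ ∂n < ∞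
  · rw [absIntegralPath_eq h]
    exact enorm_meanPath_le hJ.aemeasurable h
  · rw [absIntegralPath, if_neg h, enorm_zero]
    exact zero_le

theorem lintegral_add_dirac (hJ : Measurable J) (n : Measure (Euc d)) (u : Euc d) :
    ∫⁻ v, ‖J v‖ₑ ∂(n + Measure.dirac u) = ∫⁻ v, ‖J v‖ₑ ∂n + ‖J u‖ₑ := by
  have hJe : Measurable fun u => ‖J u‖ₑ := Cadlag.measurable_enorm.comp hJ
  rw [lintegral_add_measure, lintegral_dirac' _ hJe]

theorem absIntegralPath_add_dirac (hJ : Measurable J) {n : Measure (Euc d)}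
    (h : ∫⁻ u, ‖J u‖ₑ ∂n < ∞) (u : Euc d) :
    absIntegralPath J (n + Measure.dirac u) = integralPath J n + J u := by
  have h2 : ∫⁻ v, ‖J v‖ₑ ∂(n + Measure.dirac u) < ∞ := by
    rw [lintegral_add_dirac hJ]
    exact ENNReal.add_lt_top.2 ⟨h, enorm_lt_top⟩
  rw [absIntegralPath_eq h2]
  refine ext fun s => ?_
  have hJs : Measurable fun v => (J v).path s := (measurable_eval s).comp hJ
  rw [Cadlag.add_apply, path_integralPath hJ h2, path_integralPath hJ h, integral_add_measure
    (integrable_path hJ.aemeasurable h s)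
    (integrable_dirac' hJs.stronglyMeasurable (by finiteness)),
    integral_dirac' _ _ hJs.stronglyMeasurable]

end PathIntegral

/-! ### Couplings with reduced Palm measures -/

section Palm

open Cadlag

variable {T : ℝ} {p d : ℕ} {Ω : Type*} [MeasurableSpace Ω] {P : Measure Ω}
  {N : Ω → Measure (Euc d)} {lam : Measure (Euc d)}
  {Nu : Euc d → Ω → Measure (Euc d)} {J : Euc d → Cadlag T p}

theorem lintegral_enorm_mul_eq [SFinite P] [SFinite lam] {F : Ω → ℝ≥0∞} (hF : Measurable F)
    (hJ : Measurable J) : ∫⁻ q, ‖J q.2‖ₑ * F q.1 ∂(P.prod lam)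
      = (∫⁻ u, ‖J u‖ₑ ∂lam) * ∫⁻ ω, F ω ∂P := by
  have hJe : Measurable fun u => ‖J u‖ₑ := Cadlag.measurable_enorm.comp hJ
  have h1 : Measurable fun q : Ω × Euc d => ‖J q.2‖ₑ * F q.1 :=
    (hJe.comp measurable_snd).mul (hF.comp measurable_fst)
  rw [lintegral_prod _ h1.aemeasurable]
  have h2 : ∀ ω, ∫⁻ u, ‖J u‖ₑ * F ω ∂lam = (∫⁻ u, ‖J u‖ₑ ∂lam) * F ω := fun ω =>
    lintegral_mul_const _ hJe
  simp_rw [h2]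
  rw [lintegral_const_mul _ hF]

namespace IsReducedPalmCoupling

theorem measurable_add_dirac (h : IsReducedPalmCoupling P N lam Nu) :
    Measurable fun q : Ω × Euc d => Nu q.2 q.1 + Measure.dirac q.2 :=
  (h.measurable.comp measurable_swap).add (Measure.measurable_dirac.comp measurable_snd)

/-- Palm's formula, with the right-hand side as an integral over the product space. -/
theorem lintegral_eq_prod [SigmaFinite lam] (h : IsReducedPalmCoupling P N lam Nu)
    {k : Measure (Euc d) × Euc d → ℝ≥0∞} (hk : Measurable k) :
    ∫⁻ ω, ∫⁻ u, k (N ω, u) ∂(N ω) ∂P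
      = ∫⁻ q, k (Nu q.2 q.1 + Measure.dirac q.2, q.2) ∂(P.prod lam) := by
  rw [h.palm k hk, lintegral_prod]
  exact (hk.comp (h.measurable_add_dirac.prodMk measurable_snd)).aemeasurable

variable [IsProbabilityMeasure P]

theorem lintegral_lintegral (h : IsReducedPalmCoupling P N lam Nu) {k : Euc d → ℝ≥0∞}
    (hk : Measurable k) : ∫⁻ ω, ∫⁻ u, k u ∂(N ω) ∂P = ∫⁻ u, k u ∂lam := by
  have h1 := h.palm (fun q => k q.2) (hk.comp measurable_snd)
  have e : ∫⁻ _, ∫⁻ u, k u ∂lam ∂P = ∫⁻ u, k u ∂lam := by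
    rw [lintegral_const, measure_univ, mul_one]
  exact h1.trans e

theorem ae_lintegral_lt_top (h : IsReducedPalmCoupling P N lam Nu) (hN : Measurable N)
    (hJ : Measurable J) (hJ1 : ∫⁻ u, ‖J u‖ₑ ∂lam < ∞) :
    ∀ᵐ ω ∂P, ∫⁻ u, ‖J u‖ₑ ∂(N ω) < ∞ := by
  refine ae_lt_top ((measurable_lintegral_enorm hJ).comp hN) ?_
  have hJe : Measurable fun u => ‖J u‖ₑ := Cadlag.measurable_enorm.comp hJ
  rw [h.lintegral_lintegral hJe]
  exact hJ1.ne

variable [SigmaFinite lam]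

theorem ae_lintegral_coupling_lt_top (h : IsReducedPalmCoupling P N lam Nu) (hN : Measurable N)
    (hJ : Measurable J) (hJ1 : ∫⁻ u, ‖J u‖ₑ ∂lam < ∞) :
    ∀ᵐ q ∂(P.prod lam), ∫⁻ u, ‖J u‖ₑ ∂(Nu q.2 q.1) < ∞ := by
  have hm : Measurable fun q : Ω × Euc d => ∫⁻ v, ‖J v‖ₑ ∂(Nu q.2 q.1 + Measure.dirac q.2) :=
    (measurable_lintegral_enorm hJ).comp h.measurable_add_dirac
  have hG : MeasurableSet {q : Measure (Euc d) × Euc d | ∫⁻ v, ‖J v‖ₑ ∂q.1 = ∞} :=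
    measurableSet_eq_fun ((measurable_lintegral_enorm hJ).comp measurable_fst) measurable_const
  set k : Measure (Euc d) × Euc d → ℝ≥0∞ :=
    {q : Measure (Euc d) × Euc d | ∫⁻ v, ‖J v‖ₑ ∂q.1 = ∞}.indicator 1 with hk
  have hkm : Measurable k := measurable_one.indicator hG
  have k0 : ∀ q : Measure (Euc d) × Euc d, ∫⁻ v, ‖J v‖ₑ ∂q.1 < ∞ → k q = 0 := fun q hq =>
    indicator_of_notMem (s := {q : Measure (Euc d) × Euc d | ∫⁻ v, ‖J v‖ₑ ∂q.1 = ∞})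
      (fun hu => hq.ne hu) 1
  have k1 : ∀ q : Measure (Euc d) × Euc d, ∫⁻ v, ‖J v‖ₑ ∂q.1 = ∞ → k q = 1 := fun q hq =>
    indicator_of_mem (s := {q : Measure (Euc d) × Euc d | ∫⁻ v, ‖J v‖ₑ ∂q.1 = ∞}) hq 1
  have h1 := h.lintegral_eq_prod hkm
  have h2 : ∫⁻ ω, ∫⁻ u, k (N ω, u) ∂(N ω) ∂P = 0 := by
    rw [← lintegral_zero (μ := P)]
    refine lintegral_congr_ae ?_
    filter_upwards [h.ae_lintegral_lt_top hN hJ hJ1] with ω hω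
    have : ∀ u, k (N ω, u) = 0 := fun u => k0 _ hω
    simp [this]
  rw [h2] at h1
  have h3 := (lintegral_eq_zero_iff (hkm.comp
    (h.measurable_add_dirac.prodMk measurable_snd))).1 h1.symm
  filter_upwards [h3] with q hq
  have h4 : ∫⁻ v, ‖J v‖ₑ ∂(Nu q.2 q.1 + Measure.dirac q.2) ≠ ∞ := fun hcon =>
    one_ne_zero ((k1 (Nu q.2 q.1 + Measure.dirac q.2, q.2) hcon).symm.trans hq)
  rw [lintegral_add_dirac hJ] at h4
  exact (ENNReal.add_ne_top.1 h4).1.lt_top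

end IsReducedPalmCoupling

/-- The increment `Xᵘ - X + J_u` of the path integral when a point is added at `u`, for a
coupling `Nu` with the reduced Palm measures. -/
noncomputable def palmIncrement (J : Euc d → Cadlag T p) (N : Ω → Measure (Euc d))
    (Nu : Euc d → Ω → Measure (Euc d)) (q : Ω × Euc d) : Cadlag T p :=
  absIntegralPath J (Nu q.2 q.1 + Measure.dirac q.2) - absIntegralPath J (N q.1)

namespace IsReducedPalmCoupling

theorem measurable_palmIncrement (h : IsReducedPalmCoupling P N lam Nu) (hN : Measurable N)
    (hJ : Measurable J) : Measurable (palmIncrement J N Nu) :=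
  ((measurable_absIntegralPath hJ).comp h.measurable_add_dirac).sub
    ((measurable_absIntegralPath hJ).comp (hN.comp measurable_fst))

/-- Recursion for the moments `E[‖X‖ᵏ ∫ ‖J_u‖ N(du)]`. -/
theorem lintegral_mul_enorm_pow [SigmaFinite lam] (h : IsReducedPalmCoupling P N lam Nu)
    (hJ : Measurable J) (k : ℕ) :
    ∫⁻ ω, (∫⁻ u, ‖J u‖ₑ ∂(N ω)) * ‖absIntegralPath J (N ω)‖ₑ ^ k ∂P
      ≤ ∫⁻ q, ‖J q.2‖ₑ * (‖absIntegralPath J (N q.1)‖ₑ + ‖palmIncrement J N Nu q‖ₑ) ^ k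
        ∂(P.prod lam) := by
  have hk : Measurable fun q : Measure (Euc d) × Euc d => ‖J q.2‖ₑ * ‖absIntegralPath J q.1‖ₑ ^ k :=
    (Cadlag.measurable_enorm.comp (hJ.comp measurable_snd)).mul
      ((Cadlag.measurable_enorm.comp ((measurable_absIntegralPath hJ).comp measurable_fst)).pow_const k)
  have hJe : Measurable fun u => ‖J u‖ₑ := Cadlag.measurable_enorm.comp hJ
  have h1 := h.lintegral_eq_prod hk
  have h2 : ∀ ω, ∫⁻ u, ‖J u‖ₑ * ‖absIntegralPath J (N ω)‖ₑ ^ k ∂(N ω)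
      = (∫⁻ u, ‖J u‖ₑ ∂(N ω)) * ‖absIntegralPath J (N ω)‖ₑ ^ k := fun ω =>
    lintegral_mul_const _ hJe
  simp_rw [h2] at h1
  rw [h1]
  refine lintegral_mono fun q => ?_
  have e : absIntegralPath J (Nu q.2 q.1 + Measure.dirac q.2)
      = absIntegralPath J (N q.1) + palmIncrement J N Nu q := by
    rw [palmIncrement]; abel
  simp only [e]
  gcongr
  exact enorm_add_le _ _

variable [IsProbabilityMeasure P] [SigmaFinite lam]

theorem ae_palmIncrement_eq (h : IsReducedPalmCoupling P N lam Nu) (hN : Measurable N)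
    (hJ : Measurable J) (hJ1 : ∫⁻ u, ‖J u‖ₑ ∂lam < ∞) :
    ∀ᵐ q ∂(P.prod lam), integralPath J (Nu q.2 q.1) - integralPath J (N q.1) + J q.2
      = palmIncrement J N Nu q := by
  have h1 : ∀ᵐ q ∂(P.prod lam), ∫⁻ u, ‖J u‖ₑ ∂(N q.1) < ∞ :=
    Measure.quasiMeasurePreserving_fst.ae (h.ae_lintegral_lt_top hN hJ hJ1)
  filter_upwards [h1, h.ae_lintegral_coupling_lt_top hN hJ hJ1] with q hq1 hq2
  rw [palmIncrement, absIntegralPath_add_dirac hJ hq2, absIntegralPath_eq hq1]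
  abel

/-- Moments which are finite if `E ∫ ‖J_u‖ ‖Xᵘ - X + J_u‖² lam(du)` is finite. Each moment of `X` is
bounded by the moments of one order less, by Palm's formula. -/
structure HasPalmMoments (P : Measure Ω) (N : Ω → Measure (Euc d)) (lam : Measure (Euc d))
    (Nu : Euc d → Ω → Measure (Euc d)) (J : Euc d → Cadlag T p) : Prop where
  incr_one : ∫⁻ q, ‖J q.2‖ₑ * ‖palmIncrement J N Nu q‖ₑ ∂(P.prod lam) < ∞
  incr_two : ∫⁻ q, ‖J q.2‖ₑ * ‖palmIncrement J N Nu q‖ₑ ^ 2 ∂(P.prod lam) < ∞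
  mass_mul_two : ∫⁻ ω, (∫⁻ u, ‖J u‖ₑ ∂(N ω)) * ‖absIntegralPath J (N ω)‖ₑ ^ 2 ∂P < ∞
  pow_three : ∫⁻ ω, ‖absIntegralPath J (N ω)‖ₑ ^ 3 ∂P < ∞

theorem hasPalmMoments (h : IsReducedPalmCoupling P N lam Nu) (hN : Measurable N)
    (hJ : Measurable J) (hJ1 : ∫⁻ u, ‖J u‖ₑ ∂lam < ∞)
    (hD2 : ∫⁻ q, ‖J q.2‖ₑ * ‖palmIncrement J N Nu q‖ₑ ^ 2 ∂(P.prod lam) < ∞) :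
    HasPalmMoments P N lam Nu J := by
  have hJe : Measurable fun u => ‖J u‖ₑ := Cadlag.measurable_enorm.comp hJ
  have hX : Measurable fun ω => ‖absIntegralPath J (N ω)‖ₑ :=
    Cadlag.measurable_enorm.comp ((measurable_absIntegralPath hJ).comp hN)
  have hD : Measurable fun q => ‖palmIncrement J N Nu q‖ₑ :=
    Cadlag.measurable_enorm.comp (h.measurable_palmIncrement hN hJ)
  have hle : ∀ ω, ‖absIntegralPath J (N ω)‖ₑ ≤ ∫⁻ u, ‖J u‖ₑ ∂(N ω) := fun ω =>
    enorm_absIntegralPath_le hJ (N ω)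
  have hJ2m : Measurable fun q : Ω × Euc d => ‖J q.2‖ₑ := hJe.comp measurable_snd
  have hJX : Measurable fun q : Ω × Euc d => ‖J q.2‖ₑ * ‖absIntegralPath J (N q.1)‖ₑ :=
    hJ2m.mul (hX.comp measurable_fst)
  have hJX2 : Measurable fun q : Ω × Euc d => ‖J q.2‖ₑ * ‖absIntegralPath J (N q.1)‖ₑ ^ 2 :=
    hJ2m.mul ((hX.comp measurable_fst).pow_const 2)
  have hJD2 : Measurable fun q : Ω × Euc d => ‖J q.2‖ₑ * ‖palmIncrement J N Nu q‖ₑ ^ 2 :=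
    hJ2m.mul (hD.pow_const 2)
  have hsq : ∀ a b : ℝ≥0∞, (a + b) ^ 2 ≤ 2 * a ^ 2 + 2 * b ^ 2 := fun a b => by
    rcases eq_or_ne a ∞ with rfl | ha
    · simp
    rcases eq_or_ne b ∞ with rfl | hb
    · simp
    lift a to ℝ≥0 using ha
    lift b to ℝ≥0 using hb
    rw [← mul_add]
    have := add_sq_le (a := a) (b := b)
    exact_mod_cast this
  have hone : ∀ a : ℝ≥0∞, a ≤ 1 + a ^ 2 := fun a => by
    rcases le_total a 1 with ha | ha
    · exact ha.trans le_self_add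
    · refine le_trans ?_ le_add_self
      rw [sq]
      exact le_mul_of_one_le_left zero_le ha
  have hD1 : ∫⁻ q, ‖J q.2‖ₑ * ‖palmIncrement J N Nu q‖ₑ ∂(P.prod lam) < ∞ := by
    have h1 : ∫⁻ q, ‖J q.2‖ₑ * ‖palmIncrement J N Nu q‖ₑ ∂(P.prod lam)
        ≤ ∫⁻ q, (‖J q.2‖ₑ * 1 + ‖J q.2‖ₑ * ‖palmIncrement J N Nu q‖ₑ ^ 2) ∂(P.prod lam) := by
      refine lintegral_mono fun q => ?_
      rw [← mul_add]
      gcongr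
      exact hone _
    refine h1.trans_lt ?_
    rw [lintegral_add_left (hJ2m.mul_const 1),
      lintegral_enorm_mul_eq (F := fun _ => 1) measurable_const hJ]
    refine ENNReal.add_lt_top.2 ⟨?_, hD2⟩
    simpa using hJ1
  have hX1 : ∫⁻ ω, ‖absIntegralPath J (N ω)‖ₑ ∂P < ∞ := by
    refine (lintegral_mono hle).trans_lt ?_
    rwa [h.lintegral_lintegral hJe]
  have hS1 : ∫⁻ ω, (∫⁻ u, ‖J u‖ₑ ∂(N ω)) * ‖absIntegralPath J (N ω)‖ₑ ∂P < ∞ := by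
    have h1 := h.lintegral_mul_enorm_pow hJ 1
    simp only [pow_one, mul_add] at h1
    refine h1.trans_lt ?_
    rw [lintegral_add_left hJX, lintegral_enorm_mul_eq hX hJ]
    exact ENNReal.add_lt_top.2 ⟨ENNReal.mul_lt_top hJ1 hX1, hD1⟩
  have hX2 : ∫⁻ ω, ‖absIntegralPath J (N ω)‖ₑ ^ 2 ∂P < ∞ := by
    refine lt_of_le_of_lt (lintegral_mono fun ω => ?_) hS1
    rw [sq]
    exact mul_le_mul_left (hle ω) _
  have hS2 : ∫⁻ ω, (∫⁻ u, ‖J u‖ₑ ∂(N ω)) * ‖absIntegralPath J (N ω)‖ₑ ^ 2 ∂P < ∞ := by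
    refine (h.lintegral_mul_enorm_pow hJ 2).trans_lt ?_
    have h1 : ∫⁻ q, ‖J q.2‖ₑ * (‖absIntegralPath J (N q.1)‖ₑ + ‖palmIncrement J N Nu q‖ₑ) ^ 2
        ∂(P.prod lam) ≤ ∫⁻ q, (2 * (‖J q.2‖ₑ * ‖absIntegralPath J (N q.1)‖ₑ ^ 2)
          + 2 * (‖J q.2‖ₑ * ‖palmIncrement J N Nu q‖ₑ ^ 2)) ∂(P.prod lam) := by
      refine lintegral_mono fun q => ?_
      refine (mul_le_mul_right (hsq _ _) _).trans_eq ?_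
      ring
    refine h1.trans_lt ?_
    rw [lintegral_add_left (hJX2.const_mul 2),
      lintegral_const_mul _ hJX2,
      lintegral_const_mul _ hJD2,
      lintegral_enorm_mul_eq (hX.pow_const 2) hJ]
    exact ENNReal.add_lt_top.2 ⟨ENNReal.mul_lt_top (by simp) (ENNReal.mul_lt_top hJ1 hX2),
      ENNReal.mul_lt_top (by simp) hD2⟩
  refine ⟨hD1, hD2, hS2, lt_of_le_of_lt (lintegral_mono fun ω => ?_) hS2⟩
  rw [pow_succ']
  exact mul_le_mul_left (hle ω) _

end IsReducedPalmCoupling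

end Palm


/-! ### Palm's formula for linear functionals of the path integral -/

section PalmLinear

open Cadlag

variable {T : ℝ} {p d : ℕ} {Ω : Type*} [MeasurableSpace Ω] {P : Measure Ω}
  [IsProbabilityMeasure P] {N : Ω → Measure (Euc d)} {lam : Measure (Euc d)} [SigmaFinite lam]
  {Nu : Euc d → Ω → Measure (Euc d)} {J : Euc d → Cadlag T p}

namespace IsReducedPalmCoupling

variable {φ : Measure (Euc d) → Cadlag T p →L[ℝ] ℝ} {c : Measure (Euc d) → ℝ}

/-- Palm's formula for the nonnegative function `φ_N(J_u) + c(N) ‖J_u‖`; its integral against `N`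
is `φ_N(X) + c(N) ∫ ‖J_u‖ N(du)`, as `φ_N` commutes with the path integral. -/
theorem integral_clm_add_norm (h : IsReducedPalmCoupling P N lam Nu) (hT : 0 ≤ T)
    (hN : Measurable N) (hJ : Measurable J) (hJ1 : ∫⁻ u, ‖J u‖ₑ ∂lam < ∞)
    (hφ : Measurable fun q : Measure (Euc d) × Cadlag T p => φ q.1 q.2) (hc : Measurable c)
    (hφc : ∀ n, ‖φ n‖ ≤ c n) :
    ∫ ω, (φ (N ω) (absIntegralPath J (N ω)) + c (N ω) * (∫⁻ u, ‖J u‖ₑ ∂(N ω)).toReal) ∂P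
      = ∫ q, (φ (Nu q.2 q.1 + Measure.dirac q.2) (J q.2)
          + c (Nu q.2 q.1 + Measure.dirac q.2) * ‖J q.2‖) ∂(P.prod lam) := by
  have hc0 : ∀ n, 0 ≤ c n := fun n => (norm_nonneg _).trans (hφc n)
  have hpos : ∀ n x, 0 ≤ φ n x + c n * ‖x‖ := fun n x => by
    have h1 := (φ n).le_of_opNorm_le (hφc n) x
    rw [Real.norm_eq_abs] at h1
    linarith [neg_abs_le (φ n x)]
  have hJn : Measurable fun u => ‖J u‖ := Cadlag.measurable_norm.comp hJ
  have hk0 : Measurable fun q : Measure (Euc d) × Euc d => φ q.1 (J q.2) :=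
    hφ.comp (measurable_fst.prodMk (hJ.comp measurable_snd))
  have hk : Measurable fun q : Measure (Euc d) × Euc d => φ q.1 (J q.2) + c q.1 * ‖J q.2‖ :=
    hk0.add ((hc.comp measurable_fst).mul (hJn.comp measurable_snd))
  have hX : Measurable fun ω => φ (N ω) (absIntegralPath J (N ω)) :=
    hφ.comp (hN.prodMk ((measurable_absIntegralPath hJ).comp hN))
  have hS : Measurable fun ω => (∫⁻ u, ‖J u‖ₑ ∂(N ω)).toReal :=
    ((measurable_lintegral_enorm hJ).comp hN).ennreal_toReal
  have hfin := h.ae_lintegral_lt_top hN hJ hJ1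
  -- the inner integral
  have hin : ∀ᵐ ω ∂P, 0 ≤ φ (N ω) (absIntegralPath J (N ω))
        + c (N ω) * (∫⁻ u, ‖J u‖ₑ ∂(N ω)).toReal ∧
      ENNReal.ofReal (φ (N ω) (absIntegralPath J (N ω))
        + c (N ω) * (∫⁻ u, ‖J u‖ₑ ∂(N ω)).toReal)
        = ∫⁻ u, ENNReal.ofReal (φ (N ω) (J u) + c (N ω) * ‖J u‖) ∂(N ω) := by
    filter_upwards [hfin] with ω hω
    have e1 : φ (N ω) (absIntegralPath J (N ω)) = ∫ u, φ (N ω) (J u) ∂(N ω) := by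
      rw [absIntegralPath_eq hω]
      exact clm_meanPath hT hJ.aemeasurable hω (φ (N ω))
    have e2 : (∫⁻ u, ‖J u‖ₑ ∂(N ω)).toReal = ∫ u, ‖J u‖ ∂(N ω) := by
      have := integral_norm_eq_lintegral_enorm (μ := N ω) hJn.aestronglyMeasurable
      simp only [norm_norm, enorm_norm] at this
      exact this.symm
    have i1 := integrable_clm hT hJ.aemeasurable hω (φ (N ω))
    have i2 : Integrable (fun u => c (N ω) * ‖J u‖) (N ω) :=
      (integrable_norm hJ.aemeasurable hω).const_mul _
    have e3 : φ (N ω) (absIntegralPath J (N ω)) + c (N ω) * (∫⁻ u, ‖J u‖ₑ ∂(N ω)).toReal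
        = ∫ u, (φ (N ω) (J u) + c (N ω) * ‖J u‖) ∂(N ω) := by
      rw [e1, e2, integral_add i1 i2, integral_const_mul]
    rw [e3]
    exact ⟨integral_nonneg fun u => hpos _ _,
      ofReal_integral_eq_lintegral_ofReal (i1.add i2) (Eventually.of_forall fun u => hpos _ _)⟩
  have hpalm := h.lintegral_eq_prod hk.ennreal_ofReal
  rw [integral_eq_lintegral_of_nonneg_ae (hin.mono fun ω hω => hω.1)
      (hX.add ((hc.comp hN).mul hS)).aestronglyMeasurable,
    integral_eq_lintegral_of_nonneg_ae (Eventually.of_forall fun q => hpos _ _)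
      (hk.comp (h.measurable_add_dirac.prodMk measurable_snd)).aestronglyMeasurable,
    lintegral_congr_ae (hin.mono fun ω hω => hω.2)]
  exact congrArg ENNReal.toReal hpalm

/-- Palm's formula for `φ_N(J_u)`, where `φ_N` is a continuous linear functional depending on `N`. -/
theorem integral_clm (h : IsReducedPalmCoupling P N lam Nu) (hT : 0 ≤ T)
    (hN : Measurable N) (hJ : Measurable J) (hJ1 : ∫⁻ u, ‖J u‖ₑ ∂lam < ∞)
    (hφ : Measurable fun q : Measure (Euc d) × Cadlag T p => φ q.1 q.2) (hc : Measurable c)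
    (hφc : ∀ n, ‖φ n‖ ≤ c n)
    (hfin : ∫⁻ ω, ENNReal.ofReal (c (N ω)) * ∫⁻ u, ‖J u‖ₑ ∂(N ω) ∂P < ∞) :
    Integrable (fun ω => φ (N ω) (absIntegralPath J (N ω))) P ∧
    Integrable (fun q : Ω × Euc d => φ (Nu q.2 q.1 + Measure.dirac q.2) (J q.2)) (P.prod lam) ∧
    ∫ ω, φ (N ω) (absIntegralPath J (N ω)) ∂P
      = ∫ q, φ (Nu q.2 q.1 + Measure.dirac q.2) (J q.2) ∂(P.prod lam) := by
  have hc0 : ∀ n, 0 ≤ c n := fun n => (norm_nonneg _).trans (hφc n)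
  have hJe : Measurable fun u => ‖J u‖ₑ := Cadlag.measurable_enorm.comp hJ
  have hJn : Measurable fun u => ‖J u‖ := Cadlag.measurable_norm.comp hJ
  have hk0 : Measurable fun q : Measure (Euc d) × Euc d => φ q.1 (J q.2) :=
    hφ.comp (measurable_fst.prodMk (hJ.comp measurable_snd))
  have hk1 : Measurable fun q : Measure (Euc d) × Euc d => c q.1 * ‖J q.2‖ :=
    (hc.comp measurable_fst).mul (hJn.comp measurable_snd)
  have hk2 : Measurable fun q : Measure (Euc d) × Euc d => ENNReal.ofReal (c q.1) * ‖J q.2‖ₑ :=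
    (hc.comp measurable_fst).ennreal_ofReal.mul (hJe.comp measurable_snd)
  have hX : Measurable fun ω => φ (N ω) (absIntegralPath J (N ω)) :=
    hφ.comp (hN.prodMk ((measurable_absIntegralPath hJ).comp hN))
  have hS : Measurable fun ω => (∫⁻ u, ‖J u‖ₑ ∂(N ω)).toReal :=
    ((measurable_lintegral_enorm hJ).comp hN).ennreal_toReal
  have hcS : Integrable (fun ω => c (N ω) * (∫⁻ u, ‖J u‖ₑ ∂(N ω)).toReal) P := by
    refine ⟨((hc.comp hN).mul hS).aestronglyMeasurable, lt_of_le_of_lt ?_ hfin⟩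
    refine lintegral_mono fun ω => ?_
    rw [enorm_mul, Real.enorm_of_nonneg (hc0 _), Real.enorm_of_nonneg ENNReal.toReal_nonneg]
    gcongr
    exact ENNReal.ofReal_toReal_le
  have hφX : Integrable (fun ω => φ (N ω) (absIntegralPath J (N ω))) P := by
    refine hcS.mono' hX.aestronglyMeasurable ?_
    filter_upwards [h.ae_lintegral_lt_top hN hJ hJ1] with ω hω
    refine ((φ (N ω)).le_of_opNorm_le (hφc _) _).trans ?_
    have h1 := ENNReal.toReal_mono hω.ne (enorm_absIntegralPath_le hJ (N ω))
    rw [toReal_enorm] at h1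
    exact mul_le_mul_of_nonneg_left h1 (hc0 _)
  have hm := h.measurable_add_dirac.prodMk (measurable_snd (α := Ω) (β := Euc d))
  have hcJ : Integrable (fun q : Ω × Euc d =>
      c (Nu q.2 q.1 + Measure.dirac q.2) * ‖J q.2‖) (P.prod lam) := by
    refine ⟨(hk1.comp hm).aestronglyMeasurable, ?_⟩
    have h1 := h.lintegral_eq_prod hk2
    have h2 : ∀ ω, ∫⁻ u, ENNReal.ofReal (c (N ω)) * ‖J u‖ₑ ∂(N ω)
        = ENNReal.ofReal (c (N ω)) * ∫⁻ u, ‖J u‖ₑ ∂(N ω) := fun ω => lintegral_const_mul _ hJe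
    simp_rw [h2] at h1
    rw [h1] at hfin
    refine lt_of_le_of_lt (lintegral_mono fun q => ?_) hfin
    rw [enorm_mul, Real.enorm_of_nonneg (hc0 _), enorm_norm]
  have hφJ : Integrable (fun q : Ω × Euc d => φ (Nu q.2 q.1 + Measure.dirac q.2) (J q.2))
      (P.prod lam) :=
    hcJ.mono' (hk0.comp hm).aestronglyMeasurable
      (Eventually.of_forall fun q => (φ _).le_of_opNorm_le (hφc _) _)
  refine ⟨hφX, hφJ, ?_⟩
  have h1 := h.integral_clm_add_norm hT hN hJ hJ1 hφ hc hφc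
  have h2 := h.integral_clm_add_norm hT hN hJ hJ1 (φ := fun _ => 0)
    (by simp) hc (fun n => by simpa using hc0 n)
  rw [integral_add hφX hcS, integral_add hφJ hcJ] at h1
  simp only [_root_.zero_apply, zero_add] at h2
  linarith

end IsReducedPalmCoupling

end PalmLinear


/-! ### The centred and scaled path integral -/

section CentredPath

open Cadlag

variable {T : ℝ} {p d : ℕ} {J : Euc d → Cadlag T p} {lam : Measure (Euc d)} {σ : ℝ}

/-- The path `σ⁻¹ (∫ J_u n(du) - ∫ J_u lam(du))`, with the first integral set to `0` if it does not
converge absolutely. -/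
noncomputable def absCentredPath (J : Euc d → Cadlag T p) (lam : Measure (Euc d)) (σ : ℝ)
    (n : Measure (Euc d)) : Cadlag T p :=
  σ⁻¹ • (absIntegralPath J n - integralPath J lam)

theorem measurable_absCentredPath (hJ : Measurable J) : Measurable (absCentredPath J lam σ) :=
  ((measurable_absIntegralPath hJ).sub measurable_const).const_smul σ⁻¹

theorem centredPath_eq (hJ : Measurable J) (hJ1 : ∫⁻ u, ‖J u‖ₑ ∂lam < ∞) {n : Measure (Euc d)}
    (h : ∫⁻ u, ‖J u‖ₑ ∂n < ∞) : centredPath J lam σ n = absCentredPath J lam σ n := by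
  have e : (fun s => σ⁻¹ • ((∫ u, (J u).path s ∂n) - ∫ u, (J u).path s ∂lam))
      = (absCentredPath J lam σ n).path := by
    funext s
    rw [absCentredPath, Cadlag.smul_apply, Cadlag.sub_apply, absIntegralPath_eq h,
      path_integralPath hJ h, path_integralPath hJ hJ1]
  exact (congrArg toCadlag e).trans (toCadlag_path _)

/-- A constant `C` with `1 + ‖x̃‖ᵏ ≤ C (1 + ‖x‖ᵏ)` for the centred path `x̃`. -/
theorem exists_one_add_norm_absCentredPath_pow_le (J : Euc d → Cadlag T p)
    (lam : Measure (Euc d)) (σ : ℝ) (k : ℕ) : ∃ C : ℝ, 0 ≤ C ∧ ∀ n,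
      1 + ‖absCentredPath J lam σ n‖ ^ k ≤ C * (1 + ‖absIntegralPath J n‖ ^ k) := by
  set a := |σ⁻¹|
  set m := ‖integralPath J lam‖
  have ha : 0 ≤ a := abs_nonneg _
  have hm : 0 ≤ m := norm_nonneg _
  refine ⟨1 + a ^ k * (1 + m) ^ k * 2 ^ k, by positivity, fun n => ?_⟩
  set x := ‖absIntegralPath J n‖
  have hx : 0 ≤ x := norm_nonneg _
  have h1 : ‖absCentredPath J lam σ n‖ ≤ a * (x + m) := by
    rw [absCentredPath, norm_smul, Real.norm_eq_abs]
    exact mul_le_mul_of_nonneg_left (norm_sub_le _ _) ha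
  have h2 : x + m ≤ (1 + m) * (2 * max 1 x) := by
    have := le_max_left 1 x
    have := le_max_right 1 x
    nlinarith
  have h3 : (max 1 x) ^ k ≤ 1 + x ^ k := by
    rcases le_total 1 x with h | h
    · rw [max_eq_right h]; linarith
    · rw [max_eq_left h, one_pow]; linarith [pow_nonneg hx k]
  have h4 : ‖absCentredPath J lam σ n‖ ^ k ≤ a ^ k * (1 + m) ^ k * 2 ^ k * (1 + x ^ k) := by
    calc ‖absCentredPath J lam σ n‖ ^ k ≤ (a * ((1 + m) * (2 * max 1 x))) ^ k := by
          gcongr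
          exact h1.trans (mul_le_mul_of_nonneg_left h2 ha)
      _ = a ^ k * (1 + m) ^ k * 2 ^ k * (max 1 x) ^ k := by rw [mul_pow, mul_pow, mul_pow]; ring
      _ ≤ _ := by gcongr
  linarith [pow_nonneg hx k]

end CentredPath

section Moments

open Cadlag

variable {T : ℝ} {p d : ℕ} {Ω : Type*} [MeasurableSpace Ω] {P : Measure Ω}
  {N : Ω → Measure (Euc d)} {lam : Measure (Euc d)}
  {Nu : Euc d → Ω → Measure (Euc d)} {J : Euc d → Cadlag T p} {σ : ℝ}

namespace IsReducedPalmCoupling.HasPalmMoments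

theorem integrable_norm_pow [IsProbabilityMeasure P] (hm : HasPalmMoments P N lam Nu J)
    (hN : Measurable N) (hJ : Measurable J) {k : ℕ} (hk : k ≤ 3) :
    Integrable (fun ω => ‖absIntegralPath J (N ω)‖ ^ k) P := by
  have hX : Measurable fun ω => ‖absIntegralPath J (N ω)‖ :=
    Cadlag.measurable_norm.comp ((measurable_absIntegralPath hJ).comp hN)
  have h3 : Integrable (fun ω => ‖absIntegralPath J (N ω)‖ ^ 3) P := by
    refine ⟨(hX.pow_const 3).aestronglyMeasurable, ?_⟩
    simpa [HasFiniteIntegral, enorm_pow] using hm.pow_three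
  refine ((integrable_const 1).add h3).mono' (hX.pow_const k).aestronglyMeasurable
    (Eventually.of_forall fun ω => ?_)
  rw [Real.norm_of_nonneg (by positivity)]
  set x := ‖absIntegralPath J (N ω)‖
  have hx : 0 ≤ x := norm_nonneg _
  change x ^ k ≤ 1 + x ^ 3
  rcases le_total 1 x with h | h
  · linarith [pow_le_pow_right₀ h hk]
  · linarith [pow_le_one₀ hx h (n := k), pow_nonneg hx 3]

theorem integrable_one_add_norm_pow [IsProbabilityMeasure P] (hm : HasPalmMoments P N lam Nu J)
    (hN : Measurable N) (hJ : Measurable J) {k : ℕ} (hk : k ≤ 3) :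
    Integrable (fun ω => 1 + ‖absCentredPath J lam σ (N ω)‖ ^ k) P := by
  obtain ⟨C, hC, h⟩ := exists_one_add_norm_absCentredPath_pow_le J lam σ k
  have hX : Measurable fun ω => ‖absCentredPath J lam σ (N ω)‖ :=
    Cadlag.measurable_norm.comp ((measurable_absCentredPath hJ).comp hN)
  refine (((integrable_const 1).add (hm.integrable_norm_pow hN hJ hk)).const_mul C).mono'
    ((hX.pow_const k).const_add 1).aestronglyMeasurable (Eventually.of_forall fun ω => ?_)
  rw [Real.norm_of_nonneg (by positivity)]
  exact h _

theorem integrable_norm_mul_incr (h : IsReducedPalmCoupling P N lam Nu)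
    (hm : HasPalmMoments P N lam Nu J) (hN : Measurable N) (hJ : Measurable J) :
    Integrable (fun q => ‖J q.2‖ * ‖palmIncrement J N Nu q‖) (P.prod lam) := by
  have hJn : Measurable fun q : Ω × Euc d => ‖J q.2‖ :=
    Cadlag.measurable_norm.comp (hJ.comp measurable_snd)
  have hD : Measurable fun q => ‖palmIncrement J N Nu q‖ :=
    Cadlag.measurable_norm.comp (h.measurable_palmIncrement hN hJ)
  refine ⟨(hJn.mul hD).aestronglyMeasurable, ?_⟩
  simpa [HasFiniteIntegral, enorm_mul] using hm.incr_one

theorem integrable_norm_mul_incr_sq (h : IsReducedPalmCoupling P N lam Nu)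
    (hm : HasPalmMoments P N lam Nu J) (hN : Measurable N) (hJ : Measurable J) :
    Integrable (fun q => ‖J q.2‖ * ‖palmIncrement J N Nu q‖ ^ 2) (P.prod lam) := by
  have hJn : Measurable fun q : Ω × Euc d => ‖J q.2‖ :=
    Cadlag.measurable_norm.comp (hJ.comp measurable_snd)
  have hD : Measurable fun q => ‖palmIncrement J N Nu q‖ :=
    Cadlag.measurable_norm.comp (h.measurable_palmIncrement hN hJ)
  refine ⟨(hJn.mul (hD.pow_const 2)).aestronglyMeasurable, ?_⟩
  simpa [HasFiniteIntegral, enorm_mul, enorm_pow] using hm.incr_two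

/-- A bilinear form in `J_u` and the increment of the path integral is integrable if it grows at
most linearly in `X`. -/
theorem integrable_norm_mul_norm_mul_incr [IsProbabilityMeasure P] [SigmaFinite lam]
    (h : IsReducedPalmCoupling P N lam Nu)
    (hm : HasPalmMoments P N lam Nu J) (hN : Measurable N) (hJ : Measurable J)
    (hJ1 : ∫⁻ u, ‖J u‖ₑ ∂lam < ∞) :
    Integrable (fun q => (1 + ‖absCentredPath J lam σ (N q.1)‖)
      * (‖J q.2‖ * ‖palmIncrement J N Nu q‖)) (P.prod lam) := by
  obtain ⟨C, hC, hCn⟩ := exists_one_add_norm_absCentredPath_pow_le J lam σ 1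
  have hJn : Measurable fun u => ‖J u‖ := Cadlag.measurable_norm.comp hJ
  have hD : Measurable fun q => ‖palmIncrement J N Nu q‖ :=
    Cadlag.measurable_norm.comp (h.measurable_palmIncrement hN hJ)
  have hX : Measurable fun ω => ‖absCentredPath J lam σ (N ω)‖ :=
    Cadlag.measurable_norm.comp ((measurable_absCentredPath hJ).comp hN)
  have hX1 : Measurable fun q : Ω × Euc d => 1 + ‖absCentredPath J lam σ (N q.1)‖ :=
    (hX.comp measurable_fst).const_add 1
  have hJD : Measurable fun q : Ω × Euc d => ‖J q.2‖ * ‖palmIncrement J N Nu q‖ :=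
    (hJn.comp measurable_snd).mul hD
  have i1 := integrable_norm_mul_incr h hm hN hJ
  have i2 := integrable_norm_mul_incr_sq h hm hN hJ
  have i3 : Integrable (fun q : Ω × Euc d => ‖absIntegralPath J (N q.1)‖ ^ 2 * ‖J q.2‖)
      (P.prod lam) :=
    (hm.integrable_norm_pow hN hJ (by norm_num : 2 ≤ 3)).mul_prod
      (integrable_norm hJ.aemeasurable hJ1)
  refine ((i1.add (i3.add i2)).const_mul C).mono' (hX1.mul hJD).aestronglyMeasurable
    (Eventually.of_forall fun q => ?_)
  rw [Real.norm_of_nonneg (by positivity)]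
  have h1 := hCn (N q.1)
  simp only [pow_one] at h1
  simp only [Pi.add_apply]
  set x := ‖absIntegralPath J (N q.1)‖
  set D := ‖palmIncrement J N Nu q‖
  have hx : 0 ≤ x := norm_nonneg _
  have hD0 : 0 ≤ D := norm_nonneg _
  have hj : 0 ≤ ‖J q.2‖ := norm_nonneg _
  refine (mul_le_mul_of_nonneg_right h1 (by positivity)).trans ?_
  rw [mul_assoc]
  refine mul_le_mul_of_nonneg_left ?_ hC
  have : x * D ≤ x ^ 2 + D ^ 2 := by nlinarith [sq_nonneg (x - D), sq_nonneg (x + D)]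
  nlinarith [mul_le_mul_of_nonneg_left this hj]

end IsReducedPalmCoupling.HasPalmMoments

end Moments


/-! ### Expansion of `E DF(X̃)[X̃]` by Palm's formula -/

section Expansion

open Cadlag

variable {T : ℝ} {p d : ℕ} {Ω : Type*} [MeasurableSpace Ω] {P : Measure Ω}
  [IsProbabilityMeasure P] {N : Ω → Measure (Euc d)} {lam : Measure (Euc d)}
  {Nu : Euc d → Ω → Measure (Euc d)} {J : Euc d → Cadlag T p} {σ : ℝ} {F : Cadlag T p → ℝ} {c : ℝ}

namespace IsReducedPalmCoupling.HasPalmMoments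

theorem lintegral_fderiv_bound_lt_top (h : IsReducedPalmCoupling P N lam Nu)
    (hm : HasPalmMoments P N lam Nu J) (hN : Measurable N) (hJ : Measurable J)
    (hJ1 : ∫⁻ u, ‖J u‖ₑ ∂lam < ∞) (hc : 0 ≤ c) :
    ∫⁻ ω, ENNReal.ofReal (c * (1 + ‖absCentredPath J lam σ (N ω)‖ ^ 2))
      * ∫⁻ u, ‖J u‖ₑ ∂(N ω) ∂P < ∞ := by
  obtain ⟨C, hC, hCn⟩ := exists_one_add_norm_absCentredPath_pow_le J lam σ 2
  have hJe : Measurable fun u => ‖J u‖ₑ := Cadlag.measurable_enorm.comp hJ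
  have hS : Measurable fun ω => ∫⁻ u, ‖J u‖ₑ ∂(N ω) := (measurable_lintegral_enorm hJ).comp hN
  have hX : Measurable fun ω => ‖absIntegralPath J (N ω)‖ₑ :=
    Cadlag.measurable_enorm.comp ((measurable_absIntegralPath hJ).comp hN)
  have h1 : ∀ ω, ENNReal.ofReal (c * (1 + ‖absCentredPath J lam σ (N ω)‖ ^ 2)) * ∫⁻ u, ‖J u‖ₑ ∂(N ω)
      ≤ ENNReal.ofReal (c * C) * (∫⁻ u, ‖J u‖ₑ ∂(N ω)
        + (∫⁻ u, ‖J u‖ₑ ∂(N ω)) * ‖absIntegralPath J (N ω)‖ₑ ^ 2) := fun ω => by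
    have h2 : ENNReal.ofReal (c * (1 + ‖absCentredPath J lam σ (N ω)‖ ^ 2))
        ≤ ENNReal.ofReal (c * C) * (1 + ‖absIntegralPath J (N ω)‖ₑ ^ 2) := by
      rw [one_add_enorm_pow, ← ENNReal.ofReal_mul (by positivity), mul_assoc]
      exact ENNReal.ofReal_le_ofReal (mul_le_mul_of_nonneg_left (hCn _) hc)
    refine (mul_le_mul_left h2 _).trans_eq ?_
    ring
  refine (lintegral_mono h1).trans_lt ?_
  have hSX : Measurable fun ω => (∫⁻ u, ‖J u‖ₑ ∂(N ω)) * ‖absIntegralPath J (N ω)‖ₑ ^ 2 :=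
    hS.mul (hX.pow_const 2)
  have hSS : Measurable fun ω => ∫⁻ u, ‖J u‖ₑ ∂(N ω)
      + (∫⁻ u, ‖J u‖ₑ ∂(N ω)) * ‖absIntegralPath J (N ω)‖ₑ ^ 2 := hS.add hSX
  rw [lintegral_const_mul _ hSS, lintegral_add_left hS, h.lintegral_lintegral hJe]
  exact ENNReal.mul_lt_top ENNReal.ofReal_lt_top (ENNReal.add_lt_top.2 ⟨hJ1, hm.mass_mul_two⟩)

theorem integrable_fderiv (hm : HasPalmMoments P N lam Nu J) (hN : Measurable N)
    (hJ : Measurable J) (hJ1 : ∫⁻ u, ‖J u‖ₑ ∂lam < ∞) (hF : HasBounds F c) (hFm : Measurable F) :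
    Integrable (fun q : Ω × Euc d => fderiv ℝ F (absCentredPath J lam σ (N q.1)) (J q.2))
      (P.prod lam) := by
  have hX : Measurable fun q : Ω × Euc d => absCentredPath J lam σ (N q.1) :=
    (measurable_absCentredPath hJ).comp (hN.comp measurable_fst)
  have hJs : Measurable fun q : Ω × Euc d => J q.2 := hJ.comp measurable_snd
  have hmeas : Measurable fun q : Ω × Euc d =>
      fderiv ℝ F (absCentredPath J lam σ (N q.1)) (J q.2) :=
    (measurable_fderiv_apply hFm hF.differentiable).comp (hX.prodMk hJs)
  refine (((hm.integrable_one_add_norm_pow (σ := σ) hN hJ (by norm_num : 2 ≤ 3)).const_mul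
    c).mul_prod (integrable_norm hJ.aemeasurable hJ1)).mono' hmeas.aestronglyMeasurable
    (Eventually.of_forall fun q => ?_)
  exact (fderiv ℝ F (absCentredPath J lam σ (N q.1))).le_of_opNorm_le (hF.norm_fderiv_le _) _

variable [SigmaFinite lam]

theorem integrable_D2_incr (h : IsReducedPalmCoupling P N lam Nu)
    (hm : HasPalmMoments P N lam Nu J) (hN : Measurable N) (hJ : Measurable J)
    (hJ1 : ∫⁻ u, ‖J u‖ₑ ∂lam < ∞) (hF : HasBounds F c) (hFm : Measurable F) :
    Integrable (fun q => D2 F (absCentredPath J lam σ (N q.1)) (J q.2) (palmIncrement J N Nu q))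
      (P.prod lam) := by
  have hX : Measurable fun q : Ω × Euc d => absCentredPath J lam σ (N q.1) :=
    (measurable_absCentredPath hJ).comp (hN.comp measurable_fst)
  have hJD : Measurable fun q : Ω × Euc d => (J q.2, palmIncrement J N Nu q) :=
    (hJ.comp measurable_snd).prodMk (h.measurable_palmIncrement hN hJ)
  have hmeas : Measurable fun q : Ω × Euc d =>
      D2 F (absCentredPath J lam σ (N q.1)) (J q.2) (palmIncrement J N Nu q) :=
    (measurable_D2_apply hFm hF.differentiable hF.differentiable_fderiv).comp (hX.prodMk hJD)
  refine ((integrable_norm_mul_norm_mul_incr (σ := σ) h hm hN hJ hJ1).const_mul (2 * c)).mono'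
    hmeas.aestronglyMeasurable (Eventually.of_forall fun q => ?_)
  refine (ContinuousLinearMap.le_opNorm₂ _ _ _).trans ?_
  refine (mul_le_mul_of_nonneg_right (mul_le_mul_of_nonneg_right (hF.norm_D2_le _)
    (norm_nonneg _)) (norm_nonneg _)).trans_eq ?_
  ring

/-- Palm's formula turns `E DF(X̃)[X̃]` into the expectation of increments of `DF`, whose first-order
Taylor expansion leaves a remainder of second order in the increment of the path integral. -/
theorem abs_integral_fderiv_sub_le (h : IsReducedPalmCoupling P N lam Nu)
    (hm : HasPalmMoments P N lam Nu J) (hT : 0 ≤ T) (hN : Measurable N) (hJ : Measurable J)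
    (hJ1 : ∫⁻ u, ‖J u‖ₑ ∂lam < ∞) (hσ : 0 < σ) (hF : HasBounds F c) (hFm : Measurable F) {κ : ℝ}
    (hκ : ∀ w x, ‖fderiv ℝ F (w + x) - fderiv ℝ F w - D2 F w x‖ ≤ κ * ‖x‖ ^ 2) :
    Integrable (fun ω => fderiv ℝ F (absCentredPath J lam σ (N ω))
      (absCentredPath J lam σ (N ω))) P ∧
    |(∫ ω, fderiv ℝ F (absCentredPath J lam σ (N ω)) (absCentredPath J lam σ (N ω)) ∂P)
      - (σ ^ 2)⁻¹ * ∫ q, D2 F (absCentredPath J lam σ (N q.1)) (J q.2) (palmIncrement J N Nu q)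
        ∂(P.prod lam)|
      ≤ κ / σ * ((σ ^ 2)⁻¹ * ∫ q, ‖J q.2‖ * ‖palmIncrement J N Nu q‖ ^ 2 ∂(P.prod lam)) := by
  set x : Measure (Euc d) → Cadlag T p := absCentredPath J lam σ with hx
  set D := palmIncrement J N Nu with hD
  have hc := hF.nonneg
  have hxm : Measurable x := measurable_absCentredPath hJ
  have hφ : Measurable fun q : Measure (Euc d) × Cadlag T p => fderiv ℝ F (x q.1) q.2 :=
    (measurable_fderiv_apply hFm hF.differentiable).comp
      ((hxm.comp measurable_fst).prodMk measurable_snd)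
  have hcm : Measurable fun n => c * (1 + ‖x n‖ ^ 2) :=
    (((Cadlag.measurable_norm.comp hxm).pow_const 2).const_add 1).const_mul c
  have hfin := lintegral_fderiv_bound_lt_top (σ := σ) h hm hN hJ hJ1 hc
  obtain ⟨i1, i2, e1⟩ := h.integral_clm hT hN hJ hJ1 (φ := fun n => fderiv ℝ F (x n)) hφ hcm
    (fun n => hF.norm_fderiv_le _) hfin
  -- the mean of the path integral
  have i3 := integrable_fderiv (σ := σ) hm hN hJ hJ1 hF hFm
  have e2 : ∀ ω, fderiv ℝ F (x (N ω)) (integralPath J lam)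
      = ∫ u, fderiv ℝ F (x (N ω)) (J u) ∂lam := fun ω =>
    clm_meanPath hT hJ.aemeasurable hJ1 (fderiv ℝ F (x (N ω)))
  have i4 : Integrable (fun ω => fderiv ℝ F (x (N ω)) (integralPath J lam)) P := by
    simp_rw [e2]
    exact i3.integral_prod_left
  have e3 : ∫ ω, fderiv ℝ F (x (N ω)) (integralPath J lam) ∂P
      = ∫ q, fderiv ℝ F (x (N q.1)) (J q.2) ∂(P.prod lam) := by
    simp_rw [e2]
    exact (integral_prod _ i3).symm
  have e4 : ∀ ω, fderiv ℝ F (x (N ω)) (x (N ω))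
      = σ⁻¹ * (fderiv ℝ F (x (N ω)) (absIntegralPath J (N ω))
        - fderiv ℝ F (x (N ω)) (integralPath J lam)) := fun ω => by
    rw [← map_sub, ← smul_eq_mul, ← map_smul]
    rfl
  have i5 : Integrable (fun ω => fderiv ℝ F (x (N ω)) (x (N ω))) P := by
    simp_rw [e4]
    exact (i1.sub i4).const_mul _
  have e5 : ∫ ω, fderiv ℝ F (x (N ω)) (x (N ω)) ∂P
      = σ⁻¹ * ∫ q, (fderiv ℝ F (x (Nu q.2 q.1 + Measure.dirac q.2)) (J q.2)
        - fderiv ℝ F (x (N q.1)) (J q.2)) ∂(P.prod lam) := by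
    simp_rw [e4]
    rw [integral_const_mul, integral_sub i1 i4, integral_sub i2 i3, e1, e3]
  refine ⟨i5, ?_⟩
  have i6 := integrable_D2_incr (σ := σ) h hm hN hJ hJ1 hF hFm
  have e6 : (∫ ω, fderiv ℝ F (x (N ω)) (x (N ω)) ∂P)
      - (σ ^ 2)⁻¹ * ∫ q, D2 F (x (N q.1)) (J q.2) (D q) ∂(P.prod lam)
      = σ⁻¹ * ∫ q, (fderiv ℝ F (x (Nu q.2 q.1 + Measure.dirac q.2)) (J q.2)
        - fderiv ℝ F (x (N q.1)) (J q.2) - σ⁻¹ * D2 F (x (N q.1)) (J q.2) (D q))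
          ∂(P.prod lam) := by
    have i7 : Integrable (fun q : Ω × Euc d =>
        fderiv ℝ F (x (Nu q.2 q.1 + Measure.dirac q.2)) (J q.2)
        - fderiv ℝ F (x (N q.1)) (J q.2)) (P.prod lam) := i2.sub i3
    have i8 : Integrable (fun q : Ω × Euc d => σ⁻¹ * D2 F (x (N q.1)) (J q.2) (D q))
      (P.prod lam) := i6.const_mul _
    rw [e5, integral_sub i7 i8, integral_const_mul, ← inv_pow]
    ring
  rw [e6, abs_mul, abs_of_pos (inv_pos.2 hσ)]
  have hb : ∀ q : Ω × Euc d, ‖fderiv ℝ F (x (Nu q.2 q.1 + Measure.dirac q.2)) (J q.2)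
        - fderiv ℝ F (x (N q.1)) (J q.2) - σ⁻¹ * D2 F (x (N q.1)) (J q.2) (D q)‖
      ≤ κ * (σ ^ 2)⁻¹ * (‖J q.2‖ * ‖D q‖ ^ 2) := fun q => by
    have e7 : x (Nu q.2 q.1 + Measure.dirac q.2) = x (N q.1) + σ⁻¹ • D q := by
      simp only [hx, hD, absCentredPath, palmIncrement]
      rw [← smul_add]
      congr 1
      abel
    have e8 : σ⁻¹ * D2 F (x (N q.1)) (J q.2) (D q) = D2 F (x (N q.1)) (σ⁻¹ • D q) (J q.2) := by
      rw [D2_symm hF.differentiable hF.differentiable_fderiv _ (σ⁻¹ • D q), map_smul, smul_eq_mul]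
    rw [e7, e8]
    have h1 := (fderiv ℝ F (x (N q.1) + σ⁻¹ • D q) - fderiv ℝ F (x (N q.1))
      - D2 F (x (N q.1)) (σ⁻¹ • D q)).le_of_opNorm_le (hκ _ _) (J q.2)
    refine h1.trans_eq ?_
    rw [norm_smul, Real.norm_of_nonneg (inv_pos.2 hσ).le]
    ring
  have i9 := integrable_norm_mul_incr_sq h hm hN hJ
  have h2 := norm_integral_le_of_norm_le (i9.const_mul (κ * (σ ^ 2)⁻¹)) (Eventually.of_forall hb)
  rw [Real.norm_eq_abs, integral_const_mul] at h2
  refine (mul_le_mul_of_nonneg_left h2 (inv_pos.2 hσ).le).trans_eq ?_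
  rw [div_eq_mul_inv]
  ring

end IsReducedPalmCoupling.HasPalmMoments

end Expansion


/-! ### The expected increment of the path integral -/

section MeanPath

open Cadlag

variable {T : ℝ} {p : ℕ} {Ω : Type*} [MeasurableSpace Ω] {P : Measure Ω}

theorem meanPath_congr {Y Y' : Ω → Cadlag T p} (h : Y =ᵐ[P] Y') : meanPath P Y = meanPath P Y' := by
  have e : (fun s => ∫ ω, (Y ω).path s ∂P) = fun s => ∫ ω, (Y' ω).path s ∂P := by
    funext s
    exact integral_congr_ae (h.mono fun ω hω => by simp only [hω])
  exact congrArg toCadlag e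

theorem meanPath_sub_const [IsProbabilityMeasure P] {Y : Ω → Cadlag T p} (hY : Measurable Y)
    (hint : ∫⁻ ω, ‖Y ω‖ₑ ∂P < ∞) (x : Cadlag T p) :
    ∫⁻ ω, ‖Y ω - x‖ₑ ∂P < ∞ ∧ meanPath P (fun ω => Y ω - x) = meanPath P Y - x := by
  have h1 : ∫⁻ ω, ‖Y ω - x‖ₑ ∂P < ∞ := by
    refine (lintegral_mono fun ω => enorm_sub_le).trans_lt ?_
    rw [lintegral_add_right _ measurable_const, lintegral_const, measure_univ, mul_one]
    exact ENNReal.add_lt_top.2 ⟨hint, enorm_lt_top⟩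
  have hYx : Measurable fun ω => Y ω - x := hY.sub measurable_const
  refine ⟨h1, ext fun s => ?_⟩
  rw [Cadlag.sub_apply, path_meanPath hY.aemeasurable hint,
    path_meanPath hYx.aemeasurable h1]
  simp_rw [Cadlag.sub_apply]
  rw [integral_sub (integrable_path hY.aemeasurable hint s) (integrable_const _)]
  simp

end MeanPath

section MeanIncrement

open Cadlag

variable {T : ℝ} {p d : ℕ} {Ω : Type*} [MeasurableSpace Ω] {P : Measure Ω}
  {N : Ω → Measure (Euc d)} {lam : Measure (Euc d)}
  {Nu : Euc d → Ω → Measure (Euc d)} {J : Euc d → Cadlag T p} {σ : ℝ} {F : Cadlag T p → ℝ} {c : ℝ}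

open Classical in
/-- The expected increment `E[Xᵘ - X + J_u]`, set to `0` if the norm of the increment is not
integrable, which makes it a measurable function of `u`. -/
noncomputable def meanIncrement (P : Measure Ω) (J : Euc d → Cadlag T p) (N : Ω → Measure (Euc d))
    (Nu : Euc d → Ω → Measure (Euc d)) (u : Euc d) : Cadlag T p :=
  if ∫⁻ ω, ‖palmIncrement J N Nu (ω, u)‖ₑ ∂P < ∞ then
    meanPath P fun ω => palmIncrement J N Nu (ω, u) else 0

theorem meanIncrement_eq {u : Euc d} (h : ∫⁻ ω, ‖palmIncrement J N Nu (ω, u)‖ₑ ∂P < ∞) :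
    meanIncrement P J N Nu u = meanPath P fun ω => palmIncrement J N Nu (ω, u) := if_pos h

namespace IsReducedPalmCoupling

theorem measurable_palmIncrement_right (h : IsReducedPalmCoupling P N lam Nu) (hN : Measurable N)
    (hJ : Measurable J) (u : Euc d) : Measurable fun ω => palmIncrement J N Nu (ω, u) :=
  (h.measurable_palmIncrement hN hJ).comp measurable_prodMk_right

theorem measurable_meanIncrement [SFinite P] (h : IsReducedPalmCoupling P N lam Nu)
    (hN : Measurable N) (hJ : Measurable J) : Measurable (meanIncrement P J N Nu) := by
  classical
  have hD := h.measurable_palmIncrement hN hJ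
  have hDe : Measurable fun q => ‖palmIncrement J N Nu q‖ₑ := Cadlag.measurable_enorm.comp hD
  have hG : MeasurableSet {u : Euc d | ∫⁻ ω, ‖palmIncrement J N Nu (ω, u)‖ₑ ∂P < ∞} :=
    measurableSet_lt hDe.lintegral_prod_left' measurable_const
  refine measurable_iff.2 fun s => ?_
  have hDs : Measurable fun q => (palmIncrement J N Nu q).path s := (measurable_eval s).comp hD
  have hv : Measurable fun u : Euc d => ∫ ω, (palmIncrement J N Nu (ω, u)).path s ∂P :=
    hDs.stronglyMeasurable.integral_prod_left'.measurable
  suffices e : (fun u => (meanIncrement P J N Nu u).path s) = fun u : Euc d =>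
      if u ∈ {u : Euc d | ∫⁻ ω, ‖palmIncrement J N Nu (ω, u)‖ₑ ∂P < ∞} then
        ∫ ω, (palmIncrement J N Nu (ω, u)).path s ∂P else 0 by
    rw [e]
    exact Measurable.ite hG hv measurable_const
  funext u
  by_cases hu : ∫⁻ ω, ‖palmIncrement J N Nu (ω, u)‖ₑ ∂P < ∞
  · refine Eq.trans ?_ (if_pos (c := u ∈ {u : Euc d |
      ∫⁻ ω, ‖palmIncrement J N Nu (ω, u)‖ₑ ∂P < ∞}) hu).symm
    rw [meanIncrement_eq hu, path_meanPath (h.measurable_palmIncrement_right hN hJ u).aemeasurable hu]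
  · refine Eq.trans ?_ (if_neg (c := u ∈ {u : Euc d |
      ∫⁻ ω, ‖palmIncrement J N Nu (ω, u)‖ₑ ∂P < ∞}) hu).symm
    rw [meanIncrement, if_neg hu]
    rfl

theorem enorm_meanIncrement_le (h : IsReducedPalmCoupling P N lam Nu) (hN : Measurable N)
    (hJ : Measurable J) (u : Euc d) :
    ‖meanIncrement P J N Nu u‖ₑ ≤ ∫⁻ ω, ‖palmIncrement J N Nu (ω, u)‖ₑ ∂P := by
  by_cases hu : ∫⁻ ω, ‖palmIncrement J N Nu (ω, u)‖ₑ ∂P < ∞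
  · rw [meanIncrement_eq hu]
    exact enorm_meanPath_le (h.measurable_palmIncrement_right hN hJ u).aemeasurable hu
  · rw [meanIncrement, if_neg hu, enorm_zero]
    exact zero_le

variable [IsProbabilityMeasure P] [SigmaFinite lam]

namespace HasPalmMoments

theorem lintegral_enorm_mul_lintegral_incr_lt_top (h : IsReducedPalmCoupling P N lam Nu)
    (hm : HasPalmMoments P N lam Nu J) (hN : Measurable N) (hJ : Measurable J) :
    ∫⁻ u, ‖J u‖ₑ * ∫⁻ ω, ‖palmIncrement J N Nu (ω, u)‖ₑ ∂P ∂lam < ∞ := by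
  have hJe : Measurable fun q : Ω × Euc d => ‖J q.2‖ₑ :=
    Cadlag.measurable_enorm.comp (hJ.comp measurable_snd)
  have hDe : Measurable fun q => ‖palmIncrement J N Nu q‖ₑ :=
    Cadlag.measurable_enorm.comp (h.measurable_palmIncrement hN hJ)
  have hJD : Measurable fun q : Ω × Euc d => ‖J q.2‖ₑ * ‖palmIncrement J N Nu q‖ₑ := hJe.mul hDe
  have h1 := hm.incr_one
  rw [lintegral_prod_symm _ hJD.aemeasurable] at h1
  refine lt_of_le_of_lt (lintegral_mono fun u => ?_) h1
  exact (lintegral_const_mul _ (hDe.comp measurable_prodMk_right)).ge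

theorem ae_lintegral_incr_lt_top (h : IsReducedPalmCoupling P N lam Nu)
    (hm : HasPalmMoments P N lam Nu J) (hN : Measurable N) (hJ : Measurable J) :
    ∀ᵐ u ∂lam, J u ≠ 0 → ∫⁻ ω, ‖palmIncrement J N Nu (ω, u)‖ₑ ∂P < ∞ := by
  have hJe : Measurable fun u => ‖J u‖ₑ := Cadlag.measurable_enorm.comp hJ
  have hDe : Measurable fun q => ‖palmIncrement J N Nu q‖ₑ :=
    Cadlag.measurable_enorm.comp (h.measurable_palmIncrement hN hJ)
  filter_upwards [ae_lt_top (hJe.mul hDe.lintegral_prod_left')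
    (lintegral_enorm_mul_lintegral_incr_lt_top h hm hN hJ).ne] with u hu hJu
  exact ENNReal.lt_top_of_mul_ne_top_right hu.ne (enorm_ne_zero.2 hJu)

/-- For almost every `u` with `J_u ≠ 0` the expected increments `E[Xᵘ - X]` and `E[Xᵘ - X + J_u]`
exist; the latter agrees with `meanIncrement`. -/
theorem ae_meanPath (h : IsReducedPalmCoupling P N lam Nu)
    (hm : HasPalmMoments P N lam Nu J) (hN : Measurable N) (hJ : Measurable J)
    (hJ1 : ∫⁻ u, ‖J u‖ₑ ∂lam < ∞) :
    ∀ᵐ u ∂lam, J u ≠ 0 →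
      ((∀ s, Integrable (fun ω => (integralPath J (Nu u ω) - integralPath J (N ω)).path s) P) ∧
        IsCadlag fun s => ∫ ω, (integralPath J (Nu u ω) - integralPath J (N ω)).path s ∂P) ∧
      meanPath P (fun ω => integralPath J (Nu u ω) - integralPath J (N ω) + J u)
        = meanIncrement P J N Nu u ∧
      meanPath P (fun ω => integralPath J (Nu u ω) - integralPath J (N ω))
        = meanIncrement P J N Nu u - J u := by
  have h1 : ∀ᵐ u ∂lam, ∀ᵐ ω ∂P, integralPath J (Nu u ω) - integralPath J (N ω) + J u
      = palmIncrement J N Nu (ω, u) := by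
    have h2 : ∀ᵐ q ∂(lam.prod P), integralPath J (Nu q.1 q.2) - integralPath J (N q.2) + J q.1
        = palmIncrement J N Nu q.swap :=
      (Measure.measurePreserving_swap (μ := lam) (ν := P)).quasiMeasurePreserving.ae
        (h.ae_palmIncrement_eq hN hJ hJ1)
    exact Measure.ae_ae_of_ae_prod h2
  filter_upwards [h1, ae_lintegral_incr_lt_top h hm hN hJ] with u hu hu2 hJu
  have hfin := hu2 hJu
  have hDm := h.measurable_palmIncrement_right hN hJ (J := J) u
  obtain ⟨h3, h4⟩ := meanPath_sub_const hDm hfin (J u)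
  have e : (fun ω => integralPath J (Nu u ω) - integralPath J (N ω))
      =ᵐ[P] fun ω => palmIncrement J N Nu (ω, u) - J u := by
    filter_upwards [hu] with ω hω
    rw [← hω, add_sub_cancel_right]
  have hYm : AEMeasurable (fun ω => integralPath J (Nu u ω) - integralPath J (N ω)) P :=
    (hDm.sub measurable_const).aemeasurable.congr e.symm
  have hYfin : ∫⁻ ω, ‖integralPath J (Nu u ω) - integralPath J (N ω)‖ₑ ∂P < ∞ := by
    have e' : ∫⁻ ω, ‖integralPath J (Nu u ω) - integralPath J (N ω)‖ₑ ∂P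
        = ∫⁻ ω, ‖palmIncrement J N Nu (ω, u) - J u‖ₑ ∂P :=
      lintegral_congr_ae (e.mono fun ω hω => congrArg enorm hω)
    rwa [e']
  refine ⟨⟨fun s => integrable_path hYm hYfin s, isCadlag_integral hYm hYfin⟩, ?_, ?_⟩
  · rw [meanIncrement_eq hfin]
    exact meanPath_congr hu
  · rw [meanPath_congr e, h4, meanIncrement_eq hfin]

theorem integrable_D2_mean (h : IsReducedPalmCoupling P N lam Nu)
    (hm : HasPalmMoments P N lam Nu J) (hN : Measurable N) (hJ : Measurable J)
    (hF : HasBounds F c) (hFm : Measurable F) :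
    Integrable (fun q : Ω × Euc d => D2 F (absCentredPath J lam σ (N q.1)) (J q.2)
      (meanIncrement P J N Nu q.2)) (P.prod lam) := by
  have hM := h.measurable_meanIncrement hN hJ
  have hX : Measurable fun q : Ω × Euc d => absCentredPath J lam σ (N q.1) :=
    (measurable_absCentredPath hJ).comp (hN.comp measurable_fst)
  have hJM : Measurable fun q : Ω × Euc d => (J q.2, meanIncrement P J N Nu q.2) :=
    (hJ.comp measurable_snd).prodMk (hM.comp measurable_snd)
  have hmeas : Measurable fun q : Ω × Euc d => D2 F (absCentredPath J lam σ (N q.1)) (J q.2)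
      (meanIncrement P J N Nu q.2) :=
    (measurable_D2_apply hFm hF.differentiable hF.differentiable_fderiv).comp (hX.prodMk hJM)
  have i1 : Integrable (fun u => ‖J u‖ * ‖meanIncrement P J N Nu u‖) lam := by
    have hJn : Measurable fun u => ‖J u‖ := Cadlag.measurable_norm.comp hJ
    refine ⟨(hJn.mul (Cadlag.measurable_norm.comp hM)).aestronglyMeasurable, ?_⟩
    refine lt_of_le_of_lt (lintegral_mono fun u => ?_)
      (lintegral_enorm_mul_lintegral_incr_lt_top h hm hN hJ)
    rw [enorm_mul, enorm_norm, enorm_norm]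
    gcongr
    exact h.enorm_meanIncrement_le hN hJ u
  have i2 := ((hm.integrable_one_add_norm_pow (σ := σ) hN hJ (by norm_num : 1 ≤ 3)).const_mul
    (2 * c)).mul_prod i1
  refine i2.mono' hmeas.aestronglyMeasurable (Eventually.of_forall fun q => ?_)
  refine (ContinuousLinearMap.le_opNorm₂ _ _ _).trans ?_
  refine (mul_le_mul_of_nonneg_right (mul_le_mul_of_nonneg_right (hF.norm_D2_le _)
    (norm_nonneg _)) (norm_nonneg _)).trans_eq ?_
  rw [pow_one]
  ring

/-- The integrands of the two second-order terms of the bound agree almost everywhere with the terms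
of the decomposition of the increment into its expectation and a centred part. -/
theorem ae_D2_eq (h : IsReducedPalmCoupling P N lam Nu)
    (hm : HasPalmMoments P N lam Nu J) (hN : Measurable N) (hJ : Measurable J)
    (hJ1 : ∫⁻ u, ‖J u‖ₑ ∂lam < ∞) (F : Cadlag T p → ℝ) :
    ∀ᵐ q ∂(P.prod lam),
      D2 F (centredPath J lam σ (N q.1)) (J q.2)
          (meanPath P fun ω => integralPath J (Nu q.2 ω) - integralPath J (N ω) + J q.2)
        = D2 F (absCentredPath J lam σ (N q.1)) (J q.2) (meanIncrement P J N Nu q.2) ∧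
      D2 F (centredPath J lam σ (N q.1)) (J q.2)
          ((integralPath J (Nu q.2 q.1) - integralPath J (N q.1))
            - meanPath P fun ω => integralPath J (Nu q.2 ω) - integralPath J (N ω))
        = D2 F (absCentredPath J lam σ (N q.1)) (J q.2) (palmIncrement J N Nu q)
          - D2 F (absCentredPath J lam σ (N q.1)) (J q.2) (meanIncrement P J N Nu q.2) := by
  have h1 : ∀ᵐ q : Ω × Euc d ∂(P.prod lam), ∫⁻ u, ‖J u‖ₑ ∂(N q.1) < ∞ :=
    Measure.quasiMeasurePreserving_fst.ae (h.ae_lintegral_lt_top hN hJ hJ1)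
  have h2 := Measure.quasiMeasurePreserving_snd (μ := P) (ν := lam) |>.ae
    (ae_meanPath h hm hN hJ hJ1)
  filter_upwards [h1, h2, h.ae_palmIncrement_eq hN hJ hJ1] with q hq1 hq2 hq3
  rw [centredPath_eq hJ hJ1 hq1]
  by_cases hJq : J q.2 = 0
  · have h0 : ∀ y, D2 F (absCentredPath J lam σ (N q.1)) (J q.2) y = 0 := fun y => by
      rw [hJq, map_zero]; rfl
    exact ⟨by rw [h0, h0], by rw [h0, h0, h0, sub_zero]⟩
  · obtain ⟨-, e1, e2⟩ := hq2 hJq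
    rw [e1, e2, ← hq3]
    refine ⟨rfl, ?_⟩
    rw [← map_sub]
    congr 1
    abel

end HasPalmMoments

end IsReducedPalmCoupling

end MeanIncrement


/-! ### The bound for couplings with the reduced Palm measures -/

section GeneralBound

open Cadlag

variable {T : ℝ} {p d : ℕ} {Ω : Type*} [MeasurableSpace Ω] {P : Measure Ω}
  [IsProbabilityMeasure P] {N : Ω → Measure (Euc d)} {lam : Measure (Euc d)}
  {Nu : Euc d → Ω → Measure (Euc d)} {J Jhat : Euc d → Cadlag T p} {Lam : Measure (Euc d)}
  {γ : Measure (Cadlag T p)} {σ : ℝ} {g : Cadlag T p → ℝ} {c : ℝ}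

namespace IsReducedPalmCoupling

namespace HasPalmMoments

theorem integrable_comp_centredPath (h : IsReducedPalmCoupling P N lam Nu)
    (hm : HasPalmMoments P N lam Nu J) (hN : Measurable N) (hJ : Measurable J)
    (hJ1 : ∫⁻ u, ‖J u‖ₑ ∂lam < ∞) (hg : HasBounds g c) (hgm : Measurable g) :
    Integrable (fun ω => g (centredPath J lam σ (N ω))) P := by
  have h1 : Integrable (fun ω => g (absCentredPath J lam σ (N ω))) P :=
    ((hm.integrable_one_add_norm_pow (σ := σ) hN hJ le_rfl).const_mul c).mono'
      (hgm.comp ((measurable_absCentredPath hJ).comp hN)).aestronglyMeasurable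
      (Eventually.of_forall fun ω => hg.abs_le _)
  refine h1.congr ?_
  filter_upwards [h.ae_lintegral_lt_top hN hJ hJ1] with ω hω
  rw [centredPath_eq hJ hJ1 hω]

theorem integrable_integral_D2 [IsProbabilityMeasure γ] (hm : HasPalmMoments P N lam Nu J)
    (hN : Measurable N)
    (hJ : Measurable J) (hγ : Integrable (fun z => ‖z‖ ^ 3) γ) (hg : HasBounds g c)
    (hgm : Measurable g) :
    Integrable (fun ω => ∫ z, D2 g (absCentredPath J lam σ (N ω)) z z ∂γ) P := by
  have hX : Measurable fun q : Ω × Cadlag T p => absCentredPath J lam σ (N q.1) :=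
    (measurable_absCentredPath hJ).comp (hN.comp measurable_fst)
  have hzz : Measurable fun q : Ω × Cadlag T p => (q.2, q.2) := measurable_snd.prodMk measurable_snd
  have hmeas : Measurable fun q : Ω × Cadlag T p =>
      D2 g (absCentredPath J lam σ (N q.1)) q.2 q.2 :=
    (measurable_D2_apply hgm hg.differentiable hg.differentiable_fderiv).comp (hX.prodMk hzz)
  have i2 : Integrable (fun z : Cadlag T p => ‖z‖ ^ 2) γ := by
    refine ((integrable_const 1).add hγ).mono'
      (Cadlag.measurable_norm.pow_const 2).aestronglyMeasurable (Eventually.of_forall fun z => ?_)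
    rw [Real.norm_of_nonneg (by positivity)]
    change ‖z‖ ^ 2 ≤ 1 + ‖z‖ ^ 3
    have hz : 0 ≤ ‖z‖ := norm_nonneg z
    nlinarith [sq_nonneg (‖z‖ - 1), mul_nonneg hz (sq_nonneg (‖z‖ - 1))]
  have i1 := (hm.integrable_one_add_norm_pow (σ := σ) hN hJ (by norm_num : 1 ≤ 3)).const_mul (2 * c)
  refine (((i1.mul_prod i2).mono' hmeas.aestronglyMeasurable
    (Eventually.of_forall fun q => ?_)).integral_prod_left :)
  refine (ContinuousLinearMap.le_opNorm₂ _ _ _).trans ?_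
  refine (mul_le_mul_of_nonneg_right (mul_le_mul_of_nonneg_right (hg.norm_D2_le _)
    (norm_nonneg _)) (norm_nonneg _)).trans_eq ?_
  rw [pow_one]
  ring

end HasPalmMoments

variable [SigmaFinite lam]

/-- The last term of the bound in terms of `palmIncrement`. -/
theorem lintegral_incr_sq_eq (h : IsReducedPalmCoupling P N lam Nu) (hN : Measurable N)
    (hJ : Measurable J) (hJ1 : ∫⁻ u, ‖J u‖ₑ ∂lam < ∞) (a : ℝ≥0∞) :
    ∫⁻ ω, ∫⁻ u, ‖J u‖ₑ * ‖integralPath J (Nu u ω) - integralPath J (N ω) + J u‖ₑ ^ 2 ∂(a • lam) ∂P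
      = a * ∫⁻ q, ‖J q.2‖ₑ * ‖palmIncrement J N Nu q‖ₑ ^ 2 ∂(P.prod lam) := by
  have hJe : Measurable fun q : Ω × Euc d => ‖J q.2‖ₑ :=
    Cadlag.measurable_enorm.comp (hJ.comp measurable_snd)
  have hDe : Measurable fun q => ‖palmIncrement J N Nu q‖ₑ :=
    Cadlag.measurable_enorm.comp (h.measurable_palmIncrement hN hJ)
  have hJD : Measurable fun q : Ω × Euc d => ‖J q.2‖ₑ * ‖palmIncrement J N Nu q‖ₑ ^ 2 :=
    hJe.mul (hDe.pow_const 2)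
  rw [lintegral_prod _ hJD.aemeasurable, ← lintegral_const_mul _ hJD.lintegral_prod_right']
  refine lintegral_congr_ae ?_
  filter_upwards [Measure.ae_ae_of_ae_prod (h.ae_palmIncrement_eq hN hJ hJ1)] with ω hω
  rw [lintegral_smul_measure, smul_eq_mul]
  congr 1
  refine lintegral_congr_ae (hω.mono fun u hu => ?_)
  simp only at hu ⊢
  rw [hu]

variable [IsProbabilityMeasure γ]

namespace HasPalmMoments

/-- The Stein equation at `X̃`, combined with the expansion of `E DF(X̃)[X̃]` and the isometry
`E D²F(w)[Z,Z] = ∫ D²F(w)[Ĵ_u,Ĵ_u] Λ(du)`. -/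
theorem stein_bound (h : IsReducedPalmCoupling P N lam Nu)
    (hm : HasPalmMoments P N lam Nu J) (hT : 0 ≤ T) (hN : Measurable N) (hJ : Measurable J)
    (hJ1 : ∫⁻ u, ‖J u‖ₑ ∂lam < ∞) (hσ : 0 < σ) (hJhat : Measurable Jhat)
    (hJhat2 : ∀ s, MemLp (fun u => (Jhat u).path s) 2 Lam) (hγ : IsGaussianPathLaw γ Jhat Lam)
    (hg : HasBounds g c) (hgm : Measurable g) {f : Cadlag T p → ℝ}
    (hf : f = steinSolution γ id g) {slam : Measure (Euc d)}
    (hslam : slam = ENNReal.ofReal ((σ ^ 2)⁻¹) • lam) :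
    Integrable (fun ω => ∫ u, D2 f (centredPath J lam σ (N ω)) (Jhat u) (Jhat u) ∂Lam) P ∧
    Integrable (fun q : Ω × Euc d => D2 f (centredPath J lam σ (N q.1)) (J q.2)
      (meanPath P fun ω => integralPath J (Nu q.2 ω) - integralPath J (N ω) + J q.2))
      (P.prod slam) ∧
    Integrable (fun q : Ω × Euc d => D2 f (centredPath J lam σ (N q.1)) (J q.2)
      ((integralPath J (Nu q.2 q.1) - integralPath J (N q.1))
        - meanPath P fun ω => integralPath J (Nu q.2 ω) - integralPath J (N ω))) (P.prod slam) ∧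
    |(∫ ω, g (centredPath J lam σ (N ω)) ∂P) - ∫ z, g z ∂γ|
      ≤ |∫ ω, ((∫ u, D2 f (centredPath J lam σ (N ω)) (Jhat u) (Jhat u) ∂Lam)
          - ∫ u, D2 f (centredPath J lam σ (N ω)) (J u)
            (meanPath P fun ω' => integralPath J (Nu u ω') - integralPath J (N ω') + J u) ∂slam) ∂P|
        + |∫ ω, ∫ u, D2 f (centredPath J lam σ (N ω)) (J u)
            ((integralPath J (Nu u ω) - integralPath J (N ω))
              - meanPath P fun ω' => integralPath J (Nu u ω') - integralPath J (N ω')) ∂slam ∂P|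
        + c / 3 / σ * ((σ ^ 2)⁻¹
          * ∫ q, ‖J q.2‖ * ‖palmIncrement J N Nu q‖ ^ 2 ∂(P.prod lam)) := by
  have hγ3 := hγ.integrable_norm_pow_three hT
  obtain ⟨⟨c', hfb⟩, hκ⟩ := hg.steinSolution_hasBounds hgm hγ3
  have hstein := hg.stein_equation hT hgm hγ3 (fun a b hab => hγ.map_add_smul_prod hab)
  have hfm : Measurable (steinSolution γ id g) := measurable_steinSolution hgm
  rw [← hf] at hfb hκ hfm hstein
  have hsymm := D2_symm hfb.differentiable hfb.differentiable_fderiv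
  have hXt : ∀ᵐ ω ∂P, centredPath J lam σ (N ω) = absCentredPath J lam σ (N ω) :=
    (h.ae_lintegral_lt_top hN hJ hJ1).mono fun ω hω => centredPath_eq hJ hJ1 hω
  -- the four integrals
  have iZ := hm.integrable_integral_D2 (σ := σ) (γ := γ) hN hJ hγ3 hfb hfm
  have eZ : ∀ ω, ∫ u, D2 f (absCentredPath J lam σ (N ω)) (Jhat u) (Jhat u) ∂Lam
      = ∫ z, D2 f (absCentredPath J lam σ (N ω)) z z ∂γ := fun ω =>
    (hγ.integral_bilin hT hJhat hJhat2 (hsymm _)).2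
  have eZ' : ∀ᵐ ω ∂P, ∫ u, D2 f (centredPath J lam σ (N ω)) (Jhat u) (Jhat u) ∂Lam
      = ∫ z, D2 f (absCentredPath J lam σ (N ω)) z z ∂γ := by
    filter_upwards [hXt] with ω hω
    rw [hω, eZ]
  have iM := integrable_D2_mean (σ := σ) h hm hN hJ hfb hfm
  have iD := integrable_D2_incr (σ := σ) h hm hN hJ hJ1 hfb hfm
  obtain ⟨iA, hA⟩ := abs_integral_fderiv_sub_le (σ := σ) h hm hT hN hJ hJ1 hσ hfb hfm hκ
  have hae := ae_D2_eq (σ := σ) h hm hN hJ hJ1 f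
  have hprod : P.prod slam = ENNReal.ofReal ((σ ^ 2)⁻¹) • P.prod lam := by
    rw [hslam]; exact Measure.prod_smul_right _
  have hs0 : (ENNReal.ofReal ((σ ^ 2)⁻¹)).toReal = (σ ^ 2)⁻¹ := ENNReal.toReal_ofReal (by positivity)
  have iM' : Integrable (fun q : Ω × Euc d => D2 f (centredPath J lam σ (N q.1)) (J q.2)
      (meanPath P fun ω => integralPath J (Nu q.2 ω) - integralPath J (N ω) + J q.2))
      (P.prod lam) := iM.congr (hae.mono fun q hq => hq.1.symm)
  have iC' : Integrable (fun q : Ω × Euc d => D2 f (centredPath J lam σ (N q.1)) (J q.2)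
      ((integralPath J (Nu q.2 q.1) - integralPath J (N q.1))
        - meanPath P fun ω => integralPath J (Nu q.2 ω) - integralPath J (N ω))) (P.prod lam) :=
    (iD.sub iM).congr (hae.mono fun q hq => hq.2.symm)
  have iMs := iM'.smul_measure (c := ENNReal.ofReal ((σ ^ 2)⁻¹)) ENNReal.ofReal_ne_top
  have iCs := iC'.smul_measure (c := ENNReal.ofReal ((σ ^ 2)⁻¹)) ENNReal.ofReal_ne_top
  rw [← hprod] at iMs iCs
  have iZ' : Integrable (fun ω => ∫ u, D2 f (centredPath J lam σ (N ω)) (Jhat u) (Jhat u) ∂Lam) P :=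
    iZ.congr (eZ'.mono fun ω hω => hω.symm)
  refine ⟨iZ', iMs, iCs, ?_⟩
  have hsf : SFinite slam := by rw [hslam]; infer_instance
  -- the first two terms of the bound, as integrals over the product space
  have e1 : ∫ ω, ((∫ u, D2 f (centredPath J lam σ (N ω)) (Jhat u) (Jhat u) ∂Lam)
          - ∫ u, D2 f (centredPath J lam σ (N ω)) (J u)
            (meanPath P fun ω' => integralPath J (Nu u ω') - integralPath J (N ω') + J u) ∂slam) ∂P
      = (∫ ω, ∫ z, D2 f (absCentredPath J lam σ (N ω)) z z ∂γ ∂P)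
        - (σ ^ 2)⁻¹ * ∫ q, D2 f (absCentredPath J lam σ (N q.1)) (J q.2)
            (meanIncrement P J N Nu q.2) ∂(P.prod lam) := by
    rw [integral_sub iZ' iMs.integral_prod_left, integral_congr_ae eZ']
    congr 1
    have e := integral_prod _ iMs
    refine e.symm.trans ?_
    rw [hprod, integral_smul_measure, hs0, smul_eq_mul]
    congr 1
    exact integral_congr_ae (hae.mono fun q hq => hq.1)
  have e2 : ∫ ω, ∫ u, D2 f (centredPath J lam σ (N ω)) (J u)
            ((integralPath J (Nu u ω) - integralPath J (N ω))
              - meanPath P fun ω' => integralPath J (Nu u ω') - integralPath J (N ω')) ∂slam ∂P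
      = (σ ^ 2)⁻¹ * ((∫ q, D2 f (absCentredPath J lam σ (N q.1)) (J q.2) (palmIncrement J N Nu q)
          ∂(P.prod lam)) - ∫ q, D2 f (absCentredPath J lam σ (N q.1)) (J q.2)
            (meanIncrement P J N Nu q.2) ∂(P.prod lam)) := by
    have e := integral_prod _ iCs
    refine e.symm.trans ?_
    rw [hprod, integral_smul_measure, hs0, smul_eq_mul, ← integral_sub iD iM]
    congr 1
    exact integral_congr_ae (hae.mono fun q hq => hq.2)
  -- the Stein equation
  have ig := integrable_comp_centredPath (σ := σ) h hm hN hJ hJ1 hg hgm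
  have e3 : (∫ ω, g (centredPath J lam σ (N ω)) ∂P) - ∫ z, g z ∂γ
      = -(∫ ω, fderiv ℝ f (absCentredPath J lam σ (N ω)) (absCentredPath J lam σ (N ω)) ∂P)
        + ∫ ω, ∫ z, D2 f (absCentredPath J lam σ (N ω)) z z ∂γ ∂P := by
    have iA' : Integrable (fun ω => -fderiv ℝ f (absCentredPath J lam σ (N ω))
      (absCentredPath J lam σ (N ω))) P := iA.neg
    rw [← integral_neg, ← integral_add iA' iZ]
    have e4 : (∫ ω, g (centredPath J lam σ (N ω)) ∂P) - ∫ z, g z ∂γ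
        = ∫ ω, (g (centredPath J lam σ (N ω)) - ∫ z, g z ∂γ) ∂P := by
      rw [integral_sub ig (integrable_const _)]
      simp
    rw [e4]
    refine integral_congr_ae (hXt.mono fun ω hω => ?_)
    simp only [hω, hstein]
  rw [e1, e2, e3]
  set A := ∫ ω, fderiv ℝ f (absCentredPath J lam σ (N ω)) (absCentredPath J lam σ (N ω)) ∂P
  set E2 := ∫ ω, ∫ z, D2 f (absCentredPath J lam σ (N ω)) z z ∂γ ∂P
  set B := ∫ q, D2 f (absCentredPath J lam σ (N q.1)) (J q.2) (palmIncrement J N Nu q) ∂(P.prod lam)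
  set B1 := ∫ q, D2 f (absCentredPath J lam σ (N q.1)) (J q.2) (meanIncrement P J N Nu q.2)
    ∂(P.prod lam)
  have e5 : -A + E2 = (E2 - (σ ^ 2)⁻¹ * B1) + (-((σ ^ 2)⁻¹ * (B - B1))) + (-(A - (σ ^ 2)⁻¹ * B)) := by
    ring
  rw [e5]
  refine (abs_add_three _ _ _).trans ?_
  rw [abs_neg, abs_neg]
  gcongr

end HasPalmMoments

end IsReducedPalmCoupling

end GeneralBound


/-! ### Mecke's formula for Poisson processes -/

section Cylinders

variable {α : Type*} [MeasurableSpace α]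

/-- The sets of measures determined by the masses of the cells of a finite measurable partition; the
partition is given as the fibres of a map `l` to `Fin m`. -/
def IsPartitionCylinder (S : Set (Measure α)) : Prop :=
  ∃ (m : ℕ) (l : α → Fin m) (E : Set (Fin m → ℝ≥0∞)), Measurable l ∧ MeasurableSet E ∧
    S = {n | (fun b => n (l ⁻¹' {b})) ∈ E}

theorem measurable_cells {m : ℕ} {l : α → Fin m} (hl : Measurable l) :
    Measurable fun n : Measure α => fun b => n (l ⁻¹' {b}) :=
  measurable_pi_lambda _ fun b => Measure.measurable_coe (hl (measurableSet_singleton b))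

/-- The masses of the cells of a coarser partition are measurable functions of those of a finer
one. -/
theorem exists_measurable_cells_eq {m k : ℕ} {l : α → Fin m} {l' : α → Fin k} (hl' : Measurable l')
    (c : Fin k → Fin m) (hc : ∀ x, c (l' x) = l x) :
    ∃ G : (Fin k → ℝ≥0∞) → Fin m → ℝ≥0∞, Measurable G ∧
      ∀ n : Measure α, (fun b => n (l ⁻¹' {b})) = G fun b => n (l' ⁻¹' {b}) := by
  classical
  refine ⟨fun v b => ∑ b' with c b' = b, v b', ?_, fun n => ?_⟩
  · exact measurable_pi_lambda _ fun b => Finset.measurable_sum _ fun b' _ => measurable_pi_apply b'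
  · funext b
    change _ = ∑ b' with c b' = b, n (l' ⁻¹' {b'})
    rw [sum_measure_preimage_singleton _ fun y _ => hl' (measurableSet_singleton y)]
    congr 1
    ext x
    simp [hc]

theorem isPiSystem_isPartitionCylinder : IsPiSystem {S : Set (Measure α) | IsPartitionCylinder S} := by
  rintro _ ⟨m, l, E, hl, hE, rfl⟩ _ ⟨m', l', E', hl', hE', rfl⟩ -
  let l₂ : α → Fin (m * m') := fun x => finProdFinEquiv (l x, l' x)
  have hl₂ : Measurable l₂ := (measurable_of_countable finProdFinEquiv).comp (hl.prodMk hl')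
  obtain ⟨G, hG, hG2⟩ := exists_measurable_cells_eq (l := l) hl₂
    (fun b => (finProdFinEquiv.symm b).1) (fun x => by simp [l₂])
  obtain ⟨G', hG', hG2'⟩ := exists_measurable_cells_eq (l := l') hl₂
    (fun b => (finProdFinEquiv.symm b).2) (fun x => by simp [l₂])
  refine ⟨m * m', l₂, G ⁻¹' E ∩ G' ⁻¹' E', hl₂, (hG hE).inter (hG' hE'), ?_⟩
  ext n
  change (fun b => n (l ⁻¹' {b})) ∈ E ∧ (fun b => n (l' ⁻¹' {b})) ∈ E' ↔ _
  rw [hG2, hG2']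
  rfl

theorem generateFrom_isPartitionCylinder :
    MeasurableSpace.generateFrom {S : Set (Measure α) | IsPartitionCylinder S}
      = Measure.instMeasurableSpace := by
  classical
  refine le_antisymm (MeasurableSpace.generateFrom_le ?_) ?_
  · rintro _ ⟨m, l, E, hl, hE, rfl⟩
    exact measurable_cells hl hE
  · refine iSup₂_le fun A hA => ?_
    rintro _ ⟨E, hE, rfl⟩
    refine MeasurableSpace.measurableSet_generateFrom
      ⟨2, fun x => if x ∈ A then 0 else 1, {v | v 0 ∈ E},
        Measurable.ite hA measurable_const measurable_const, measurable_pi_apply 0 hE, ?_⟩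
    ext n
    have : (fun x => if x ∈ A then (0 : Fin 2) else 1) ⁻¹' {0} = A := by
      ext x
      by_cases hx : x ∈ A <;> simp [hx]
    change n A ∈ E ↔ n ((fun x => if x ∈ A then (0 : Fin 2) else 1) ⁻¹' {0}) ∈ E
    rw [this]

theorem isPartitionCylinder_univ : IsPartitionCylinder (univ : Set (Measure α)) :=
  ⟨1, fun _ => 0, univ, measurable_const, MeasurableSet.univ, by simp⟩

/-- Finite measures on `Measure α × α` agree if they agree on rectangles over partition
cylinders. -/
theorem ext_of_partitionCylinder {μ ν : Measure (Measure α × α)} [IsFiniteMeasure μ]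
    (h : ∀ S C, IsPartitionCylinder S → MeasurableSet C → μ (S ×ˢ C) = ν (S ×ˢ C)) : μ = ν := by
  have hgen := generateFrom_eq_prod (generateFrom_isPartitionCylinder (α := α))
    (MeasurableSpace.generateFrom_measurableSet (α := α))
    ⟨fun _ => univ, fun _ => isPartitionCylinder_univ, iUnion_const _⟩
    ⟨fun _ => univ, fun _ => MeasurableSet.univ, iUnion_const _⟩
  refine ext_of_generate_finite _ hgen.symm
    (isPiSystem_isPartitionCylinder.prod MeasurableSpace.isPiSystem_measurableSet) ?_ ?_
  · rintro _ ⟨S, hS, C, hC, rfl⟩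
    exact h S C hS hC
  · rw [← univ_prod_univ]
    exact h _ _ isPartitionCylinder_univ MeasurableSet.univ

end Cylinders

theorem lintegral_mul_poissonMeasure (r : ℝ≥0) (φ : ℕ → ℝ≥0∞) :
    ∫⁻ k, φ k * k ∂(poissonMeasure r) = r * ∫⁻ k, φ (k + 1) ∂(poissonMeasure r) := by
  rw [lintegral_countable', lintegral_countable', tsum_eq_zero_add' ENNReal.summable,
    ← ENNReal.tsum_mul_left]
  simp only [CharP.cast_eq_zero, mul_zero, zero_mul, zero_add]
  refine tsum_congr fun k => ?_
  have h : ((k + 1 : ℕ) : ℝ≥0∞) * poissonMeasure r {k + 1} = r * poissonMeasure r {k} := by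
    rw [poissonMeasure_singleton, poissonMeasure_singleton, ← ENNReal.ofReal_natCast,
      ← ENNReal.ofReal_coe_nnreal, ← ENNReal.ofReal_mul (by positivity),
      ← ENNReal.ofReal_mul (by positivity)]
    congr 1
    rw [Nat.factorial_succ]
    push_cast
    field_simp
    ring
  rw [mul_assoc, h]
  ring

namespace IsPoissonProcess

variable {d : ℕ} {Ω : Type*} [MeasurableSpace Ω] {P : Measure Ω} {N : Ω → Measure (Euc d)}
  {lam : Measure (Euc d)}

theorem measurable_eval (hN : Measurable N) {A : Set (Euc d)} (hA : MeasurableSet A) :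
    Measurable fun ω => N ω A := (Measure.measurable_coe hA).comp hN

theorem lintegral_law (h : IsPoissonProcess P N lam) {A : Set (Euc d)}
    (hA : MeasurableSet A) (hAl : lam A ≠ ∞) {φ : ℝ≥0∞ → ℝ≥0∞} (hφ : Measurable φ) :
    ∫⁻ k, φ k ∂(P.map fun ω => N ω A) = ∫⁻ k : ℕ, φ k ∂(poissonMeasure (lam A).toNNReal) := by
  rw [h.law A hA hAl, lintegral_map hφ (measurable_of_countable _)]

theorem ae_lt_top (h : IsPoissonProcess P N lam) (hN : Measurable N) {A : Set (Euc d)}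
    (hA : MeasurableSet A) (hAl : lam A ≠ ∞) : ∀ᵐ ω ∂P, N ω A < ∞ := by
  have h1 : ∀ᵐ k ∂(P.map fun ω => N ω A), k < ∞ := by
    rw [h.law A hA hAl, ae_map_iff (measurable_of_countable _).aemeasurable measurableSet_Iio]
    exact Eventually.of_forall fun k => ENNReal.natCast_lt_top k
  exact ae_of_ae_map (measurable_eval hN hA).aemeasurable h1

theorem congr (h : IsPoissonProcess P N lam) {N' : Ω → Measure (Euc d)} (hN : N =ᵐ[P] N') :
    IsPoissonProcess P N' lam := by
  refine ⟨fun A hA hAl => ?_, fun n A hA hd => ?_⟩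
  · rw [← h.law A hA hAl]
    exact Measure.map_congr (hN.mono fun ω hω => by simp only [hω])
  · exact (h.indep n A hA hd).congr fun i => hN.mono fun ω hω => by simp only [hω]

/-- The masses of the cells of a partition disjoint from `C` are independent of the mass of `C`. -/
theorem indepFun_cells (h : IsPoissonProcess P N lam) (hN : Measurable N) {m : ℕ}
    {B : Fin m → Set (Euc d)} {C : Set (Euc d)} (hB : ∀ b, MeasurableSet (B b))
    (hC : MeasurableSet C) (hd : Pairwise fun i j => Disjoint (B i) (B j))
    (hBC : ∀ b, Disjoint (B b) C) : IndepFun (fun ω b => N ω (B b)) (fun ω => N ω C) P := by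
  let A : Fin (m + 1) → Set (Euc d) := Fin.cons C B
  have hA : ∀ i, MeasurableSet (A i) := Fin.cases hC hB
  have hAd : Pairwise fun i j => Disjoint (A i) (A j) := by
    intro i j hij
    induction i using Fin.cases with
    | zero =>
      induction j using Fin.cases with
      | zero => exact absurd rfl hij
      | succ j => exact (hBC j).symm
    | succ i =>
      induction j using Fin.cases with
      | zero => exact hBC i
      | succ j => exact hd fun hcon => hij (congrArg Fin.succ hcon)
  have h1 := (h.indep _ A hA hAd).indepFun_finset (Finset.univ.erase 0) {0} (by simp)
    fun i => measurable_eval hN (hA i)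
  have hφ : Measurable fun (v : (Finset.univ.erase (0 : Fin (m + 1)) : Finset _) → ℝ≥0∞)
      (b : Fin m) => v ⟨b.succ, by simp⟩ :=
    measurable_pi_lambda _ fun b => measurable_pi_apply _
  have hψ : Measurable fun v : (({0} : Finset (Fin (m + 1))) → ℝ≥0∞) => v ⟨0, by simp⟩ :=
    measurable_pi_apply _
  exact h1.comp hφ hψ

variable [IsProbabilityMeasure P]

/-- Mecke's formula for functions of the masses of the cells of a finite partition, and a set `C`
contained in one of the cells. -/
theorem lintegral_cells_mul (h : IsPoissonProcess P N lam) (hN : Measurable N) {m : ℕ}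
    {l : Euc d → Fin m} (hl : Measurable l) {φ : (Fin m → ℝ≥0∞) → ℝ≥0∞} (hφ : Measurable φ)
    {C : Set (Euc d)} (hC : MeasurableSet C) (hCl : lam C ≠ ∞) {b₀ : Fin m}
    (hCb : C ⊆ l ⁻¹' {b₀}) :
    ∫⁻ ω, φ (fun b => N ω (l ⁻¹' {b})) * N ω C ∂P
      = lam C * ∫⁻ ω, φ ((fun b => N ω (l ⁻¹' {b})) + Pi.single b₀ 1) ∂P := by
  classical
  have hlm : ∀ b, MeasurableSet (l ⁻¹' {b}) := fun b => hl (measurableSet_singleton b)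
  have hind := h.indepFun_cells hN (B := fun b => l ⁻¹' {b} \ C) (C := C)
    (fun b => (hlm b).diff hC) hC
    (fun i j hij => ((disjoint_singleton.2 hij).preimage l).mono sdiff_subset sdiff_subset)
    fun b => disjoint_sdiff_left
  have hW : Measurable fun ω => fun b => N ω (l ⁻¹' {b} \ C) :=
    measurable_pi_lambda _ fun b => measurable_eval hN ((hlm b).diff hC)
  have hK : Measurable fun ω => N ω C := measurable_eval hN hC
  have hdec : ∀ ω, (fun b => N ω (l ⁻¹' {b})) = (fun b => N ω (l ⁻¹' {b} \ C))
      + Pi.single b₀ (N ω C) := fun ω => by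
    funext b
    rw [Pi.add_apply]
    by_cases hb : b = b₀
    · subst hb
      rw [Pi.single_eq_same, ← measure_sdiff_add_inter (l ⁻¹' {b}) hC, inter_eq_right.2 hCb]
    · rw [Pi.single_eq_of_ne hb, add_zero, sdiff_eq_left.2]
      exact ((disjoint_singleton.2 hb).preimage l).mono_right hCb
  have hs : Measurable fun q : (Fin m → ℝ≥0∞) × ℝ≥0∞ => q.1 + Pi.single b₀ q.2 :=
    measurable_fst.add ((measurable_pi_lambda _ fun b => by
      by_cases hb : b = b₀
      · subst hb; simpa using measurable_snd
      · simp [Pi.single_eq_of_ne hb]) : Measurable fun q : (Fin m → ℝ≥0∞) × ℝ≥0∞ =>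
        (Pi.single b₀ q.2 : Fin m → ℝ≥0∞))
  have hΦ : Measurable fun q : (Fin m → ℝ≥0∞) × ℝ≥0∞ => φ (q.1 + Pi.single b₀ q.2) := hφ.comp hs
  have hΦ1 : Measurable fun q : (Fin m → ℝ≥0∞) × ℝ≥0∞ => φ (q.1 + Pi.single b₀ (q.2 + 1)) :=
    hΦ.comp (measurable_fst.prodMk (measurable_snd.add_const 1))
  have hmap := (indepFun_iff_map_prod_eq_prod_map_map hW.aemeasurable hK.aemeasurable).1 hind
  have hpk : IsProbabilityMeasure (P.map fun ω => N ω C) :=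
    Measure.isProbabilityMeasure_map hK.aemeasurable
  have key : ∀ {ψ : (Fin m → ℝ≥0∞) × ℝ≥0∞ → ℝ≥0∞}, Measurable ψ →
      ∫⁻ ω, ψ (fun b => N ω (l ⁻¹' {b} \ C), N ω C) ∂P
        = ∫⁻ w, ∫⁻ k : ℕ, ψ (w, k) ∂(poissonMeasure (lam C).toNNReal)
          ∂(P.map fun ω b => N ω (l ⁻¹' {b} \ C)) := fun {ψ} hψ => by
    have e := lintegral_map (μ := P) hψ (hW.prodMk hK)
    rw [← e, hmap, lintegral_prod _ hψ.aemeasurable]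
    exact lintegral_congr fun w => h.lintegral_law hC hCl (hψ.comp measurable_prodMk_left)
  have e1 : ∀ ω, φ (fun b => N ω (l ⁻¹' {b})) * N ω C
      = (fun q : (Fin m → ℝ≥0∞) × ℝ≥0∞ => φ (q.1 + Pi.single b₀ q.2) * q.2)
        (fun b => N ω (l ⁻¹' {b} \ C), N ω C) := fun ω => by rw [hdec]
  have e2 : ∀ ω, φ ((fun b => N ω (l ⁻¹' {b})) + Pi.single b₀ 1)
      = (fun q : (Fin m → ℝ≥0∞) × ℝ≥0∞ => φ (q.1 + Pi.single b₀ (q.2 + 1)))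
        (fun b => N ω (l ⁻¹' {b} \ C), N ω C) := fun ω => by
    rw [hdec, add_assoc, ← Pi.single_add]
  rw [(lintegral_congr e1).trans (key (hΦ.mul measurable_snd)),
    (lintegral_congr e2).trans (key hΦ1)]
  simp only [Pi.mul_apply]
  have e3 : ∀ w, ∫⁻ k : ℕ, φ (w + (Pi.single b₀ (k : ℝ≥0∞) : Fin m → ℝ≥0∞)) * k ∂(poissonMeasure (lam C).toNNReal)
      = lam C * ∫⁻ k : ℕ, φ (w + (Pi.single b₀ ((k : ℝ≥0∞) + 1) : Fin m → ℝ≥0∞))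
        ∂(poissonMeasure (lam C).toNNReal) := fun w => by
    have := lintegral_mul_poissonMeasure (lam C).toNNReal fun k =>
      φ (w + (Pi.single b₀ (k : ℝ≥0∞) : Fin m → ℝ≥0∞))
    simpa [ENNReal.coe_toNNReal hCl] using this
  simp_rw [e3]
  refine lintegral_const_mul _ ?_
  exact (hΦ1.comp (measurable_fst.prodMk
    ((measurable_of_countable _).comp measurable_snd))).lintegral_prod_right'

/-- Mecke's formula for functions of the masses of the cells of a finite partition, and an arbitrary
set `C` of finite intensity: `C` is cut into its intersections with the cells. -/
theorem lintegral_cells_mul_eq (h : IsPoissonProcess P N lam) (hN : Measurable N) {m : ℕ}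
    {l : Euc d → Fin m} (hl : Measurable l) {φ : (Fin m → ℝ≥0∞) → ℝ≥0∞} (hφ : Measurable φ)
    {C : Set (Euc d)} (hC : MeasurableSet C) (hCl : lam C ≠ ∞) :
    ∫⁻ ω, φ (fun b => N ω (l ⁻¹' {b})) * N ω C ∂P
      = ∫⁻ ω, ∫⁻ u in C, φ (fun b => (N ω + Measure.dirac u) (l ⁻¹' {b})) ∂lam ∂P := by
  classical
  have hlm : ∀ b, MeasurableSet (l ⁻¹' {b}) := fun b => hl (measurableSet_singleton b)
  have hsum : ∀ n : Measure (Euc d), n C = ∑ b, n (l ⁻¹' {b} ∩ C) := fun n => by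
    have := sum_measure_preimage_singleton (μ := n.restrict C) Finset.univ fun b _ => hlm b
    simpa [Measure.restrict_apply (hlm _)] using this.symm
  have hφN : Measurable fun ω => φ fun b => N ω (l ⁻¹' {b}) := hφ.comp ((measurable_cells hl).comp hN)
  have hφ1 : ∀ b₀, Measurable fun ω => φ ((fun b => N ω (l ⁻¹' {b})) + Pi.single b₀ 1) := fun b₀ =>
    hφ.comp (((measurable_cells hl).comp hN).add_const _)
  have hcell : ∀ ω u, (fun b => (N ω + Measure.dirac u) (l ⁻¹' {b}))
      = (fun b => N ω (l ⁻¹' {b})) + Pi.single (l u) 1 := fun ω u => by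
    funext b
    rw [Measure.add_apply, Measure.dirac_apply' _ (hlm b), Pi.add_apply]
    congr 1
    by_cases hb : l u = b
    · subst hb; simp
    · rw [Pi.single_eq_of_ne (Ne.symm hb), indicator_of_notMem (by simpa using hb)]
  have hin : ∀ ω, ∫⁻ u in C, φ (fun b => (N ω + Measure.dirac u) (l ⁻¹' {b})) ∂lam
      = ∑ b₀, φ ((fun b => N ω (l ⁻¹' {b})) + Pi.single b₀ 1) * lam (l ⁻¹' {b₀} ∩ C) := fun ω => by
    simp_rw [hcell]
    have e := lintegral_map (μ := lam.restrict C) (measurable_of_countable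
      fun b₀ => φ ((fun b => N ω (l ⁻¹' {b})) + Pi.single b₀ 1)) hl
    rw [← e, lintegral_fintype]
    refine Finset.sum_congr rfl fun b₀ _ => ?_
    rw [Measure.map_apply hl (measurableSet_singleton b₀), Measure.restrict_apply (hlm b₀)]
  simp_rw [hin]
  rw [lintegral_finsetSum _ fun b₀ _ => (hφ1 b₀).mul_const _]
  have hl1 : ∀ ω, φ (fun b => N ω (l ⁻¹' {b})) * N ω C
      = ∑ b₀, φ (fun b => N ω (l ⁻¹' {b})) * N ω (l ⁻¹' {b₀} ∩ C) := fun ω => by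
    rw [hsum, Finset.mul_sum]
  simp_rw [hl1]
  have hφl : ∀ b₀, Measurable fun ω => φ (fun b => N ω (l ⁻¹' {b})) * N ω (l ⁻¹' {b₀} ∩ C) :=
    fun b₀ => hφN.mul (measurable_eval hN ((hlm b₀).inter hC))
  rw [lintegral_finsetSum _ fun b₀ _ => hφl b₀]
  refine Finset.sum_congr rfl fun b₀ _ => ?_
  rw [h.lintegral_cells_mul hN hl hφ ((hlm b₀).inter hC) (measure_ne_top_of_subset inter_subset_right hCl)
    inter_subset_left, lintegral_mul_const _ (hφ1 b₀), mul_comm]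

/-- Mecke's formula on a set of finite intensity, by uniqueness of finite measures. -/
theorem lintegral_restrict_eq (h : IsPoissonProcess P N lam) (hN : Measurable N)
    {D : Set (Euc d)} (hD : MeasurableSet D) (hDl : lam D ≠ ∞) (hDN : ∀ ω, N ω D < ∞)
    {k : Measure (Euc d) × Euc d → ℝ≥0∞} (hk : Measurable k) :
    Measurable (fun ω => ∫⁻ u in D, k (N ω, u) ∂(N ω)) ∧
    ∫⁻ ω, ∫⁻ u in D, k (N ω, u) ∂(N ω) ∂P
      = ∫⁻ ω, ∫⁻ u in D, k (N ω + Measure.dirac u, u) ∂lam ∂P := by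
  classical
  let ρ : Ω → Measure (Measure (Euc d) × Euc d) := fun ω =>
    ((N ω).restrict D).map fun u => (N ω, u)
  have hfin : ∀ ω, IsFiniteMeasure ((N ω).restrict D) := fun ω =>
    ⟨by rw [Measure.restrict_apply_univ]; exact hDN ω⟩
  have hρfin : ∀ ω, IsFiniteMeasure (ρ ω) := fun ω => Measure.isFiniteMeasure_map _ _
  have hlamD : IsFiniteMeasure (lam.restrict D) :=
    ⟨by rw [Measure.restrict_apply_univ]; exact hDl.lt_top⟩
  have hrect : ∀ ω S C, MeasurableSet S → MeasurableSet C →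
      ρ ω (S ×ˢ C) = S.indicator 1 (N ω) * N ω (C ∩ D) := fun ω S C hS hC => by
    rw [Measure.map_apply measurable_prodMk_left (hS.prod hC)]
    by_cases hω : N ω ∈ S
    · rw [mk_preimage_prod_right hω, indicator_of_mem hω, Pi.one_apply, one_mul,
        Measure.restrict_apply hC]
    · rw [mk_preimage_prod_right_eq_empty hω, indicator_of_notMem hω, zero_mul, measure_empty]
  have hρ : Measurable ρ := by
    refine Measurable.measure_of_isPiSystem generateFrom_prod.symm isPiSystem_prod ?_ ?_
    · rintro _ ⟨S, hS : MeasurableSet S, C, hC : MeasurableSet C, rfl⟩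
      simp_rw [hrect _ S C hS hC]
      exact ((measurable_one.indicator hS).comp hN).mul (measurable_eval hN (hC.inter hD))
    · simp_rw [← univ_prod_univ, hrect _ univ univ MeasurableSet.univ MeasurableSet.univ]
      exact ((measurable_one.indicator MeasurableSet.univ).comp hN).mul
        (measurable_eval hN (MeasurableSet.univ.inter hD))
  have hadd : Measurable fun q : Ω × Euc d => (N q.1 + Measure.dirac q.2, q.2) :=
    ((hN.comp measurable_fst).add (Measure.measurable_dirac.comp measurable_snd)).prodMk
      measurable_snd
  have hkρ : ∀ {k : Measure (Euc d) × Euc d → ℝ≥0∞}, Measurable k → ∀ ω,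
      ∫⁻ q, k q ∂(ρ ω) = ∫⁻ u in D, k (N ω, u) ∂(N ω) := fun hk ω =>
    lintegral_map hk measurable_prodMk_left
  have hkadd : ∀ {k : Measure (Euc d) × Euc d → ℝ≥0∞}, Measurable k →
      ∫⁻ q, k q ∂((P.prod (lam.restrict D)).map
        fun q : Ω × Euc d => (N q.1 + Measure.dirac q.2, q.2))
        = ∫⁻ ω, ∫⁻ u in D, k (N ω + Measure.dirac u, u) ∂lam ∂P := fun hk =>
    (lintegral_map hk hadd).trans (lintegral_prod _ (hk.comp hadd).aemeasurable)
  have heq : (P.prod (lam.restrict D)).map (fun q : Ω × Euc d => (N q.1 + Measure.dirac q.2, q.2))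
      = P.bind ρ := by
    refine ext_of_partitionCylinder ?_
    rintro _ C ⟨m, l, E, hl, hE, rfl⟩ hC
    have hφ : Measurable (E.indicator (1 : (Fin m → ℝ≥0∞) → ℝ≥0∞)) := measurable_one.indicator hE
    have hS : MeasurableSet {n : Measure (Euc d) | (fun b => n (l ⁻¹' {b})) ∈ E} :=
      measurable_cells hl hE
    rw [Measure.bind_apply (hS.prod hC) hρ.aemeasurable]
    simp_rw [hrect _ _ C hS hC]
    have e := h.lintegral_cells_mul_eq hN hl hφ (hC.inter hD)
      (measure_ne_top_of_subset inter_subset_right hDl)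
    refine Eq.trans ?_ e.symm
    rw [← lintegral_indicator_one (hS.prod hC), hkadd (measurable_one.indicator (hS.prod hC))]
    refine lintegral_congr fun ω => ?_
    rw [← Measure.restrict_restrict hC, ← lintegral_indicator hC]
    refine lintegral_congr fun u => ?_
    by_cases hu : u ∈ C
    · rw [indicator_of_mem hu]
      by_cases hE' : (fun b => (N ω + Measure.dirac u) (l ⁻¹' {b})) ∈ E
      · rw [indicator_of_mem hE', indicator_of_mem (s := {n : Measure (Euc d) |
          (fun b => n (l ⁻¹' {b})) ∈ E} ×ˢ C) (mk_mem_prod hE' hu)]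
        rfl
      · rw [indicator_of_notMem hE', indicator_of_notMem fun hcon => hE' hcon.1]
    · rw [indicator_of_notMem hu, indicator_of_notMem fun hcon => hu hcon.2]
  refine ⟨?_, ?_⟩
  · simp_rw [← hkρ hk]
    exact (Measure.measurable_lintegral hk).comp hρ
  · simp_rw [← hkρ hk]
    rw [← Measure.lintegral_bind hρ.aemeasurable hk.aemeasurable, ← heq, hkadd hk]

/-- Mecke's formula: the reduced Palm measures of a Poisson process are its own law, so that the
process is coupled with them by itself. -/
theorem isReducedPalmCoupling [SigmaFinite lam] (h : IsPoissonProcess P N lam)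
    (hN : Measurable N) : IsReducedPalmCoupling P N lam fun _ => N := by
  classical
  refine ⟨hN.comp measurable_snd, fun k hk => ?_⟩
  let D : ℕ → Set (Euc d) := disjointed (spanningSets lam)
  have hD : ∀ i, MeasurableSet (D i) := MeasurableSet.disjointed (measurableSet_spanningSets lam)
  have hDl : ∀ i, lam (D i) ≠ ∞ := fun i => measure_ne_top_of_subset (disjointed_subset _ i)
    (measure_spanningSets_lt_top lam i).ne
  have hDd : Pairwise fun i j => Disjoint (D i) (D j) := disjoint_disjointed _
  have hDu : ⋃ i, D i = univ := by rw [iUnion_disjointed, iUnion_spanningSets]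
  -- a version of `N` with finite mass on all the sets `D i`
  let G : Set Ω := {ω | ∀ i, N ω (D i) < ∞}
  have hG : MeasurableSet G := by
    have : G = ⋂ i, {ω | N ω (D i) < ∞} := by ext; simp [G]
    rw [this]
    exact MeasurableSet.iInter fun i => measurableSet_lt (measurable_eval hN (hD i)) measurable_const
  have hGae : ∀ᵐ ω ∂P, ω ∈ G := ae_all_iff.2 fun i => h.ae_lt_top hN (hD i) (hDl i)
  let N' : Ω → Measure (Euc d) := fun ω => if ω ∈ G then N ω else 0
  have hN' : Measurable N' := Measurable.ite hG hN measurable_const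
  have hNN' : N =ᵐ[P] N' := hGae.mono fun ω hω => (if_pos hω).symm
  have hDN : ∀ i ω, N' ω (D i) < ∞ := fun i ω => by
    by_cases hω : ω ∈ G
    · rw [show N' ω = N ω from if_pos hω]; exact hω i
    · rw [show N' ω = 0 from if_neg hω]; simp
  have h' := h.congr hNN'
  have hsplit : ∀ (n : Measure (Euc d)) (f : Euc d → ℝ≥0∞),
      ∫⁻ u, f u ∂n = ∑' i, ∫⁻ u in D i, f u ∂n := fun n f => by
    rw [← lintegral_iUnion hD hDd, hDu, Measure.restrict_univ]
  have hkadd : Measurable fun q : Ω × Euc d => k (N' q.1 + Measure.dirac q.2, q.2) :=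
    hk.comp (((hN'.comp measurable_fst).add (Measure.measurable_dirac.comp measurable_snd)).prodMk
      measurable_snd)
  calc ∫⁻ ω, ∫⁻ u, k (N ω, u) ∂(N ω) ∂P = ∫⁻ ω, ∫⁻ u, k (N' ω, u) ∂(N' ω) ∂P :=
        lintegral_congr_ae (hNN'.mono fun ω hω => by simp only [hω])
    _ = ∫⁻ ω, ∑' i, ∫⁻ u in D i, k (N' ω, u) ∂(N' ω) ∂P := by simp_rw [← hsplit]
    _ = ∑' i, ∫⁻ ω, ∫⁻ u in D i, k (N' ω, u) ∂(N' ω) ∂P := lintegral_tsum fun i =>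
        (h'.lintegral_restrict_eq hN' (hD i) (hDl i) (hDN i) hk).1.aemeasurable
    _ = ∑' i, ∫⁻ ω, ∫⁻ u in D i, k (N' ω + Measure.dirac u, u) ∂lam ∂P := tsum_congr fun i =>
        (h'.lintegral_restrict_eq hN' (hD i) (hDl i) (hDN i) hk).2
    _ = ∫⁻ ω, ∑' i, ∫⁻ u in D i, k (N' ω + Measure.dirac u, u) ∂lam ∂P :=
        (lintegral_tsum fun i => hkadd.lintegral_prod_right'.aemeasurable).symm
    _ = ∫⁻ ω, ∫⁻ u, k (N' ω + Measure.dirac u, u) ∂lam ∂P := by simp_rw [← hsplit]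
    _ = ∫⁻ ω, ∫⁻ u, k (N ω + Measure.dirac u, u) ∂lam ∂P :=
        lintegral_congr_ae (hNN'.mono fun ω hω => by simp only [hω])

end IsPoissonProcess


/-! ### Transfer from the law of the Gaussian process -/

section Transfer

open Cadlag

variable {T : ℝ} {p : ℕ} {Ω' : Type*} [MeasurableSpace Ω'] {Q : Measure Ω'} {Y : Ω' → Cadlag T p}
  {g : Cadlag T p → ℝ}

theorem integral_map_ouPoint (hY : AEMeasurable Y Q) (hgm : Measurable g) (w : Cadlag T p) (s : ℝ) :
    ∫ z, g (ouPoint w s z) ∂(Q.map Y) = ∫ ω, g (ouPoint w s (Y ω)) ∂Q :=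
  integral_map hY (hgm.comp (measurable_ouPoint_right w s)).aestronglyMeasurable

theorem steinSolution_eq_map (hY : AEMeasurable Y Q) (hgm : Measurable g) :
    steinSolution Q Y g = steinSolution (Q.map Y) id g := by
  funext w
  simp only [steinSolution, id_eq, integral_map_ouPoint hY hgm,
    integral_map hY hgm.aestronglyMeasurable]

theorem eq_zero_of_normM_eq_zero (hg : MemM g) (h : normM g = 0) : g = 0 := by
  funext w
  have h1 := hg.hasBounds.abs_le w
  rw [h, ENNReal.toReal_zero, zero_mul] at h1
  exact abs_nonpos_iff.1 h1

theorem meanPath_const [IsProbabilityMeasure Q] (x : Cadlag T p) :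
    meanPath Q (fun _ => x) = x := by
  have e : (fun s => ∫ _, x.path s ∂Q) = x.path := by
    funext s
    simp
  exact (congrArg toCadlag e).trans (toCadlag_path x)

theorem measurable_of_uncurry {d : ℕ} {J : Euc d → Cadlag T p}
    (h : Measurable fun q : Euc d × Icc (0 : ℝ) T => (J q.1).path q.2) : Measurable J :=
  measurable_iff.2 fun _ => h.comp measurable_prodMk_right

end Transfer

theorem theorem1p3 {T : ℝ} (hT : 0 < T) {p d : ℕ}
    -- the point process `N` with mean measure `lam`
    {Ω : Type*} [MeasurableSpace Ω] (P : Measure Ω) [IsProbabilityMeasure P]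
    (N : Ω → Measure (Euc d)) (hN : IsSimplePointProcess P N)
    (lam : Measure (Euc d)) [SigmaFinite lam] (hlam : HasMeanMeasure P N lam)
    (σ : ℝ) (hσ : 0 < σ)
    -- the functions `J_u`
    (J : Euc d → Cadlag T p)
    (hJmeas : Measurable fun q : Euc d × Icc (0 : ℝ) T => J q.1 q.2)
    (hJ2 : ∀ s, MemLp (fun u => J u s) 2 lam)
    (hJ1 : ∫⁻ u, ‖J u‖ₑ ∂lam < ∞)
    -- the functions `Ĵ_u`, the measure `Λ` and the Gaussian process `Z`
    (Jhat : Euc d → Cadlag T p) (Lam : Measure (Euc d))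
    (hJhatmeas : Measurable fun q : Euc d × Icc (0 : ℝ) T => Jhat q.1 q.2)
    (hJhat2 : ∀ s, MemLp (fun u => Jhat u s) 2 Lam)
    {Ω' : Type*} [MeasurableSpace Ω'] (Q : Measure Ω') [IsProbabilityMeasure Q]
    (Z : Icc (0 : ℝ) T → Ω' → Euc p) (hZ : IsCentredGaussianWithCov Q Z Jhat Lam)
    -- the test function
    (g : Cadlag T p → ℝ) (hg : MemM g) (hgmeas : Measurable g) :
    let Zp : Ω' → Cadlag T p := fun ω => toCadlag fun s => Z s ω
    let f : Cadlag T p → ℝ := steinSolution Q Zp g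
    let X : Ω → Cadlag T p := fun ω => integralPath J (N ω)
    let Xt : Ω → Cadlag T p := fun ω => centredPath J lam σ (N ω)
    let slam : Measure (Euc d) := ENNReal.ofReal ((σ ^ 2)⁻¹) • lam
    -- `E g(Z)` exists and the Stein solution is well defined and in `M`
    (Integrable (fun ω => g (Zp ω)) Q ∧
      (∀ w s, 0 < s → Integrable (fun ω => g (ouPoint w s (Zp ω))) Q) ∧
      (∀ w, IntegrableOn
        (fun s => (∫ ω, g (ouPoint w s (Zp ω)) ∂Q) - ∫ ω, g (Zp ω) ∂Q) (Ioi (0 : ℝ))) ∧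
      MemM f) ∧
    -- the bound for general couplings with the reduced Palm measures
    (∀ Nu : Euc d → Ω → Measure (Euc d), IsReducedPalmCoupling P N lam Nu →
      let Xu : Euc d → Ω → Cadlag T p := fun u ω => integralPath J (Nu u ω)
      let I3 : ℝ≥0∞ := ∫⁻ ω, ∫⁻ u, ‖J u‖ₑ * ‖Xu u ω - X ω + J u‖ₑ ^ 2 ∂slam ∂P
      -- if the last term is finite, all the expectations and integrals exist
      (I3 < ∞ →
        Integrable (fun ω => g (Xt ω)) P ∧
        (∀ᵐ u ∂lam, J u ≠ 0 →
          (∀ s, Integrable (fun ω => (Xu u ω - X ω) s) P) ∧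
          IsCadlag fun s => ∫ ω, (Xu u ω - X ω) s ∂P) ∧
        (∀ w, Integrable (fun u => D2 f w (Jhat u) (Jhat u)) Lam) ∧
        Integrable (fun ω => ∫ u, D2 f (Xt ω) (Jhat u) (Jhat u) ∂Lam) P ∧
        Integrable (fun q : Ω × Euc d => D2 f (Xt q.1) (J q.2)
          (meanPath P fun ω => Xu q.2 ω - X ω + J q.2)) (P.prod slam) ∧
        Integrable (fun q : Ω × Euc d => D2 f (Xt q.1) (J q.2)
          ((Xu q.2 q.1 - X q.1) - meanPath P fun ω => Xu q.2 ω - X ω)) (P.prod slam)) ∧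
      ENNReal.ofReal |(∫ ω, g (Xt ω) ∂P) - ∫ ω, g (Zp ω) ∂Q| ≤
        ENNReal.ofReal |∫ ω, ((∫ u, D2 f (Xt ω) (Jhat u) (Jhat u) ∂Lam)
          - ∫ u, D2 f (Xt ω) (J u) (meanPath P fun ω' => Xu u ω' - X ω' + J u) ∂slam) ∂P|
        + ENNReal.ofReal |∫ ω, ∫ u, D2 f (Xt ω) (J u)
            ((Xu u ω - X ω) - meanPath P fun ω' => Xu u ω' - X ω') ∂slam ∂P|
        + normM g / ENNReal.ofReal (2 * σ) * I3) ∧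
    -- the Poisson case
    (IsPoissonProcess P N lam → Lam = slam → Jhat = J →
      (∫⁻ u, ‖J u‖ₑ ^ 3 ∂slam < ∞ → Integrable (fun ω => g (Xt ω)) P) ∧
      ENNReal.ofReal |(∫ ω, g (Xt ω) ∂P) - ∫ ω, g (Zp ω) ∂Q| ≤
        normM g / ENNReal.ofReal (2 * σ) * ∫⁻ u, ‖J u‖ₑ ^ 3 ∂slam) := by
  intro Zp f X Xt slam
  have hJ : Measurable J := measurable_of_uncurry hJmeas
  have hJhat : Measurable Jhat := measurable_of_uncurry hJhatmeas
  have hNm := hN.measurable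
  have hZm : AEMeasurable Zp Q := hZ.aemeasurable_path
  have hγ : IsGaussianPathLaw (Q.map Zp) Jhat Lam := hZ.isGaussianPathLaw
  have hγP := hγ.isProbabilityMeasure
  have hγ3 := hγ.integrable_norm_pow_three hT.le
  have hgb := hg.hasBounds
  have hf : f = steinSolution (Q.map Zp) id g := steinSolution_eq_map hZm hgmeas
  have hgZ : ∫ z, g z ∂(Q.map Zp) = ∫ ω, g (Zp ω) ∂Q :=
    integral_map hZm hgmeas.aestronglyMeasurable
  have hσ2 : ENNReal.ofReal ((σ ^ 2)⁻¹) ≠ 0 := by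
    rw [Ne, ENNReal.ofReal_eq_zero, not_le]
    positivity
  have hgen : ∀ Nu : Euc d → Ω → Measure (Euc d), IsReducedPalmCoupling P N lam Nu →
      let Xu : Euc d → Ω → Cadlag T p := fun u ω => integralPath J (Nu u ω)
      let I3 : ℝ≥0∞ := ∫⁻ ω, ∫⁻ u, ‖J u‖ₑ * ‖Xu u ω - X ω + J u‖ₑ ^ 2 ∂slam ∂P
      (I3 < ∞ →
        Integrable (fun ω => g (Xt ω)) P ∧
        (∀ᵐ u ∂lam, J u ≠ 0 →
          (∀ s, Integrable (fun ω => (Xu u ω - X ω) s) P) ∧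
          IsCadlag fun s => ∫ ω, (Xu u ω - X ω) s ∂P) ∧
        (∀ w, Integrable (fun u => D2 f w (Jhat u) (Jhat u)) Lam) ∧
        Integrable (fun ω => ∫ u, D2 f (Xt ω) (Jhat u) (Jhat u) ∂Lam) P ∧
        Integrable (fun q : Ω × Euc d => D2 f (Xt q.1) (J q.2)
          (meanPath P fun ω => Xu q.2 ω - X ω + J q.2)) (P.prod slam) ∧
        Integrable (fun q : Ω × Euc d => D2 f (Xt q.1) (J q.2)
          ((Xu q.2 q.1 - X q.1) - meanPath P fun ω => Xu q.2 ω - X ω)) (P.prod slam)) ∧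
      ENNReal.ofReal |(∫ ω, g (Xt ω) ∂P) - ∫ ω, g (Zp ω) ∂Q| ≤
        ENNReal.ofReal |∫ ω, ((∫ u, D2 f (Xt ω) (Jhat u) (Jhat u) ∂Lam)
          - ∫ u, D2 f (Xt ω) (J u) (meanPath P fun ω' => Xu u ω' - X ω' + J u) ∂slam) ∂P|
        + ENNReal.ofReal |∫ ω, ∫ u, D2 f (Xt ω) (J u)
            ((Xu u ω - X ω) - meanPath P fun ω' => Xu u ω' - X ω') ∂slam ∂P|
        + normM g / ENNReal.ofReal (2 * σ) * I3 := by
    intro Nu h Xu I3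
    have hI3 : I3 = ENNReal.ofReal ((σ ^ 2)⁻¹)
        * ∫⁻ q, ‖J q.2‖ₑ * ‖palmIncrement J N Nu q‖ₑ ^ 2 ∂(P.prod lam) :=
      h.lintegral_incr_sq_eq hNm hJ hJ1 _
    rcases lt_or_ge I3 ∞ with hfin | hinf
    · have hfin2 : ∫⁻ q, ‖J q.2‖ₑ * ‖palmIncrement J N Nu q‖ₑ ^ 2 ∂(P.prod lam) < ∞ := by
        rw [hI3] at hfin
        exact ENNReal.lt_top_of_mul_ne_top_right hfin.ne hσ2
      have hm := h.hasPalmMoments hNm hJ hJ1 hfin2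
      obtain ⟨h1, h2, h3, h4⟩ := hm.stein_bound h hT.le hNm hJ hJ1 hσ hJhat hJhat2 hγ hgb hgmeas hf
        (slam := slam) rfl
      obtain ⟨⟨c', hfb⟩, -⟩ := hgb.steinSolution_hasBounds hgmeas hγ3
      rw [← hf] at hfb
      refine ⟨fun _ => ⟨hm.integrable_comp_centredPath h hNm hJ hJ1 hgb hgmeas, ?_, fun w => ?_,
        h1, h2, h3⟩, ?_⟩
      · exact (hm.ae_meanPath h hNm hJ hJ1).mono fun u hu hJu => (hu hJu).1
      · exact (hγ.integral_bilin hT.le hJhat hJhat2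
          (D2_symm hfb.differentiable hfb.differentiable_fderiv w)).1
      · have i1 := hm.integrable_norm_mul_incr_sq h hNm hJ
        have e1 : ∫⁻ q, ‖J q.2‖ₑ * ‖palmIncrement J N Nu q‖ₑ ^ 2 ∂(P.prod lam)
            = ENNReal.ofReal (∫ q, ‖J q.2‖ * ‖palmIncrement J N Nu q‖ ^ 2 ∂(P.prod lam)) := by
          rw [ofReal_integral_eq_lintegral_ofReal i1 (Eventually.of_forall fun q => by positivity)]
          refine lintegral_congr fun q => ?_
          rw [ENNReal.ofReal_mul (norm_nonneg _), ENNReal.ofReal_pow (norm_nonneg _),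
            ofReal_norm, ofReal_norm]
        have hr : 0 ≤ ∫ q, ‖J q.2‖ * ‖palmIncrement J N Nu q‖ ^ 2 ∂(P.prod lam) :=
          integral_nonneg fun q => by positivity
        have hcM : normM g = ENNReal.ofReal (normM g).toReal :=
          (ENNReal.ofReal_toReal hg.normM_lt_top.ne).symm
        have hc := hgb.nonneg
        generalize (normM g).toReal = c at h4 hcM hc
        rw [hgZ] at h4
        refine (ENNReal.ofReal_le_ofReal h4).trans ?_
        refine ENNReal.ofReal_add_le.trans (add_le_add ENNReal.ofReal_add_le ?_)
        rw [hI3, e1, ← ENNReal.ofReal_mul (by positivity), hcM,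
          ← ENNReal.ofReal_div_of_pos (by positivity), ← ENNReal.ofReal_mul (by positivity)]
        refine ENNReal.ofReal_le_ofReal (mul_le_mul_of_nonneg_right ?_ (by positivity))
        -- the constant obtained is `c / (3σ)`, the bound claims `c / (2σ)`
        rw [div_div]
        gcongr
        norm_num
    · have htop : I3 = ∞ := top_le_iff.1 hinf
      refine ⟨fun hlt => absurd htop hlt.ne, ?_⟩
      rcases eq_or_ne (normM g) 0 with h0 | h0
      -- `0 * ∞ = 0`, but `‖g‖_M = 0` means `g = 0`
      · simp [eq_zero_of_normM_eq_zero hg h0]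
      · rw [htop, ENNReal.mul_top (ENNReal.div_ne_zero.2 ⟨h0, ENNReal.ofReal_ne_top⟩), add_top]
        exact le_top
  refine ⟨⟨?_, fun w s hs => ?_, fun w => ?_, ?_⟩, hgen, fun hpois hLam hJJ => ?_⟩
  · exact (hgb.integrable_self hgmeas hγ3).comp_aemeasurable hZm
  · exact (hgb.integrable_ou hgmeas hγ3 w hs.le).comp_aemeasurable hZm
  · have h1 := hgb.integrableOn_ou hgmeas hγ3 w
    simp only [integral_map_ouPoint hZm hgmeas, hgZ] at h1
    exact h1
  · obtain ⟨⟨c', hfb⟩, -⟩ := hgb.steinSolution_hasBounds hgmeas hγ3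
    rw [hf]
    exact hfb.memM
  · obtain ⟨h1, h2⟩ := hgen (fun _ => N) (hpois.isReducedPalmCoupling hNm)
    subst hJJ
    -- with `Nᵘ = N` the increments `Xᵘ - X + J_u` are the deterministic `J_u`
    have e0 : ∀ u ω, integralPath Jhat (N ω) - X ω + Jhat u = Jhat u := fun u ω => by
      simp [X]
    have e1 : ∀ u, (meanPath P fun ω => integralPath Jhat (N ω) - X ω + Jhat u) = Jhat u :=
      fun u => by simp_rw [e0]; exact meanPath_const _
    have e2 : ∀ ω, integralPath Jhat (N ω) - X ω = 0 := fun ω => sub_self _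
    have e3 : ∫⁻ ω, ∫⁻ u, ‖Jhat u‖ₑ * ‖integralPath Jhat (N ω) - X ω + Jhat u‖ₑ ^ 2 ∂slam ∂P
        = ∫⁻ u, ‖Jhat u‖ₑ ^ 3 ∂slam := by
      simp_rw [e0, lintegral_const, measure_univ, mul_one, pow_succ' _ 2]
    simp only [e3, e1, hLam, sub_self, integral_zero, abs_zero, ENNReal.ofReal_zero, zero_add] at h1 h2
    simp only [e2, meanPath_const, sub_self, map_zero, integral_zero, abs_zero, ENNReal.ofReal_zero,
      zero_add] at h2
    exact ⟨fun hlt => (h1 hlt).1, h2⟩
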